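/- Let $G=SL(2,\mathbb{R})$, $h_t=\begin{pmatrix}1&t\\0&1\end{pmatrix}$, $a_t=\begin{pmatrix}e^{t/2}&0\\0&e^{-t/2}\end{pmatrix}$, and let $\Gamma\subset G$ be a co-compact arithmetic lattice: $\Gamma$ is discrete, $X=G/\Gamma$ is compact, and $\Gamma$ is commensurable with the image in $G$ of the group of norm-one elements of the order $\mathcal{O}_F+\mathcal{O}_F i+\mathcal{O}_F j+\mathcal{O}_F ij$ (where $i^2=\alpha$, $j^2=\beta$, $ij=-ji$, with $\alpha,\beta\in\mathcal{O}_F\setminus\{0\}$) of a quaternion algebra $A$ over a totally real number field $F$, under a homomorphism $A\to M_2(\mathbb{R})$ that is $F$-linear with respect to a real embedding $\sigma_0$ of $F$, where $A$ is ramified at every other real embedding $\sigma\ne\sigma_0$ of $F$ (that is, $\sigma(\alpha)<0$ and $\sigma(\beta)<0$). Let $d_G$ be the right-invariant Riemannian metric on $G$ given by the inner product $\mathrm{tr}(AB^{t})$ on $\mathfrak{sl}(2,\mathbb{R})$, let $d_X$ be the induced quotient metric on $X$, and let $d_{X\times X}$ be the maximum of the distances of the two coordinates. Let $H=\{(g,g):g\in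 G\}$, fix a Haar measure on $H\cong G$, and let $\mathrm{vol}(H.(x_0,y_0))$ be the volume of the orbit $H.(x_0,y_0)\subset X\times X$, i.e. the covolume of the stabilizer of $(x_0,y_0)$ in $H$. Let $\|g\|$ denote the largest absolute value of a matrix entry of the components of $g\in G\times G$. For $A_1,A_2,R,T>0$, say that $(x,y)\in X\times X$ satisfies E2 if there is $(x_0,y_0)\in X\times X$ with $\mathrm{vol}(H.(x_0,y_0))\le R^{A_1}$ such that for every $r\in[0,T]$ there is $g\in G\times G$ with $\|g\|<R^{A_1}$ and $$d_{X\times X}\big((h_sx,h_sy),\,gH.(x_0,y_0)\big)\le R^{A_1}\Big(\frac{1+|s-r|}{T}\Big)^{1/A_2}\qquad\text{for all } s\in[0,T].$$ **Lemma.** For all $A_1,A_2>0$ there is $\delta_0>0$ such that for every $\delta\in(0,\delta_0)$ there is $T_0$ with the following property. For every $T\ge T_0$, every $x\in X$ and all positive integers (in particular, all primes) $p\neq q$ with $p,q\le T^{\delta^2}$, the point $(a_{-\log p}x,\,a_{-\log q}x)$ does not satisfy E2 with $R=T^{\delta/(1000A_1A_2)}$. Here $\delta_0$ may depend on $\Gamma$,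 $A_1$, $A_2$ and the choice of Haar measure, and $T_0$ on these and $\delta$, but neither depends on $x$, $p$, $q$. -/

import Mathlib

open MeasureTheory
open scoped ENNReal Quaternion

noncomputable section

namespace Horocycle

/-- The group `G = SL(2, ℝ)`. -/
abbrev G : Type := Matrix.SpecialLinearGroup (Fin 2) ℝ

/-- The (unstable) horocycle flow `h_t`, the upper triangular unipotent matrix with entry `t`. -/
def h (t : ℝ) : G :=
  ⟨!![1, t; 0, 1], by simp [Matrix.det_fin_two]⟩

/-- The geodesic flow `a_t = diag(e^{t/2}, e^{-t/2})`. -/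
def a (t : ℝ) : G :=
  ⟨!![Real.exp (t / 2), 0; 0, Real.exp (-t / 2)], by
    rw [Matrix.det_fin_two_of, ← Real.exp_add, mul_zero, sub_zero, ← add_div, add_neg_cancel,
      zero_div, Real.exp_zero]⟩

/-! ### Arithmetic lattices -/

/-- For a number field `F`, a quaternion algebra `A = (α, β / F)` with basis `1, i, j, k = ij`,
`i² = α`, `j² = β`, where `α`, `β` are algebraic integers, and a ring homomorphism
`φ : A → M₂(ℝ)`: the image in `SL(2, ℝ)` of the group of elements of reduced norm one in the
order `𝓞_F + 𝓞_F i + 𝓞_F j + 𝓞_F k`. The reduced norm of `u` is `u * star u`. -/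
def normOneUnits {F : Type} [Field F] (α β : F) (hα : IsIntegral ℤ α) (hβ : IsIntegral ℤ β)
    (φ : ℍ[F,α,β] →+* Matrix (Fin 2) (Fin 2) ℝ) : Subgroup G where
  carrier := {g | ∃ u : ℍ[F,α,β],
    (IsIntegral ℤ u.re ∧ IsIntegral ℤ u.imI ∧ IsIntegral ℤ u.imJ ∧ IsIntegral ℤ u.imK) ∧
      u * star u = 1 ∧ φ u = (g : Matrix (Fin 2) (Fin 2) ℝ)}
  one_mem' := ⟨1, by simp [isIntegral_one, isIntegral_zero], by simp, by simp⟩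
  mul_mem' := by
    rintro g g' ⟨u, ⟨h1, h2, h3, h4⟩, hu, hg⟩ ⟨v, ⟨k1, k2, k3, k4⟩, hv, hg'⟩
    refine ⟨u * v, ⟨?_, ?_, ?_, ?_⟩, ?_, ?_⟩
    · simp only [QuaternionAlgebra.re_mul]
      exact (((h1.mul k1).add ((hα.mul h2).mul k2)).add ((hβ.mul h3).mul k3)).add
        (((isIntegral_zero.mul hβ).mul h3).mul k4) |>.sub (((hα.mul hβ).mul h4).mul k4)
    · simp only [QuaternionAlgebra.imI_mul, zero_mul, add_zero]
      exact (((h1.mul k2).add (h2.mul k1)).sub ((hβ.mul h3).mul k4)).add ((hβ.mul h4).mul k3)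
    · simp only [QuaternionAlgebra.imJ_mul, zero_mul, add_zero]
      exact (((h1.mul k3).add ((hα.mul h2).mul k4)).add (h3.mul k1)).sub ((hα.mul h4).mul k2)
    · simp only [QuaternionAlgebra.imK_mul, zero_mul, add_zero]
      exact (((h1.mul k4).add (h2.mul k3)).sub (h3.mul k2)).add (h4.mul k1)
    · rw [star_mul, mul_assoc, ← mul_assoc v, hv, one_mul, hu]
    · rw [map_mul, hg, hg', Matrix.SpecialLinearGroup.coe_mul]
  inv_mem' := by
    rintro g ⟨u, ⟨h1, h2, h3, h4⟩, hu, hg⟩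
    have hcomm : star u * u = 1 := by
      rw [← hu]; exact (star_comm_self' u)
    refine ⟨star u, ⟨?_, ?_, ?_, ?_⟩, ?_, ?_⟩
    · simpa using h1
    · simpa using h2.neg
    · simpa using h3.neg
    · simpa using h4.neg
    · rw [star_star, hcomm]
    · have h5 : φ (star u) * (g : Matrix (Fin 2) (Fin 2) ℝ) = 1 := by
        rw [← hg, ← map_mul, hcomm, map_one]
      have h6 : (g : Matrix (Fin 2) (Fin 2) ℝ) * ((g⁻¹ : G) : Matrix (Fin 2) (Fin 2) ℝ) = 1 := by
        rw [← Matrix.SpecialLinearGroup.coe_mul, mul_inv_cancel, Matrix.SpecialLinearGroup.coe_one]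
      exact left_inv_eq_right_inv h5 h6

/-- A subgroup `Γ` of `SL(2, ℝ)` is arithmetic if it is commensurable with the image of the
norm-one unit group of an order in a quaternion algebra `A` over a totally real number field `F`,
where `A` is split at one real place `σ₀` of `F` (the homomorphism `φ`, which is `F`-linear along
`σ₀`, exhibits `A ⊗_{σ₀} ℝ ≃ M₂(ℝ)`) and ramified at all the other real places. The homomorphism
`φ` is arbitrary, so that conjugation of `Γ` is allowed for. -/
def IsArithmetic (Γ : Subgroup G) : Prop :=
  ∃ (F : Type) (_ : Field F) (_ : NumberField F) (_ : NumberField.IsTotallyReal F)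
    (α β : F) (hα : IsIntegral ℤ α) (hβ : IsIntegral ℤ β) (σ₀ : F →+* ℝ)
    (φ : ℍ[F,α,β] →+* Matrix (Fin 2) (Fin 2) ℝ),
    α ≠ 0 ∧ β ≠ 0 ∧
    (∀ c : F, φ (c : ℍ[F,α,β]) = σ₀ c • (1 : Matrix (Fin 2) (Fin 2) ℝ)) ∧
    (∀ σ : F →+* ℝ, σ ≠ σ₀ → σ α < 0 ∧ σ β < 0) ∧
    Γ.Commensurable (normOneUnits α β hα hβ φ)

/-- `Γ` is a co-compact arithmetic lattice in `SL(2, ℝ)`. -/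
structure IsCocompactArithmeticLattice (Γ : Subgroup G) : Prop where
  discrete : DiscreteTopology Γ
  cocompact : CompactSpace (G ⧸ Γ)
  arithmetic : IsArithmetic Γ

/-! ### The metric on `X = G / Γ` and on `X × X` -/

/-- The entrywise derivative of a curve in `SL(2, ℝ)`. -/
def velocity (c : ℝ → G) (t : ℝ) : Matrix (Fin 2) (Fin 2) ℝ :=
  Matrix.of fun i j => deriv (fun s => (c s : Matrix (Fin 2) (Fin 2) ℝ) i j) t

/-- The speed `‖c'(t) c(t)⁻¹‖` of a curve in `SL(2, ℝ)` with respect to the right-invariant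
Riemannian metric that is the Hilbert–Schmidt inner product `tr(A Bᵀ)` on `sl(2, ℝ)`. -/
def speed (c : ℝ → G) (t : ℝ) : ℝ :=
  √(∑ i, ∑ j, ((velocity c t * ((c t)⁻¹ : G)) i j) ^ 2)

/-- The right-invariant Riemannian distance on `SL(2, ℝ)`: the infimum of the lengths of the
`C¹` curves from `g` to `g'`. -/
def distG (g g' : G) : ℝ≥0∞ :=
  ⨅ (c : ℝ → G)
    (_ : ∀ i j, ContDiff ℝ 1 fun s => (c s : Matrix (Fin 2) (Fin 2) ℝ) i j)
    (_ : c 0 = g) (_ : c 1 = g'),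
    ∫⁻ t in Set.Icc (0 : ℝ) 1, ENNReal.ofReal (speed c t)

/-- The quotient distance on `X = G / Γ`: the infimum of the distances between lifts. -/
def distX (Γ : Subgroup G) (x y : G ⧸ Γ) : ℝ≥0∞ :=
  ⨅ (g : G) (g' : G) (_ : (g : G ⧸ Γ) = x) (_ : (g' : G ⧸ Γ) = y), distG g g'

/-- The product distance on `X × X`. -/
def distXX (Γ : Subgroup G) (P Q : (G ⧸ Γ) × (G ⧸ Γ)) : ℝ≥0∞ :=
  max (distX Γ P.1 Q.1) (distX Γ P.2 Q.2)

/-- The distance from a point of `X × X` to a subset. -/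
def distToSet (Γ : Subgroup G) (P : (G ⧸ Γ) × (G ⧸ Γ)) (S : Set ((G ⧸ Γ) × (G ⧸ Γ))) : ℝ≥0∞ :=
  ⨅ Q ∈ S, distXX Γ P Q

/-! ### Orbits of the diagonal subgroup -/

/-- The orbit `H.(x₀, y₀)` of the diagonal subgroup `H = {(g, g)}` of `G × G`. -/
def diagOrbit (Γ : Subgroup G) (P : (G ⧸ Γ) × (G ⧸ Γ)) : Set ((G ⧸ Γ) × (G ⧸ Γ)) :=
  {Q | ∃ η : G, Q = (η • P.1, η • P.2)}

/-- The volume of the orbit `H.(x₀, y₀)`, with `H ≃ G` carrying the Haar measure `μ`: the least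
measure of a measurable subset of `H` that maps onto the orbit. When the stabilizer of `(x₀, y₀)`
in `H` is discrete, this is the measure of a fundamental domain of the stabilizer, that is, the
covolume of the stabilizer (finite exactly when the orbit is periodic). -/
def orbitVol [MeasurableSpace G] (μ : Measure G) (Γ : Subgroup G) (P : (G ⧸ Γ) × (G ⧸ Γ)) :
    ℝ≥0∞ :=
  ⨅ (S : Set G) (_ : MeasurableSet S)
    (_ : ∀ Q ∈ diagOrbit Γ P, ∃ η ∈ S, Q = (η • P.1, η • P.2)), μ S

/-- Condition E2 for the point `P = (x, y)`, with the parameters `A₁`, `A₂`, `R`, `T`: there is a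
point `P₀ = (x₀, y₀)` whose `H`-orbit has volume at most `R^{A₁}` such that for every `r ∈ [0, T]`
there is `g ∈ G × G` with `‖g‖ < R^{A₁}` (maximum norm of the entries) such that for all
`s ∈ [0, T]` the point `(h_s × h_s) P` has distance at most `R^{A₁} ((1 + |s - r|) / T)^{1 / A₂}`
from `g H.(x₀, y₀)`. -/
def E2 [MeasurableSpace G] (μ : Measure G) (Γ : Subgroup G) (A₁ A₂ R T : ℝ)
    (P : (G ⧸ Γ) × (G ⧸ Γ)) : Prop :=
  ∃ P₀ : (G ⧸ Γ) × (G ⧸ Γ),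
    orbitVol μ Γ P₀ ≤ ENNReal.ofReal (R ^ A₁) ∧
    ∀ r ∈ Set.Icc (0 : ℝ) T, ∃ g₁ g₂ : G,
      (∀ i j, |(g₁ : Matrix (Fin 2) (Fin 2) ℝ) i j| < R ^ A₁ ∧
        |(g₂ : Matrix (Fin 2) (Fin 2) ℝ) i j| < R ^ A₁) ∧
      ∀ s ∈ Set.Icc (0 : ℝ) T,
        distToSet Γ (h s • P.1, h s • P.2)
            ((fun Q : (G ⧸ Γ) × (G ⧸ Γ) => (g₁ • Q.1, g₂ • Q.2)) '' diagOrbit Γ P₀) ≤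
          ENNReal.ofReal (R ^ A₁ * ((1 + |s - r|) / T) ^ (1 / A₂))

end Horocycle

end

namespace Horocycle

open Topology

/-! ### The topology of `SL(2, ℝ)` -/

/-! Suppose E2 holds and write `x = g₀Γ`. Only the centre `r = 0` is needed: for all `s ≤ L =
T^(1-δ)` the pair `h_s a_{-log p} x`, `h_s a_{-log q} x` is within a small power of `1/T` of one
translate `gH.(x₀,y₀)`. Put `F₁(s) = h_s a_{-log p} g₀` and `F₂(s) = h_s a_{-log q} g₀`.

A pair of points on an `H`-orbit of volume `V` is described by an element `θ` for which `Γ ∩ θΓθ⁻¹`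
has index `O(V + 1)` in `Γ` (`exists_relIndex_le`). So closeness at time `s` yields such a `θ(s)`
with `F₁(s) θ(s) F₂(s)⁻¹` close to the fixed element `g₁g₂⁻¹` (`exists_commensurating`). Elements
`θ` of small index are separated: if two of them nearly agree, their quotient almost commutes with
short elements of a finite index subgroup, by discreteness commutes with them, and is then trivial
since these do not commute with each other (`exists_short_noncommuting`, `exists_separation`). Hence
`θ(s)` is one element `θ` for all `s ∈ [0, L]`.

Now `Z = F₁(0) θ F₂(0)⁻¹` stays bounded under conjugation by `h_s` for `s ≤ L`. These conjugates are
quadratic in `s`, so `Z` is nearly plus or minus an upper unipotent. Undoing the geodesic flow,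
`tr(θ)²` is very close to `(p+q)²/(pq)` (`exists_commensurating_trace`).

Arithmetic excludes this (`exists_arithmetic_rigidity`). A Casimir-type formula gives an element `ω`
of the quaternion order that maps to a multiple of `θ`, and from it an algebraic integer which at
`σ₀` is a controlled multiple of `pq tr(θ)² - (p+q)²` and which is `O((p+q)²)` at the other,
ramified, places. If it is non-zero, its norm is at least 1, which contradicts the closeness once
`δ` is small. If it is zero, then `θ` has eigenvalues `±√(p/q)`, `±√(q/p)`, with a common sign; as
`p ≠ q`, this makes a combination of `ω` and `1` a zero divisor, hence produces a non-trivial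
unipotent in `Γ`, impossible in a cocompact lattice. -/

theorem continuous_entry (i j : Fin 2) :
    Continuous fun g : G => (g : Matrix (Fin 2) (Fin 2) ℝ) i j := by
  fun_prop

instance : LocallyCompactSpace G :=
  haveI : LocallyCompactSpace (Matrix (Fin 2) (Fin 2) ℝ) :=
    inferInstanceAs (LocallyCompactSpace (Fin 2 → Fin 2 → ℝ))
  (Matrix.SpecialLinearGroup.isClosedEmbedding_val (n := Fin 2) (R := ℝ)).locallyCompactSpace

instance : SecondCountableTopology G :=
  haveI : SecondCountableTopology (Matrix (Fin 2) (Fin 2) ℝ) :=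
    inferInstanceAs (SecondCountableTopology (Fin 2 → Fin 2 → ℝ))
  (Matrix.SpecialLinearGroup.isClosedEmbedding_val (n := Fin 2) (R := ℝ)).isEmbedding.isInducing
    |>.secondCountableTopology

/-- Every entry of the matrix has absolute value at most `b`. -/
def Bd (M : Matrix (Fin 2) (Fin 2) ℝ) (b : ℝ) : Prop := ∀ i j, |M i j| ≤ b

/-- The elements of `SL(2, ℝ)` whose entries differ by less than `c` from those of `1`. -/
def nearOne (c : ℝ) : Set G :=
  {g | ∀ i j, |(g : Matrix (Fin 2) (Fin 2) ℝ) i j - (1 : Matrix (Fin 2) (Fin 2) ℝ) i j| < c}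

theorem isOpen_nearOne (c : ℝ) : IsOpen (nearOne c) := by
  simp only [nearOne, Set.ofPred_forall]
  refine isOpen_iInter_of_finite fun i => isOpen_iInter_of_finite fun j => ?_
  exact isOpen_lt (((continuous_entry i j).sub continuous_const).abs) continuous_const

theorem one_mem_nearOne {c : ℝ} (hc : 0 < c) : (1 : G) ∈ nearOne c := by
  intro i j; simpa using hc

theorem nearOne_mono {c c' : ℝ} (h : c ≤ c') : nearOne c ⊆ nearOne c' :=
  fun _ hg i j => (hg i j).trans_le h

theorem exists_nearOne_subset {W : Set G} (hW : W ∈ 𝓝 (1 : G)) : ∃ c > 0, nearOne c ⊆ W := by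
  have hcomap := (Matrix.SpecialLinearGroup.isClosedEmbedding_val (n := Fin 2)
    (R := ℝ)).isInducing.nhds_eq_comap (1 : G)
  obtain ⟨t, ht, htW⟩ := Filter.mem_comap.1 (hcomap.ge hW)
  obtain ⟨c, hc, hct⟩ := Metric.mem_nhds_iff.1
    (show t ∈ @nhds (Fin 2 → Fin 2 → ℝ) _ ((1 : G) : Matrix (Fin 2) (Fin 2) ℝ) from ht)
  refine ⟨c, hc, fun g hg => htW (hct ?_)⟩
  exact (dist_pi_lt_iff hc).2 fun i => (dist_pi_lt_iff hc).2 fun j => by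
    rw [Real.dist_eq]; exact hg i j

theorem isCompact_entries_le (b : ℝ) :
    IsCompact {g : G | Bd (g : Matrix (Fin 2) (Fin 2) ℝ) b} := by
  have h1 : IsCompact (Set.univ.pi fun _ : Fin 2 => Set.univ.pi fun _ : Fin 2 => Set.Icc (-b) b) :=
    isCompact_univ_pi fun _ => isCompact_univ_pi fun _ => isCompact_Icc
  have h2 := (Matrix.SpecialLinearGroup.isClosedEmbedding_val (n := Fin 2)
    (R := ℝ)).isCompact_preimage (K := (Set.univ.pi fun _ : Fin 2 =>
      Set.univ.pi fun _ : Fin 2 => Set.Icc (-b) b)) h1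
  refine h2.of_isClosed_subset ?_ fun g hg => ?_
  · simp only [Bd, Set.ofPred_forall]
    refine isClosed_iInter fun i => isClosed_iInter fun j => ?_
    exact isClosed_le (continuous_entry i j).abs continuous_const
  · exact fun i _ j _ => abs_le.1 (hg i j)

theorem exists_bd_of_isCompact {K : Set G} (hK : IsCompact K) :
    ∃ C : ℝ, 1 ≤ C ∧ ∀ g ∈ K, Bd (g : Matrix (Fin 2) (Fin 2) ℝ) C := by
  have h : ∀ i j : Fin 2, ∃ C : ℝ, ∀ g ∈ K, |(g : Matrix (Fin 2) (Fin 2) ℝ) i j| ≤ C := by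
    intro i j
    obtain ⟨C, hC⟩ := hK.exists_bound_of_continuousOn (continuous_entry i j).continuousOn
    exact ⟨C, fun g hg => by simpa using hC g hg⟩
  choose C hC using h
  refine ⟨1 + ∑ i, ∑ j, |C i j|, by
    have : 0 ≤ ∑ i, ∑ j, |C i j| := by positivity
    linarith, fun g hg i j => (hC i j g hg).trans ?_⟩
  have h1 : |C i j| ≤ ∑ j, |C i j| :=
    Finset.single_le_sum (f := fun j => |C i j|) (fun _ _ => abs_nonneg _) (Finset.mem_univ j)
  have h2 : ∑ j, |C i j| ≤ ∑ i, ∑ j, |C i j| :=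
    Finset.single_le_sum (f := fun i => ∑ j, |C i j|) (fun _ _ => by positivity)
      (Finset.mem_univ i)
  linarith [le_abs_self (C i j)]

/-- A cocompact subgroup admits a compact set of representatives. -/
theorem exists_isCompact_mul {Γ : Subgroup G} [CompactSpace (G ⧸ Γ)] :
    ∃ K : Set G, IsCompact K ∧ (1 : G) ∈ K ∧ ∀ g : G, ∃ κ ∈ K, ∃ γ ∈ Γ, g = κ * γ := by
  let U : ℕ → Set (G ⧸ Γ) := fun n =>
    (QuotientGroup.mk : G → G ⧸ Γ) '' {g | ∀ i j, |(g : Matrix (Fin 2) (Fin 2) ℝ) i j| < n}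
  have hU : ∀ n, IsOpen (U n) := by
    intro n
    refine QuotientGroup.isOpenMap_coe _ ?_
    simp only [Set.ofPred_forall]
    refine isOpen_iInter_of_finite fun i => isOpen_iInter_of_finite fun j => ?_
    exact isOpen_lt (continuous_entry i j).abs continuous_const
  have hmono : Monotone U := by
    intro m n hmn
    refine Set.image_mono fun g hg i j => (hg i j).trans_le ?_
    exact_mod_cast hmn
  have hcov : (Set.univ : Set (G ⧸ Γ)) ⊆ ⋃ n, U n := by
    intro x _
    induction x using QuotientGroup.induction_on with
    | H g =>
      obtain ⟨C, -, hC⟩ := exists_bd_of_isCompact (isCompact_singleton (x := g))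
      obtain ⟨n, hn⟩ := exists_nat_gt C
      exact Set.mem_iUnion.2 ⟨n, g, fun i j => (hC g rfl i j).trans_lt hn, rfl⟩
  obtain ⟨n, hn⟩ := isCompact_univ.elim_directed_cover U hU hcov hmono.directed_le
  refine ⟨{g : G | Bd (g : Matrix (Fin 2) (Fin 2) ℝ) (n + 1)}, isCompact_entries_le _, ?_, ?_⟩
  · intro i j
    fin_cases i <;> fin_cases j <;> simp <;> positivity
  intro g
  obtain ⟨κ, hκ, hκg⟩ := hn (Set.mem_univ (g : G ⧸ Γ))
  refine ⟨κ, fun i j => (hκ i j).le.trans (by linarith), κ⁻¹ * g, QuotientGroup.eq.1 hκg, by simp⟩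

/-- Conjugates of a discrete subgroup by elements of a compact set are uniformly discrete. -/
theorem exists_uniform_discrete {Γ : Subgroup G} [DiscreteTopology Γ] {K : Set G}
    (hK : IsCompact K) :
    ∃ c > 0, ∀ κ ∈ K, ∀ γ ∈ Γ, κ * γ * κ⁻¹ ∈ nearOne c → γ = 1 := by
  obtain ⟨V, hV, hVΓ⟩ : ∃ V : Set G, IsOpen V ∧ Subtype.val ⁻¹' V = ({1} : Set Γ) :=
    isOpen_induced_iff.1 (isOpen_discrete ({1} : Set Γ))
  have hV1 : (1 : G) ∈ V := by
    have : (1 : Γ) ∈ (Subtype.val ⁻¹' V : Set Γ) := by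
      rw [hVΓ]; exact Set.mem_singleton _
    exact this
  have hcont : Continuous fun p : G × G => p.1⁻¹ * p.2 * p.1 :=
    (continuous_fst.inv.mul continuous_snd).mul continuous_fst
  have hsub : K ×ˢ {(1 : G)} ⊆ (fun p : G × G => p.1⁻¹ * p.2 * p.1) ⁻¹' V := by
    rintro ⟨κ, g⟩ ⟨-, hg⟩
    have hg' : g = 1 := hg
    rw [Set.mem_preimage, hg', mul_one, inv_mul_cancel]
    exact hV1
  obtain ⟨u, v, -, hv, hKu, h1v, huv⟩ := generalized_tube_lemma hK isCompact_singleton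
    (hV.preimage hcont) hsub
  obtain ⟨c, hc, hcv⟩ := exists_nearOne_subset (hv.mem_nhds (h1v (Set.mem_singleton _)))
  refine ⟨c, hc, fun κ hκ γ hγ hmem => ?_⟩
  have hm : ((κ, κ * γ * κ⁻¹) : G × G) ∈ u ×ˢ v := Set.mem_prod.2 ⟨hKu hκ, hcv hmem⟩
  have h2 : γ ∈ V := by
    have h1 := huv hm
    rw [Set.mem_preimage, mul_assoc κ γ, inv_mul_cancel_left, inv_mul_cancel_right] at h1
    exact h1
  have h3 : (⟨γ, hγ⟩ : Γ) ∈ (Subtype.val ⁻¹' V : Set Γ) := h2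
  rw [hVΓ] at h3
  exact congrArg Subtype.val (Set.mem_singleton_iff.1 h3)

/-! ### Unimodularity -/

/-- The Weyl element of `SL(2, ℝ)`. -/
def weyl : G := ⟨!![0, -1; 1, 0], by simp [Matrix.det_fin_two]⟩

theorem coe_weyl : (weyl : Matrix (Fin 2) (Fin 2) ℝ) = !![0, -1; 1, 0] := rfl

theorem coe_h (t : ℝ) : (h t : Matrix (Fin 2) (Fin 2) ℝ) = !![1, t; 0, 1] := rfl

theorem coe_a (t : ℝ) : (a t : Matrix (Fin 2) (Fin 2) ℝ) =
    !![Real.exp (t / 2), 0; 0, Real.exp (-t / 2)] := rfl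

theorem det_entries (g : G) : g 0 0 * g 1 1 - g 0 1 * g 1 0 = 1 := by
  rw [← Matrix.det_fin_two]; exact g.2

theorem coe_mul_eq (g k : G) : ((g * k : G) : Matrix (Fin 2) (Fin 2) ℝ) =
    !![g 0 0 * k 0 0 + g 0 1 * k 1 0, g 0 0 * k 0 1 + g 0 1 * k 1 1;
      g 1 0 * k 0 0 + g 1 1 * k 1 0, g 1 0 * k 0 1 + g 1 1 * k 1 1] := by
  rw [Matrix.SpecialLinearGroup.coe_mul]
  exact Matrix.eta_fin_two _ |>.trans (by simp [Matrix.mul_apply, Fin.sum_univ_two])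

theorem coe_inv_eq (g : G) : ((g⁻¹ : G) : Matrix (Fin 2) (Fin 2) ℝ) =
    !![g 1 1, -g 0 1; -g 1 0, g 0 0] := by
  rw [Matrix.SpecialLinearGroup.coe_inv, Matrix.adjugate_fin_two]

theorem ext_entries {g k : G} (h₁ : g 0 0 = k 0 0) (h₂ : g 0 1 = k 0 1) (h₃ : g 1 0 = k 1 0)
    (h₄ : g 1 1 = k 1 1) : g = k := by
  ext i j
  fin_cases i <;> fin_cases j <;> assumption

theorem h_mul_h (s t : ℝ) : h s * h t = h (s + t) := by
  apply ext_entries <;> simp [coe_mul_eq, coe_h, add_comm, -Matrix.SpecialLinearGroup.coe_mul]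

theorem h_zero : h 0 = 1 := by
  apply ext_entries <;> simp [coe_h]

theorem h_inv (s : ℝ) : (h s)⁻¹ = h (-s) := by
  rw [inv_eq_iff_mul_eq_one, h_mul_h, add_neg_cancel, h_zero]

theorem a_mul_h (s t : ℝ) : a s * h t = h (Real.exp s * t) * a s := by
  have h1 : Real.exp s * Real.exp (-s / 2) = Real.exp (s / 2) := by
    rw [← Real.exp_add]; ring_nf
  apply ext_entries <;> simp [coe_mul_eq, coe_h, coe_a, -Matrix.SpecialLinearGroup.coe_mul]
  linear_combination (-t) * h1

/-- Conjugation by `a 1` turns `h u` into `h (e u)`, so every `h t` is a commutator and is killed.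
Upper unipotents and their Weyl conjugates generate the group. -/
theorem monoidHom_eq_one (f : G →* NNReal) (g : G) : f g = 1 := by
  have hinv : ∀ g, f g * f g⁻¹ = 1 := fun g => by rw [← map_mul, mul_inv_cancel, map_one]
  have hne : ∀ g, f g ≠ 0 := fun g h0 => by simpa [h0] using hinv g
  have hconj : ∀ g k, f (g * k * g⁻¹) = f k := fun g k => by
    rw [map_mul, map_mul, mul_right_comm, hinv, one_mul]
  have hh : ∀ t, f (h t) = 1 := by
    intro t
    have hpos : (Real.exp 1 - 1) ≠ 0 := by
      have := Real.add_one_lt_exp (one_ne_zero (α := ℝ))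
      linarith
    set u := t / (Real.exp 1 - 1) with hu
    have h1 : f (h (Real.exp 1 * u)) = f (h u) := by
      rw [← hconj (a 1) (h u), a_mul_h, mul_inv_cancel_right]
    have h2 : Real.exp 1 * u = t + u := by rw [hu]; field_simp; ring
    rw [h2, ← h_mul_h, map_mul] at h1
    exact mul_right_cancel₀ (hne (h u)) (by rw [h1, one_mul])
  have key : ∀ g : G, (g : Matrix (Fin 2) (Fin 2) ℝ) 1 0 ≠ 0 → f g = 1 := by
    intro g hc
    have hdet := det_entries g
    have hg : g = h ((g 0 0 - 1) / g 1 0) * (weyl * h (-g 1 0) * weyl⁻¹) *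
        h ((g 1 1 - 1) / g 1 0) := by
      apply ext_entries <;>
        simp [coe_mul_eq, coe_inv_eq, coe_h, coe_weyl, -Matrix.SpecialLinearGroup.coe_mul,
          -Matrix.SpecialLinearGroup.coe_inv] <;>
        field_simp <;> first | ring1 | linear_combination -hdet
    rw [hg, map_mul, map_mul, hconj, hh, hh, hh]; simp
  by_cases hc : (g : Matrix (Fin 2) (Fin 2) ℝ) 1 0 = 0
  · have h1 : f (weyl * g) = 1 := by
      apply key
      have hdet := det_entries g
      rw [hc] at hdet
      simp only [coe_mul_eq, coe_weyl]
      rintro h0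
      simp at h0
      simp [h0] at hdet
    rw [map_mul, key weyl (by simp [coe_weyl]), one_mul] at h1
    exact h1
  · exact key g hc

/-- The modular character is a homomorphism to `NNReal`, hence trivial. Packing arguments in `G/Γ`
translate sets on the right. -/
instance isMulRightInvariant [MeasurableSpace G] [BorelSpace G] (μ : Measure G)
    [μ.IsHaarMeasure] : μ.IsMulRightInvariant := by
  refine ⟨fun g => ?_⟩
  rw [Measure.isMulLeftInvariant_eq_smul (Measure.map (· * g) μ) μ,
    ← Measure.modularCharacterFun_eq_haarScalarFactor]
  have : Measure.modularCharacterFun g = 1 := monoidHom_eq_one Measure.modularCharacter g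
  rw [this, one_smul]

/-! ### The Riemannian distance and matrix entries -/

theorem continuous_velocity {c : ℝ → G}
    (hc : ∀ i j, ContDiff ℝ 1 fun s => (c s : Matrix (Fin 2) (Fin 2) ℝ) i j) (i j : Fin 2) :
    Continuous fun t => velocity c t i j :=
  (hc i j).continuous_deriv le_rfl

theorem continuous_speed {c : ℝ → G}
    (hc : ∀ i j, ContDiff ℝ 1 fun s => (c s : Matrix (Fin 2) (Fin 2) ℝ) i j) :
    Continuous (speed c) := by
  have hv := continuous_velocity hc
  have hcc : ∀ i j, Continuous fun s => (c s : Matrix (Fin 2) (Fin 2) ℝ) i j :=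
    fun i j => (hc i j).continuous
  have hinv : ∀ i j, Continuous fun s => ((c s)⁻¹ : G) i j := by
    intro i j
    simp only [coe_inv_eq]
    fin_cases i <;> fin_cases j <;> simp <;> first | exact hcc _ _ | exact (hcc _ _).neg
  unfold speed
  refine Real.continuous_sqrt.comp (continuous_finsetSum _ fun i _ =>
    continuous_finsetSum _ fun j _ => Continuous.pow ?_ 2)
  simp only [Matrix.mul_apply, Fin.sum_univ_two]
  exact ((hv _ _).mul (hinv _ _)).add ((hv _ _).mul (hinv _ _))

theorem abs_entry_le_speed (c : ℝ → G) (t : ℝ) (i j : Fin 2) :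
    |(velocity c t * ((c t)⁻¹ : G)) i j| ≤ speed c t := by
  refine Real.abs_le_sqrt ?_
  refine (Finset.single_le_sum (f := fun j => ((velocity c t * ((c t)⁻¹ : G)) i j) ^ 2)
    (fun _ _ => sq_nonneg _) (Finset.mem_univ j)).trans ?_
  exact Finset.single_le_sum (f := fun i => ∑ j, ((velocity c t * ((c t)⁻¹ : G)) i j) ^ 2)
    (fun _ _ => Finset.sum_nonneg fun _ _ => sq_nonneg _) (Finset.mem_univ i)

theorem speed_nonneg (c : ℝ → G) (t : ℝ) : 0 ≤ speed c t := Real.sqrt_nonneg _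

/-- A small Riemannian distance forces the quotient to be entrywise close to `1`. -/
theorem abs_entry_sub_le_of_distG_lt {g g' : G} {ε : ℝ} (hε : 0 < ε) (hε' : ε ≤ 1 / 4)
    (hd : distG g g' < ENNReal.ofReal ε) (i j : Fin 2) :
    |((g' * g⁻¹ : G) : Matrix (Fin 2) (Fin 2) ℝ) i j - (1 : Matrix (Fin 2) (Fin 2) ℝ) i j|
      ≤ 2 * ε := by
  simp only [distG, iInf_lt_iff] at hd
  obtain ⟨c, hc, rfl, rfl, hlt⟩ := hd
  have hsc := continuous_speed hc
  have hI : ∫ t in (0 : ℝ)..1, speed c t ≤ ε := by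
    rw [intervalIntegral.integral_of_le zero_le_one, ← integral_Icc_eq_integral_Ioc,
      integral_eq_lintegral_of_nonneg_ae (Filter.Eventually.of_forall fun t => speed_nonneg c t)
        hsc.aestronglyMeasurable]
    exact ENNReal.toReal_le_of_le_ofReal hε.le hlt.le
  let Φ : ℝ → Fin 2 → Fin 2 → ℝ := fun t i j =>
    ((c t : Matrix (Fin 2) (Fin 2) ℝ) * (((c 0)⁻¹ : G) : Matrix (Fin 2) (Fin 2) ℝ)) i j
      - (1 : Matrix (Fin 2) (Fin 2) ℝ) i j
  let Φ' : ℝ → Fin 2 → Fin 2 → ℝ := fun t i j =>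
    (velocity c t * (((c 0)⁻¹ : G) : Matrix (Fin 2) (Fin 2) ℝ)) i j
  have hderiv : ∀ i j t, HasDerivAt (fun t => Φ t i j) (Φ' t i j) t := by
    intro i j t
    have hd : ∀ i k, HasDerivAt (fun s => (c s : Matrix (Fin 2) (Fin 2) ℝ) i k)
        (velocity c t i k) t := fun i k =>
      ((hc i k).differentiable one_ne_zero t).hasDerivAt
    simp only [Φ, Φ', Matrix.mul_apply, Fin.sum_univ_two]
    exact ((((hd i 0).mul_const _).add ((hd i 1).mul_const _)).sub_const _)
  have hΦ'c : ∀ i j, Continuous fun t => Φ' t i j := by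
    intro i j
    have hv := continuous_velocity hc
    simp only [Φ', Matrix.mul_apply, Fin.sum_univ_two]
    exact ((hv _ _).mul continuous_const).add ((hv _ _).mul continuous_const)
  have hΦc : Continuous Φ := continuous_pi fun i => continuous_pi fun j =>
    continuous_iff_continuousAt.2 fun t => (hderiv i j t).continuousAt
  obtain ⟨t₀, ht₀, hmax⟩ := isCompact_Icc.exists_isMaxOn (s := Set.Icc (0 : ℝ) 1)
    ⟨0, by simp⟩ hΦc.norm.continuousOn
  set M := ‖Φ t₀‖ with hM
  have hMt : ∀ t ∈ Set.Icc (0 : ℝ) 1, ∀ i j, |Φ t i j| ≤ M := fun t ht i j =>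
    ((norm_le_pi_norm (Φ t i) j).trans (norm_le_pi_norm (Φ t) i)).trans (hmax ht)
  have hM0 : 0 ≤ M := norm_nonneg _
  have hΦ0 : ∀ i j, Φ 0 i j = 0 := by
    intro i j
    simp only [Φ]
    rw [← Matrix.SpecialLinearGroup.coe_mul, mul_inv_cancel, Matrix.SpecialLinearGroup.coe_one,
      sub_self]
  -- With `A = c' c⁻¹` and `Φ = c(t) c(0)⁻¹ - 1`, the curve satisfies `Φ' = A + AΦ`, and the entries
  -- of `A` are at most the speed.
  have hΦ' : ∀ t ∈ Set.Icc (0 : ℝ) 1, ∀ i j, |Φ' t i j| ≤ (1 + 2 * M) * speed c t := by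
    intro t ht i j
    set A := velocity c t * (((c t)⁻¹ : G) : Matrix (Fin 2) (Fin 2) ℝ) with hA
    have h1 : Φ' t i j = A i j + (A i 0 * Φ t 0 j + A i 1 * Φ t 1 j) := by
      have h2 : velocity c t * (((c 0)⁻¹ : G) : Matrix (Fin 2) (Fin 2) ℝ) =
          A + A * ((c t : Matrix (Fin 2) (Fin 2) ℝ) *
            (((c 0)⁻¹ : G) : Matrix (Fin 2) (Fin 2) ℝ) - 1) := by
        have h3 : (((c t)⁻¹ : G) : Matrix (Fin 2) (Fin 2) ℝ) * (c t : Matrix (Fin 2) (Fin 2) ℝ)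
            = 1 := by
          rw [← Matrix.SpecialLinearGroup.coe_mul, inv_mul_cancel,
            Matrix.SpecialLinearGroup.coe_one]
        rw [mul_sub, mul_one, add_sub_cancel, hA, mul_assoc, ← mul_assoc _ (c t).1, h3, one_mul]
      simp only [Φ', Φ]
      rw [h2, Matrix.add_apply, Matrix.mul_apply, Fin.sum_univ_two]
      rfl
    have hA' : ∀ k, |A i k| ≤ speed c t := fun k => abs_entry_le_speed c t i k
    have hs := speed_nonneg c t
    rw [h1]
    calc |A i j + (A i 0 * Φ t 0 j + A i 1 * Φ t 1 j)|
        ≤ |A i j| + (|A i 0| * |Φ t 0 j| + |A i 1| * |Φ t 1 j|) := by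
          rw [← abs_mul, ← abs_mul]
          exact (abs_add_le _ _).trans (add_le_add le_rfl (abs_add_le _ _))
      _ ≤ speed c t + (speed c t * M + speed c t * M) := by
          gcongr
          exacts [hA' _, hA' _, hMt t ht _ _, hA' _, hMt t ht _ _]
      _ = (1 + 2 * M) * speed c t := by ring
  -- Bootstrap: integrating up to the time where `‖Φ‖` is maximal bounds the maximum `M` by itself;
  -- for `ε ≤ 1/4` this gives `M ≤ 2ε`.
  have hMle : M ≤ (1 + 2 * M) * ε := by
    rw [hM]
    have hnn : 0 ≤ (1 + 2 * M) * ε := by positivity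
    refine (pi_norm_le_iff_of_nonneg hnn).2 fun i => (pi_norm_le_iff_of_nonneg hnn).2 fun j => ?_
    have hint := intervalIntegral.integral_eq_sub_of_hasDerivAt (a := 0) (b := t₀)
      (fun t _ => hderiv i j t) ((hΦ'c i j).intervalIntegrable _ _)
    rw [hΦ0, sub_zero] at hint
    rw [← hint]
    calc ‖∫ t in (0 : ℝ)..t₀, Φ' t i j‖
        ≤ ∫ t in (0 : ℝ)..t₀, (1 + 2 * M) * speed c t := by
          refine intervalIntegral.norm_integral_le_of_norm_le ht₀.1 ?_
            ((continuous_const.mul hsc).intervalIntegrable _ _)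
          exact Filter.Eventually.of_forall fun t ht => hΦ' t ⟨ht.1.le, ht.2.trans ht₀.2⟩ i j
      _ = (1 + 2 * M) * ∫ t in (0 : ℝ)..t₀, speed c t :=
          intervalIntegral.integral_const_mul _ _
      _ ≤ (1 + 2 * M) * ε := by
          refine mul_le_mul_of_nonneg_left (le_trans ?_ hI) (by positivity)
          exact intervalIntegral.integral_mono_interval le_rfl ht₀.1 ht₀.2
            (Filter.Eventually.of_forall fun t => speed_nonneg c t)
            (hsc.intervalIntegrable _ _)
  have hfin := hMt 1 (by simp) i j
  simp only [Φ] at hfin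
  rw [Matrix.SpecialLinearGroup.coe_mul]
  refine hfin.trans ?_
  nlinarith

/-! ### Packing and the index of stabilizers -/

/-- A set that injects into `G/Λ` is no larger than a set that surjects onto it: cut `B` into pieces
according to the element of `Λ` that moves them into `S`; the moved pieces are disjoint. -/
theorem measure_le_of_injective_mod [MeasurableSpace G] [BorelSpace G] (μ : Measure G)
    [μ.IsHaarMeasure] {Λ : Subgroup G} [Countable Λ] {S B : Set G} (hS : MeasurableSet S)
    (hB : MeasurableSet B) (hcov : ∀ g : G, ∃ s ∈ S, ∃ l ∈ Λ, g = s * l)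
    (hinj : ∀ b ∈ B, ∀ b' ∈ B, b⁻¹ * b' ∈ Λ → b = b') : μ B ≤ μ S := by
  let D : Λ → Set G := fun l => {s | s * l ∈ B ∧ s ∈ S}
  have hmeas : ∀ g : G, Measurable fun s : G => s * g := fun g =>
    (continuous_mul_const g).measurable
  have hD : ∀ l, MeasurableSet (D l) := fun l => (hmeas l hB).inter hS
  have hBsub : B ⊆ ⋃ l : Λ, (fun b : G => b * (l : G)⁻¹) ⁻¹' D l := by
    intro b hb
    obtain ⟨s, hs, l, hl, rfl⟩ := hcov b
    refine Set.mem_iUnion.2 ⟨⟨l, hl⟩, ?_⟩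
    simp only [Set.mem_preimage, D, mul_inv_cancel_right]
    exact ⟨hb, hs⟩
  have hdisj : Pairwise (Function.onFun Disjoint D) := by
    intro l l' hll
    refine Set.disjoint_left.2 fun s hs hs' => hll ?_
    have h1 : (s * (l : G))⁻¹ * (s * l') ∈ Λ := by
      have h2 : (s * (l : G))⁻¹ * (s * l') = ((l⁻¹ * l' : Λ) : G) := by
        simp [mul_inv_rev, mul_assoc]
      rw [h2]; exact Subtype.prop _
    exact Subtype.ext (mul_left_cancel (hinj _ hs.1 _ hs'.1 h1))
  calc μ B ≤ μ (⋃ l : Λ, (fun b : G => b * (l : G)⁻¹) ⁻¹' D l) := measure_mono hBsub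
    _ ≤ ∑' l : Λ, μ ((fun b : G => b * (l : G)⁻¹) ⁻¹' D l) := measure_iUnion_le _
    _ = ∑' l : Λ, μ (D l) := by simp_rw [measure_preimage_mul_right]
    _ = μ (⋃ l, D l) := (measure_iUnion hdisj hD).symm
    _ ≤ μ S := measure_mono (Set.iUnion_subset fun l s hs => hs.2)

/-- The conjugate `θ Γ θ⁻¹`. -/
def conjBy (θ : G) (Γ : Subgroup G) : Subgroup G := Γ.map (MulAut.conj θ).toMonoidHom

theorem mem_conjBy {θ g : G} {Γ : Subgroup G} : g ∈ conjBy θ Γ ↔ θ⁻¹ * g * θ ∈ Γ := by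
  constructor
  · rintro ⟨γ, hγ, rfl⟩
    simpa [mul_assoc] using hγ
  · intro hg
    exact ⟨_, hg, by simp [mul_assoc]⟩

theorem nearOne_entries {c : ℝ} {u : G} (hu : u ∈ nearOne c) :
    |u 0 0 - 1| < c ∧ |u 0 1| < c ∧ |u 1 0| < c ∧ |u 1 1 - 1| < c :=
  ⟨by simpa using hu 0 0, by simpa using hu 0 1, by simpa using hu 1 0, by simpa using hu 1 1⟩

theorem inv_mul_mem_nearOne {c : ℝ} (hc : c ≤ 1) {u v : G} (hu : u ∈ nearOne c)
    (hv : v ∈ nearOne c) : u⁻¹ * v ∈ nearOne (4 * c) := by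
  have hu' := nearOne_entries hu
  have hv' := nearOne_entries hv
  obtain ⟨h1, h2, h3, h4⟩ := hu'
  obtain ⟨k1, k2, k3, k4⟩ := hv'
  have hmul : ∀ x y : ℝ, |x| < c → |y| < c → |x * y| ≤ c := fun x y hx hy => by
    rw [abs_mul]; nlinarith [abs_nonneg x, abs_nonneg y]
  have hval : ((u⁻¹ * v : G) : Matrix (Fin 2) (Fin 2) ℝ) =
    !![u 1 1 * v 0 0 - u 0 1 * v 1 0, u 1 1 * v 0 1 - u 0 1 * v 1 1;
      -(u 1 0 * v 0 0) + u 0 0 * v 1 0, -(u 1 0 * v 0 1) + u 0 0 * v 1 1] := by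
    rw [coe_mul_eq, coe_inv_eq]; simp [sub_eq_add_neg]
  have key : ∀ x p q r s : ℝ, x = p + q + r + s ∨ x = p + q + r - s ∨ x = p - q + r - s ∨
      x = p - q + r + s → |p| < c → |q| < c → |r| ≤ c → |s| ≤ c → |x| < 4 * c := by
    intro x p q r s hx hp hq hr hs
    rw [abs_lt] at hp hq ⊢
    rw [abs_le] at hr hs
    rcases hx with rfl | rfl | rfl | rfl <;> constructor <;> linarith
  intro i j
  rw [hval]
  fin_cases i <;> fin_cases j <;> simp
  · exact key _ (u 1 1 - 1) (v 0 0 - 1) _ _ (Or.inr (Or.inl (by ring))) h4 k1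
      (hmul (u 1 1 - 1) (v 0 0 - 1) h4 k1) (hmul _ _ h2 k3)
  · exact key _ (v 0 1) (u 0 1) _ _ (Or.inr (Or.inr (Or.inl (by ring)))) k2 h2
      (hmul (u 1 1 - 1) (v 0 1) h4 k2) (hmul (u 0 1) (v 1 1 - 1) h2 k4)
  · exact key _ (v 1 0) (u 1 0) _ _ (Or.inr (Or.inr (Or.inl (by ring)))) k3 h3
      (hmul (u 0 0 - 1) (v 1 0) h1 k3) (hmul (u 1 0) (v 0 0 - 1) h3 k1)
  · exact key _ (u 0 0 - 1) (v 1 1 - 1) _ _ (Or.inr (Or.inl (by ring))) h1 k4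
      (hmul (u 0 0 - 1) (v 1 1 - 1) h1 k4) (hmul _ _ h3 k2)

theorem measure_nearOne_pos [MeasurableSpace G] [BorelSpace G] (μ : Measure G)
    [μ.IsHaarMeasure] {c : ℝ} (hc : 0 < c) : 0 < μ (nearOne c) :=
  (isOpen_nearOne c).measure_pos μ ⟨1, one_mem_nearOne hc⟩

theorem measure_nearOne_lt_top [MeasurableSpace G] [BorelSpace G] (μ : Measure G)
    [μ.IsHaarMeasure] (c : ℝ) : μ (nearOne c) < ∞ := by
  refine (measure_mono fun g hg i j => ?_).trans_lt (isCompact_entries_le (c + 1)).measure_lt_top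
  have h1 := (hg i j).le
  have h2 : |(1 : Matrix (Fin 2) (Fin 2) ℝ) i j| ≤ 1 := by
    rw [Matrix.one_apply]; split_ifs <;> simp
  calc _ = |((g : Matrix (Fin 2) (Fin 2) ℝ) i j - (1 : Matrix (Fin 2) (Fin 2) ℝ) i j)
        + (1 : Matrix (Fin 2) (Fin 2) ℝ) i j| := by rw [sub_add_cancel]
    _ ≤ c + 1 := (abs_add_le _ _).trans (add_le_add h1 h2)

theorem card_le_of_forall_finset {α : Type*} {b : ℝ} (hb : ∀ F : Finset α, (F.card : ℝ) ≤ b) :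
    Finite α ∧ (Nat.card α : ℝ) ≤ b := by
  have hfin : Finite α := by
    by_contra h
    rw [not_finite_iff_infinite] at h
    obtain ⟨n, hn⟩ := exists_nat_gt b
    obtain ⟨F, hF⟩ := Infinite.exists_subset_card_eq α n
    have := hb F
    rw [hF] at this
    linarith
  refine ⟨hfin, ?_⟩
  have := Fintype.ofFinite α
  simpa [Nat.card_eq_fintype_card] using hb Finset.univ

/-- The volume of an `H`-orbit bounds the index of the stabilizer in a lattice. -/
theorem exists_relIndex_le [MeasurableSpace G] [BorelSpace G] (μ : Measure G)
    [μ.IsHaarMeasure] (Γ : Subgroup G) [DiscreteTopology Γ] [Countable Γ] :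
    ∃ C : ℝ, 0 < C ∧ ∀ (k₁ k₂ : G) (V : ℝ), 0 ≤ V →
      orbitVol μ Γ ((k₁ : G ⧸ Γ), (k₂ : G ⧸ Γ)) ≤ ENNReal.ofReal V →
        (conjBy (k₁⁻¹ * k₂) Γ).relIndex Γ ≠ 0 ∧
          ((conjBy (k₁⁻¹ * k₂) Γ).relIndex Γ : ℝ) ≤ C * (V + 1) := by
  obtain ⟨c, hc, hΓ⟩ := exists_uniform_discrete (Γ := Γ) (isCompact_singleton (x := (1 : G)))
  set c' := min (c / 4) 1 with hc'
  have hc'0 : 0 < c' := lt_min (by linarith) one_pos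
  set U := nearOne c' with hU
  have hUinj : ∀ u ∈ U, ∀ v ∈ U, u⁻¹ * v ∈ Γ → u = v := by
    intro u hu v hv huv
    have h1 := inv_mul_mem_nearOne (min_le_right _ _) hu hv
    have h2 := hΓ 1 rfl _ huv (by
      rw [one_mul, inv_one, mul_one]
      exact nearOne_mono (by linarith [min_le_left (c / 4) 1]) h1)
    exact (inv_mul_eq_one.1 h2)
  have hm0 : 0 < (μ U).toReal :=
    ENNReal.toReal_pos (measure_nearOne_pos μ hc'0).ne' (measure_nearOne_lt_top μ c').ne
  refine ⟨((μ U).toReal)⁻¹, by positivity, fun k₁ k₂ V hV hvol => ?_⟩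
  set θ := k₁⁻¹ * k₂ with hθ
  have hlt : orbitVol μ Γ ((k₁ : G ⧸ Γ), (k₂ : G ⧸ Γ)) < ENNReal.ofReal (V + 1) :=
    hvol.trans_lt ((ENNReal.ofReal_lt_ofReal_iff (by linarith)).2 (by linarith))
  simp only [orbitVol, iInf_lt_iff] at hlt
  obtain ⟨S, hS, hSorb, hSV⟩ := hlt
  -- This is the stabilizer of the pair `(k₁Γ, k₂Γ)` in `H ≅ G`; the set `S`, which maps onto the
  -- orbit, therefore covers `G/Δ`.
  let Δ : Subgroup G := conjBy k₁ (conjBy θ Γ ⊓ Γ)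
  have hΔ : ∀ g, g ∈ Δ ↔ k₂⁻¹ * g * k₂ ∈ Γ ∧ k₁⁻¹ * g * k₁ ∈ Γ := by
    intro g
    simp only [Δ, mem_conjBy, Subgroup.mem_inf]
    have : θ⁻¹ * (k₁⁻¹ * g * k₁) * θ = k₂⁻¹ * g * k₂ := by simp [hθ, mul_assoc]
    rw [this]
  have : Countable Δ := by
    refine Function.Injective.countable (f := fun g : Δ => (⟨_, ((hΔ g).1 g.2).2⟩ : Γ)) ?_
    intro g g' hgg
    have h1 : k₁⁻¹ * (g : G) * k₁ = k₁⁻¹ * (g' : G) * k₁ := congrArg Subtype.val hgg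
    exact Subtype.ext (mul_left_cancel (mul_right_cancel h1))
  have hcov : ∀ g : G, ∃ s ∈ S, ∃ l ∈ Δ, g = s * l := by
    intro g
    obtain ⟨η, hη, hηg⟩ := hSorb _ ⟨g, rfl⟩
    refine ⟨η, hη, η⁻¹ * g, (hΔ _).2 ⟨?_, ?_⟩, by simp⟩
    · have h1 : ((g * k₂ : G) : G ⧸ Γ) = ((η * k₂ : G) : G ⧸ Γ) := (Prod.ext_iff.1 hηg).2
      have h2 := QuotientGroup.eq.1 h1.symm
      simpa [mul_assoc] using h2
    · have h1 : ((g * k₁ : G) : G ⧸ Γ) = ((η * k₁ : G) : G ⧸ Γ) := (Prod.ext_iff.1 hηg).1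
      have h2 := QuotientGroup.eq.1 h1.symm
      simpa [mul_assoc] using h2
  have hcard : ∀ F : Finset (Γ ⧸ (conjBy θ Γ).subgroupOf Γ),
      (F.card : ℝ) ≤ ((μ U).toReal)⁻¹ * (V + 1) := by
    intro F
    let t : Γ ⧸ (conjBy θ Γ).subgroupOf Γ → G := fun q => (Quotient.out q : Γ)
    -- The translates `U t(q) k₁⁻¹`, one for each coset. Together they inject into `G/Δ`, because
    -- `U` injects into `G/Γ` and the cosets are distinct; so the number of cosets times `μ U` is at
    -- most `μ S`.
    let Bq : Γ ⧸ (conjBy θ Γ).subgroupOf Γ → Set G := fun q =>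
      (fun b => b * (k₁ * (t q)⁻¹)) ⁻¹' U
    have hBm : ∀ q, MeasurableSet (Bq q) := fun q =>
      ((isOpen_nearOne c').preimage (continuous_mul_const _)).measurableSet
    have hBμ : ∀ q, μ (Bq q) = μ U := fun q => measure_preimage_mul_right _ _ _
    have hkey : ∀ q q', ∀ b ∈ Bq q, ∀ b' ∈ Bq q', b⁻¹ * b' ∈ Δ → q = q' ∧ b = b' := by
      intro q q' b hb b' hb' hbb
      obtain ⟨h2, h1⟩ := (hΔ _).1 hbb
      have e1 : (b * (k₁ * (t q)⁻¹))⁻¹ * (b' * (k₁ * (t q')⁻¹)) =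
          t q * (k₁⁻¹ * (b⁻¹ * b') * k₁) * (t q')⁻¹ := by simp [mul_assoc]
      have ht : ∀ q, t q ∈ Γ := fun q => (Quotient.out q : Γ).2
      have h3 : b * (k₁ * (t q)⁻¹) = b' * (k₁ * (t q')⁻¹) := hUinj _ hb _ hb' (by
        rw [e1]; exact Γ.mul_mem (Γ.mul_mem (ht q) h1) (Γ.inv_mem (ht q')))
      have e2 : k₁⁻¹ * (b⁻¹ * b') * k₁ = (t q)⁻¹ * t q' := by
        have h4 : b' = b * (k₁ * (t q)⁻¹) * (k₁ * (t q')⁻¹)⁻¹ := by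
          rw [h3, mul_inv_cancel_right]
        rw [h4]; simp [mul_assoc]
      have hq : q = q' := by
        have h5 : (t q)⁻¹ * t q' ∈ conjBy θ Γ := by
          rw [← e2, mem_conjBy]
          have : θ⁻¹ * (k₁⁻¹ * (b⁻¹ * b') * k₁) * θ = k₂⁻¹ * (b⁻¹ * b') * k₂ := by
            simp [hθ, mul_assoc]
          rw [this]; exact h2
        have h6 : (QuotientGroup.mk (Quotient.out q) : Γ ⧸ (conjBy θ Γ).subgroupOf Γ) =
            QuotientGroup.mk (Quotient.out q') :=
          QuotientGroup.eq.2 (Subgroup.mem_subgroupOf.2 (by simpa [t] using h5))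
        rwa [QuotientGroup.out_eq', QuotientGroup.out_eq'] at h6
      subst hq
      exact ⟨rfl, mul_right_cancel h3⟩
    have hle : μ (⋃ q ∈ F, Bq q) ≤ μ S := by
      refine measure_le_of_injective_mod μ (Λ := Δ) hS (F.measurableSet_biUnion fun q _ => hBm q)
        hcov ?_
      intro b hb b' hb' hbb
      obtain ⟨q, -, hq⟩ := Set.mem_iUnion₂.1 hb
      obtain ⟨q', -, hq'⟩ := Set.mem_iUnion₂.1 hb'
      exact (hkey q q' b hq b' hq' hbb).2
    rw [measure_biUnion_finset (fun q _ q' _ hqq => Set.disjoint_left.2 fun b hb hb' =>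
      hqq (hkey q q' b hb b hb' (by rw [inv_mul_cancel]; exact Δ.one_mem)).1) fun q _ => hBm q] at hle
    simp_rw [hBμ] at hle
    rw [Finset.sum_const, nsmul_eq_mul] at hle
    have h7 := ENNReal.toReal_le_of_le_ofReal (by linarith : 0 ≤ V + 1) (hle.trans hSV.le)
    rw [ENNReal.toReal_mul, ENNReal.toReal_natCast] at h7
    rw [inv_mul_eq_div, le_div_iff₀ hm0]
    exact h7
  obtain ⟨hfin, hle⟩ := card_le_of_forall_finset hcard
  refine ⟨?_, hle⟩
  exact Nat.card_ne_zero.2 ⟨⟨((1 : Γ) : Γ ⧸ _)⟩, hfin⟩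

/-! ### Short non-commuting elements in subgroups of finite index -/

/-- Pigeonhole in `G/Δ`, whose volume is proportional to the index: among the neighbourhoods of `h_k
κ`, for `k` up to a multiple of the index, two must overlap modulo `Δ`. The resulting `γ` is
conjugate by `κ` to nearly `h_τ` with `τ` a non-zero integer, which explains the linear bound and
the dominant upper right entry. -/
theorem exists_short_upper [MeasurableSpace G] [BorelSpace G] (μ : Measure G)
    [μ.IsHaarMeasure] (Γ : Subgroup G) [DiscreteTopology Γ] [Countable Γ]
    [CompactSpace (G ⧸ Γ)] {K : Set G} (hK : IsCompact K) :
    ∃ C : ℝ, 1 ≤ C ∧ ∀ κ ∈ K, ∀ Δ ≤ Γ, Δ.relIndex Γ ≠ 0 → ∃ γ ∈ Δ,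
      |(κ * γ * κ⁻¹ : G) 1 0| < |(κ * γ * κ⁻¹ : G) 0 1| ∧
        Bd (κ * γ * κ⁻¹ : G) (C * Δ.relIndex Γ) := by
  obtain ⟨c, hc, hΓ⟩ := exists_uniform_discrete (Γ := Γ) hK
  obtain ⟨K₀, hK₀, -, hK₀Γ⟩ := exists_isCompact_mul (Γ := Γ)
  -- `c/4` keeps `U⁻¹U` inside the uniform discreteness neighbourhood; `1/20` makes `τ` dominate the
  -- errors in `U⁻¹ h_τ U` as soon as `|τ| ≥ 1`.
  set c' := min (c / 4) (1 / 20) with hc'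
  have hc'0 : 0 < c' := lt_min (by linarith) (by norm_num)
  have hc'1 : c' ≤ 1 / 20 := min_le_right _ _
  set U := nearOne c' with hU
  set m := (μ U).toReal with hm
  have hm0 : 0 < m :=
    ENNReal.toReal_pos (measure_nearOne_pos μ hc'0).ne' (measure_nearOne_lt_top μ c').ne
  set M := (μ K₀).toReal with hM
  have hM0 : 0 ≤ M := ENNReal.toReal_nonneg
  refine ⟨5 * (M / m + 1), by linarith [div_nonneg hM0 hm0.le], fun κ hκ Δ hΔ hN => ?_⟩
  set N := Δ.relIndex Γ with hNdef
  have hN1 : (1 : ℝ) ≤ N := by exact_mod_cast Nat.one_le_iff_ne_zero.2 hN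
  -- Just enough balls for `n · μ U` to exceed `N · μ K₀`, a bound for the volume of `G/Δ`.
  set n := ⌊N * M / m⌋₊ + 1 with hn
  have hn1 : N * M / m < n := by rw [hn]; push_cast; exact Nat.lt_floor_add_one _
  have hn2 : (n : ℝ) ≤ N * (M / m + 1) := by
    have : (⌊N * M / m⌋₊ : ℝ) ≤ N * M / m := Nat.floor_le (by positivity)
    rw [hn]; push_cast; rw [mul_add, ← mul_div_assoc]; linarith
  have hfin : Finite (Γ ⧸ Δ.subgroupOf Γ) := (Nat.card_ne_zero.1 hN).2
  have : Fintype (Γ ⧸ Δ.subgroupOf Γ) := Fintype.ofFinite _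
  have : Countable Δ := (Subgroup.inclusion_injective hΔ).countable
  let t : Γ ⧸ Δ.subgroupOf Γ → G := fun q => (Quotient.out q : Γ)
  let S : Set G := ⋃ q, (fun g => g * (t q)⁻¹) ⁻¹' K₀
  have hSm : MeasurableSet S := MeasurableSet.iUnion fun q =>
    (hK₀.isClosed.preimage (continuous_mul_const _)).measurableSet
  have hSμ : μ S ≤ N * μ K₀ := by
    calc μ S ≤ ∑ q, μ ((fun g => g * (t q)⁻¹) ⁻¹' K₀) := measure_iUnion_fintype_le _ _
      _ = ∑ _q : Γ ⧸ Δ.subgroupOf Γ, μ K₀ := by simp_rw [measure_preimage_mul_right]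
      _ = N * μ K₀ := by
        rw [Finset.sum_const, nsmul_eq_mul, Finset.card_univ, ← Nat.card_eq_fintype_card]; rfl
  have hcov : ∀ g : G, ∃ s ∈ S, ∃ l ∈ Δ, g = s * l := by
    intro g
    obtain ⟨k, hk, γ, hγ, rfl⟩ := hK₀Γ g
    let q : Γ ⧸ Δ.subgroupOf Γ := ((⟨γ, hγ⟩ : Γ) : Γ ⧸ Δ.subgroupOf Γ)
    have h1 : (t q)⁻¹ * γ ∈ Δ := by
      have h2 : (QuotientGroup.mk (Quotient.out q) : Γ ⧸ Δ.subgroupOf Γ) =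
        QuotientGroup.mk ⟨γ, hγ⟩ := QuotientGroup.out_eq' q
      exact Subgroup.mem_subgroupOf.1 (QuotientGroup.eq.1 h2)
    refine ⟨k * t q, Set.mem_iUnion.2 ⟨q, ?_⟩, _, h1, by simp [mul_assoc]⟩
    simpa using hk
  let Bk : ℕ → Set G := fun k => (fun g => h (-k) * (g * κ⁻¹)) ⁻¹' U
  have hBkm : ∀ k, MeasurableSet (Bk k) := fun k =>
    ((isOpen_nearOne c').preimage
      ((continuous_const_mul (h (-k))).comp (continuous_mul_const κ⁻¹))).measurableSet
  have hBkμ : ∀ k, μ (Bk k) = μ U := by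
    intro k
    have : Bk k = (fun g => g * κ⁻¹) ⁻¹' ((fun g => h (-k) * g) ⁻¹' U) := rfl
    rw [this, measure_preimage_mul_right, measure_preimage_mul]
  have hdecomp : ∀ (k k' : ℕ) (b b' : G), κ * (b⁻¹ * b') * κ⁻¹ =
      (h (-k) * (b * κ⁻¹))⁻¹ * (h ((k' : ℝ) - k) * (h (-k') * (b' * κ⁻¹))) := by
    intro k k' b b'
    rw [← mul_assoc (h _) (h _), h_mul_h, mul_inv_rev, h_inv]
    have : (k' : ℝ) - k + -k' = -k := by ring
    rw [this, neg_neg, mul_assoc _ (h k), ← mul_assoc (h k), h_mul_h, add_neg_cancel, h_zero]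
    simp [mul_assoc]
  have hentry : ∀ u ∈ U, ∀ v ∈ U, ∀ τ : ℝ, 1 ≤ |τ| → ∀ z : G, z = u⁻¹ * (h τ * v) →
      |z 1 0| < |z 0 1| ∧ Bd z (5 * |τ|) := by
    intro u hu v hv τ hτ z hz
    obtain ⟨u1, u2, u3, u4⟩ := nearOne_entries hu
    obtain ⟨v1, v2, v3, v4⟩ := nearOne_entries hv
    have hb : ∀ x : ℝ, |x - 1| < c' → |x| ≤ 21 / 20 ∧ 19 / 20 ≤ |x| := by
      intro x hx
      have h1 := abs_sub_abs_le_abs_sub x 1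
      have h2 := abs_sub_abs_le_abs_sub 1 x
      rw [abs_sub_comm 1 x] at h2
      rw [abs_one] at h1 h2
      constructor <;> linarith
    obtain ⟨U1, U1'⟩ := hb _ u1
    obtain ⟨U4, U4'⟩ := hb _ u4
    obtain ⟨V1, V1'⟩ := hb _ v1
    obtain ⟨V4, V4'⟩ := hb _ v4
    have U2 : |u 0 1| ≤ 1 / 20 := by linarith
    have U3 : |u 1 0| ≤ 1 / 20 := by linarith
    have V2 : |v 0 1| ≤ 1 / 20 := by linarith
    have V3 : |v 1 0| ≤ 1 / 20 := by linarith
    have hzval : (z : Matrix (Fin 2) (Fin 2) ℝ) =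
        !![u 1 1 * (v 0 0 + τ * v 1 0) - u 0 1 * v 1 0, u 1 1 * (v 0 1 + τ * v 1 1) - u 0 1 * v 1 1;
          -u 1 0 * (v 0 0 + τ * v 1 0) + u 0 0 * v 1 0,
          -u 1 0 * (v 0 1 + τ * v 1 1) + u 0 0 * v 1 1] := by
      rw [hz, coe_mul_eq, coe_mul_eq, coe_inv_eq, coe_h]
      simp [sub_eq_add_neg]
    have hT : 0 ≤ |τ| := abs_nonneg τ
    have tri : ∀ x y : ℝ, |x + y| ≤ |x| + |y| := abs_add_le
    have mulb : ∀ {x y a b : ℝ}, |x| ≤ a → |y| ≤ b → |x * y| ≤ a * b := fun hx hy => by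
      rw [abs_mul]; exact mul_le_mul hx hy (abs_nonneg _) ((abs_nonneg _).trans hx)
    have U3n : |-u 1 0| ≤ 1 / 20 := by rwa [abs_neg]
    have hp1 : ∀ p r : ℝ, |p + τ * r| ≤ |p| + |τ| * |r| := fun p r =>
      (tri _ _).trans (by rw [abs_mul])
    have hw1 : |v 0 0 + τ * v 1 0| ≤ 21 / 20 + |τ| * (1 / 20) :=
      (hp1 _ _).trans (add_le_add V1 (mul_le_mul_of_nonneg_left V3 hT))
    have hw2 : |v 0 1 + τ * v 1 1| ≤ 1 / 20 + |τ| * (21 / 20) :=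
      (hp1 _ _).trans (add_le_add V2 (mul_le_mul_of_nonneg_left V4 hT))
    have z10 : |-u 1 0 * (v 0 0 + τ * v 1 0) + u 0 0 * v 1 0| ≤
        1 / 20 * (21 / 20 + |τ| * (1 / 20)) + 21 / 20 * (1 / 20) :=
      (tri _ _).trans (add_le_add (mulb U3n hw1) (mulb U1 V3))
    have hlow : |u 1 1 * (v 0 1 + τ * v 1 1) - u 0 1 * v 1 1| ≥
        19 / 20 * (19 / 20) * |τ| - 21 / 20 * (1 / 20) - 1 / 20 * (21 / 20) := by
      have e : τ * (u 1 1 * v 1 1) = (u 1 1 * (v 0 1 + τ * v 1 1) - u 0 1 * v 1 1)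
        + (-(u 1 1 * v 0 1) + u 0 1 * v 1 1) := by ring
      have h1 : |τ| * (|u 1 1| * |v 1 1|) ≤ |u 1 1 * (v 0 1 + τ * v 1 1) - u 0 1 * v 1 1|
        + (21 / 20 * (1 / 20) + 1 / 20 * (21 / 20)) := by
        rw [← abs_mul, ← abs_mul, e]
        refine (tri _ _).trans (add_le_add le_rfl ((tri _ _).trans
          (add_le_add (by rw [abs_neg]; exact mulb U4 V2) (mulb U2 V4))))
      have h2 : 19 / 20 * (19 / 20) ≤ |u 1 1| * |v 1 1| :=
        mul_le_mul U4' V4' (by norm_num) (abs_nonneg _)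
      have h3 := mul_le_mul_of_nonneg_left h2 hT
      linarith
    refine ⟨?_, fun i j => ?_⟩
    · rw [hzval]; simp only [Matrix.of_apply, Matrix.cons_val', Matrix.cons_val_zero,
        Matrix.cons_val_one, Matrix.cons_val_fin_one]
      linarith
    · rw [hzval]
      fin_cases i <;> fin_cases j <;> simp only [Fin.zero_eta, Fin.mk_one, Fin.isValue,
        Matrix.of_apply, Matrix.cons_val', Matrix.cons_val_zero, Matrix.cons_val_one,
        Matrix.cons_val_fin_one]
      · refine (abs_sub _ _).trans ((add_le_add (mulb U4 hw1) (mulb U2 V3)).trans ?_); linarith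
      · refine (abs_sub _ _).trans ((add_le_add (mulb U4 hw2) (mulb U2 V4)).trans ?_); linarith
      · linarith
      · refine (tri _ _).trans ((add_le_add (mulb U3n hw2) (mulb U1 V4)).trans ?_)
        linarith
  have hτ : ∀ k k' : ℕ, k ≠ k' → 1 ≤ |(k' : ℝ) - k| := by
    intro k k' hkk
    have : (1 : ℤ) ≤ |(k' : ℤ) - k| := Int.one_le_abs (by omega)
    exact_mod_cast this
  have hdisj : ∀ k k', k ≠ k' → Disjoint (Bk k) (Bk k') := by
    intro k k' hkk
    refine Set.disjoint_left.2 fun b hb hb' => ?_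
    have h1 := (hentry _ hb _ hb' _ (hτ k k' hkk) _ (hdecomp k k' b b)).1
    simp at h1
  have hB : ¬ μ (⋃ k ∈ Finset.range n, Bk k) ≤ μ S := by
    rw [measure_biUnion_finset (fun k _ k' _ hkk => hdisj k k' hkk) fun k _ => hBkm k]
    simp_rw [hBkμ]
    rw [Finset.sum_const, nsmul_eq_mul, Finset.card_range]
    intro hle
    have h1 := hle.trans hSμ
    have h2 := ENNReal.toReal_mono (ENNReal.mul_ne_top (by simp) hK₀.measure_lt_top.ne) h1
    rw [ENNReal.toReal_mul, ENNReal.toReal_mul, ENNReal.toReal_natCast,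
      ENNReal.toReal_natCast, ← hm, ← hM] at h2
    rw [div_lt_iff₀ hm0] at hn1
    linarith
  have hnot : ¬ ∀ b ∈ ⋃ k ∈ Finset.range n, Bk k, ∀ b' ∈ ⋃ k ∈ Finset.range n, Bk k,
      b⁻¹ * b' ∈ Δ → b = b' := fun hinj => hB (measure_le_of_injective_mod μ hSm
        ((Finset.range n).measurableSet_biUnion fun k _ => hBkm k) hcov hinj)
  push Not at hnot
  obtain ⟨b, hb, b', hb', hmem, hne⟩ := hnot
  obtain ⟨k, hkn, hk⟩ := Set.mem_iUnion₂.1 hb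
  obtain ⟨k', hkn', hk'⟩ := Set.mem_iUnion₂.1 hb'
  -- A collision within one ball would put `κγκ⁻¹` in `U⁻¹U`, so `γ = 1` and the two points would
  -- coincide.
  have hkk : k ≠ k' := by
    rintro rfl
    have h1 := hdecomp k k b b'
    rw [sub_self, h_zero, one_mul] at h1
    have h2 := hΓ κ hκ _ (hΔ hmem) (by
      rw [h1]
      exact nearOne_mono (by linarith [min_le_left (c / 4) (1 / 20)])
        (inv_mul_mem_nearOne (hc'1.trans (by norm_num)) hk hk'))
    exact hne (inv_mul_eq_one.1 h2)
  obtain ⟨h1, h2⟩ := hentry _ hk _ hk' _ (hτ k k' hkk) _ (hdecomp k k' b b')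
  refine ⟨_, hmem, h1, fun i j => (h2 i j).trans ?_⟩
  have h3 : |(k' : ℝ) - k| ≤ n := by
    have e1 : (k : ℝ) < n := by exact_mod_cast Finset.mem_range.1 hkn
    have e2 : (k' : ℝ) < n := by exact_mod_cast Finset.mem_range.1 hkn'
    have e3 : (0 : ℝ) ≤ k := k.cast_nonneg
    have e4 : (0 : ℝ) ≤ k' := k'.cast_nonneg
    rw [abs_le]; constructor <;> linarith
  linarith

/-- A subgroup of index `N` of a cocompact lattice contains a pair of non-commuting elements
whose entries are `O(N)`, uniformly over conjugates by a compact set. -/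
theorem exists_short_noncommuting [MeasurableSpace G] [BorelSpace G] (μ : Measure G)
    [μ.IsHaarMeasure] (Γ : Subgroup G) [DiscreteTopology Γ] [Countable Γ]
    [CompactSpace (G ⧸ Γ)] {K : Set G} (hK : IsCompact K) :
    ∃ C : ℝ, 1 ≤ C ∧ ∀ κ ∈ K, ∀ Δ ≤ Γ, Δ.relIndex Γ ≠ 0 → ∃ a ∈ Δ, ∃ b ∈ Δ,
      a * b ≠ b * a ∧ Bd (κ * a * κ⁻¹ : G) (C * Δ.relIndex Γ) ∧
        Bd (κ * b * κ⁻¹ : G) (C * Δ.relIndex Γ) := by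
  obtain ⟨C₁, hC₁, h₁⟩ := exists_short_upper μ Γ hK
  -- Conjugating by the Weyl element swaps the off-diagonal entries up to sign, so `b` has a
  -- dominant lower left entry while `a` has a dominant upper right one. Commuting elements have
  -- proportional off-diagonal parts, which rules this out.
  obtain ⟨C₂, hC₂, h₂⟩ := exists_short_upper μ Γ (hK.image (continuous_const_mul weyl))
  refine ⟨max C₁ C₂, le_max_of_le_left hC₁, fun κ hκ Δ hΔ hN => ?_⟩
  obtain ⟨a, ha, ha1, ha2⟩ := h₁ κ hκ Δ hΔ hN
  obtain ⟨b, hb, hb1, hb2⟩ := h₂ _ ⟨κ, hκ, rfl⟩ Δ hΔ hN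
  have hNn : (0 : ℝ) ≤ Δ.relIndex Γ := Nat.cast_nonneg _
  have hval : ((weyl * κ * b * (weyl * κ)⁻¹ : G) : Matrix (Fin 2) (Fin 2) ℝ) =
      !![(κ * b * κ⁻¹ : G) 1 1, -(κ * b * κ⁻¹ : G) 1 0;
        -(κ * b * κ⁻¹ : G) 0 1, (κ * b * κ⁻¹ : G) 0 0] := by
    have : weyl * κ * b * (weyl * κ)⁻¹ = weyl * (κ * b * κ⁻¹) * weyl⁻¹ := by simp [mul_assoc]
    rw [this]
    generalize κ * b * κ⁻¹ = z
    rw [coe_mul_eq, coe_mul_eq, coe_inv_eq, coe_weyl]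
    simp
  refine ⟨a, ha, b, hb, fun hab => ?_, fun i j => (ha2 i j).trans ?_, fun i j => ?_⟩
  · rw [hval] at hb1
    simp only [Matrix.of_apply, Matrix.cons_val', Matrix.cons_val_zero,
        Matrix.cons_val_one, Matrix.cons_val_fin_one, abs_neg] at hb1
    have h3 : (κ * a * κ⁻¹) * (κ * b * κ⁻¹) = (κ * b * κ⁻¹) * (κ * a * κ⁻¹) := by
      have e1 : (κ * a * κ⁻¹) * (κ * b * κ⁻¹) = κ * (a * b) * κ⁻¹ := by simp [mul_assoc]
      have e2 : (κ * b * κ⁻¹) * (κ * a * κ⁻¹) = κ * (b * a) * κ⁻¹ := by simp [mul_assoc]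
      rw [e1, e2, hab]
    generalize κ * a * κ⁻¹ = x at h3 ha1
    generalize κ * b * κ⁻¹ = y at h3 hb1
    have h4 := congrArg (fun g : G => (g : Matrix (Fin 2) (Fin 2) ℝ) 0 0) h3
    simp only [coe_mul_eq, Matrix.of_apply, Matrix.cons_val', Matrix.cons_val_zero,
        Matrix.cons_val_fin_one] at h4
    have h5 : x 0 1 * y 1 0 = y 0 1 * x 1 0 := by linarith
    have h6 := congrArg abs h5
    rw [abs_mul, abs_mul] at h6
    nlinarith [abs_nonneg (x 0 1), abs_nonneg (x 1 0), abs_nonneg (y 1 0), abs_nonneg (y 0 1)]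
  · exact mul_le_mul_of_nonneg_right (le_max_left _ _) hNn
  · have h3 : ∀ i j, |(weyl * κ * b * (weyl * κ)⁻¹ : G) i j| ≤ max C₁ C₂ * Δ.relIndex Γ :=
      fun i j => (hb2 i j).trans (mul_le_mul_of_nonneg_right (le_max_right _ _) hNn)
    rw [hval] at h3
    have e1 := h3 0 0
    have e2 := h3 0 1
    have e3 := h3 1 0
    have e4 := h3 1 1
    simp only [Matrix.of_apply, Matrix.cons_val', Matrix.cons_val_zero,
        Matrix.cons_val_one, Matrix.cons_val_fin_one, abs_neg] at e1 e2 e3 e4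
    fin_cases i <;> fin_cases j <;> assumption

/-! ### Entrywise bounds -/

theorem Bd.nonneg {M : Matrix (Fin 2) (Fin 2) ℝ} {b : ℝ} (hM : Bd M b) : 0 ≤ b :=
  (abs_nonneg _).trans (hM 0 0)

theorem Bd.mono {M : Matrix (Fin 2) (Fin 2) ℝ} {b c : ℝ} (hM : Bd M b) (h : b ≤ c) : Bd M c :=
  fun i j => (hM i j).trans h

theorem Bd.mul {M N : Matrix (Fin 2) (Fin 2) ℝ} {b c : ℝ} (hM : Bd M b) (hN : Bd N c) :
    Bd (M * N) (2 * b * c) := by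
  intro i j
  rw [Matrix.mul_apply, Fin.sum_univ_two]
  refine (abs_add_le _ _).trans ?_
  rw [abs_mul, abs_mul]
  have h1 := mul_le_mul (hM i 0) (hN 0 j) (abs_nonneg _) hM.nonneg
  have h2 := mul_le_mul (hM i 1) (hN 1 j) (abs_nonneg _) hM.nonneg
  linarith

theorem Bd.add {M N : Matrix (Fin 2) (Fin 2) ℝ} {b c : ℝ} (hM : Bd M b) (hN : Bd N c) :
    Bd (M + N) (b + c) := fun i j => (abs_add_le _ _).trans (add_le_add (hM i j) (hN i j))

theorem Bd.sub {M N : Matrix (Fin 2) (Fin 2) ℝ} {b c : ℝ} (hM : Bd M b) (hN : Bd N c) :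
    Bd (M - N) (b + c) := fun i j => (abs_sub _ _).trans (add_le_add (hM i j) (hN i j))

theorem bd_one : Bd (1 : Matrix (Fin 2) (Fin 2) ℝ) 1 := by
  intro i j
  rw [Matrix.one_apply]; split_ifs <;> simp

theorem Bd.inv {g : G} {b : ℝ} (hg : Bd g b) : Bd (g⁻¹ : G) b := by
  intro i j
  rw [coe_inv_eq]
  fin_cases i <;> fin_cases j <;> simp [abs_neg] <;> exact hg _ _

theorem Bd.of_sub_one {M : Matrix (Fin 2) (Fin 2) ℝ} {b : ℝ} (hM : Bd (M - 1) b) :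
    Bd M (b + 1) := by
  have := hM.add bd_one
  rwa [sub_add_cancel] at this

theorem Bd.inv_sub_one {g : G} {b : ℝ} (hg : Bd ((g : Matrix (Fin 2) (Fin 2) ℝ) - 1) b) :
    Bd (((g⁻¹ : G) : Matrix (Fin 2) (Fin 2) ℝ) - 1) b := by
  have h0 := hg 0 0
  have h1 := hg 0 1
  have h2 := hg 1 0
  have h3 := hg 1 1
  simp [Matrix.sub_apply] at h0 h1 h2 h3
  intro i j
  rw [Matrix.sub_apply, coe_inv_eq]
  fin_cases i <;> fin_cases j <;> simp [abs_neg] <;> assumption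

theorem Bd.mul_sub_one {M N : Matrix (Fin 2) (Fin 2) ℝ} {b c : ℝ} (hM : Bd (M - 1) b)
    (hN : Bd (N - 1) c) : Bd (M * N - 1) (b + c + 2 * b * c) := by
  have h := (hM.add hN).add (hM.mul hN)
  have e : M - 1 + (N - 1) + (M - 1) * (N - 1) = M * N - 1 := by noncomm_ring
  rwa [e] at h

/-! ### Centralizers and conjugates -/

/-- Two elements commute exactly when their traceless parts are parallel. A non-scalar `e` would
force the traceless parts of `x` and `y` to be parallel to its own; so `e = ±1`, and the entry bound
excludes `-1`. -/
theorem eq_one_of_commute {e x y : G} (hx : e * x = x * e) (hy : e * y = y * e)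
    (hxy : x * y ≠ y * x) (he : Bd ((e : Matrix (Fin 2) (Fin 2) ℝ) - 1) (1 / 2)) : e = 1 := by
  have hcomm : ∀ u v : G, u * v = v * u ↔ (u 0 1 * v 1 0 = v 0 1 * u 1 0 ∧
      (u 0 0 - u 1 1) * v 0 1 = u 0 1 * (v 0 0 - v 1 1) ∧
      (u 0 0 - u 1 1) * v 1 0 = u 1 0 * (v 0 0 - v 1 1)) := by
    intro u v
    constructor
    · intro huv
      have h1 := congrArg (fun g : G => (g : Matrix (Fin 2) (Fin 2) ℝ) 0 0) huv
      have h2 := congrArg (fun g : G => (g : Matrix (Fin 2) (Fin 2) ℝ) 0 1) huv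
      have h3 := congrArg (fun g : G => (g : Matrix (Fin 2) (Fin 2) ℝ) 1 0) huv
      simp only [coe_mul_eq, Matrix.of_apply, Matrix.cons_val', Matrix.cons_val_zero,
        Matrix.cons_val_one, Matrix.cons_val_fin_one] at h1 h2 h3
      refine ⟨?_, ?_, ?_⟩ <;> linarith
    · rintro ⟨h1, h2, h3⟩
      apply ext_entries <;> simp only [coe_mul_eq, Matrix.of_apply, Matrix.cons_val',
        Matrix.cons_val_zero, Matrix.cons_val_one, Matrix.cons_val_fin_one] <;> linarith
  obtain ⟨x1, x2, x3⟩ := (hcomm e x).1 hx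
  obtain ⟨y1, y2, y3⟩ := (hcomm e y).1 hy
  rw [Ne, hcomm] at hxy
  have E0 : e 0 1 = 0 := by
    by_contra h0
    have h2 : (x 0 0 - x 1 1) * y 0 1 = x 0 1 * (y 0 0 - y 1 1) :=
      mul_left_cancel₀ h0 (by linear_combination y 0 1 * (-x2) + x 0 1 * y2)
    refine hxy ⟨mul_left_cancel₀ h0 ?_, h2, mul_left_cancel₀ h0 ?_⟩
    · linear_combination x 0 1 * y1 - y 0 1 * x1
    · linear_combination (x 0 0 - x 1 1) * y1 - (y 0 0 - y 1 1) * x1 + e 1 0 * h2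
  have E1 : e 1 0 = 0 := by
    by_contra h0
    refine hxy ⟨mul_left_cancel₀ h0 ?_, mul_left_cancel₀ h0 ?_, mul_left_cancel₀ h0 ?_⟩
    · linear_combination x 1 0 * y1 - y 1 0 * x1
    · linear_combination (x 0 0 - x 1 1) * (-y1) + (y 0 0 - y 1 1) * x1 +
        ((x 0 0 - x 1 1) * y 1 0 - (y 0 0 - y 1 1) * x 1 0) * E0
    · linear_combination x 1 0 * y3 - y 1 0 * x3
  have E2 : e 0 0 - e 1 1 = 0 := by
    by_contra h0
    refine hxy ⟨mul_left_cancel₀ h0 ?_, mul_left_cancel₀ h0 ?_, mul_left_cancel₀ h0 ?_⟩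
    · rw [E0] at x2 y2
      rw [E1] at x3 y3
      simp only [zero_mul, mul_eq_zero, h0, false_or] at x2 y2
      rw [x2, y2]; ring
    · rw [E0] at x2 y2
      simp only [zero_mul, mul_eq_zero, h0, false_or] at x2 y2
      rw [x2, y2]; ring
    · rw [E1] at x3 y3
      simp only [zero_mul, mul_eq_zero, h0, false_or] at x3 y3
      rw [x3, y3]; ring
  have hdet := det_entries e
  rw [E0, zero_mul, sub_zero, ← sub_eq_zero.1 E2] at hdet
  have h00 := he 0 0
  simp [Matrix.sub_apply] at h00
  rw [abs_le] at h00
  have e00 : e 0 0 = 1 := by nlinarith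
  apply ext_entries
  · simpa using e00
  · simpa using E0
  · simpa using E1
  · rw [← sub_eq_zero.1 E2]; simpa using e00

theorem conjBy_mul (θ θ' : G) (Γ : Subgroup G) : conjBy (θ * θ') Γ = conjBy θ (conjBy θ' Γ) := by
  ext g; simp only [mem_conjBy, mul_inv_rev, mul_assoc]

theorem conjBy_self {γ : G} {Γ : Subgroup G} (hγ : γ ∈ Γ) : conjBy γ Γ = Γ := by
  ext g
  rw [mem_conjBy, mul_assoc, Γ.mul_mem_cancel_left (Γ.inv_mem hγ), Γ.mul_mem_cancel_right hγ]

theorem relIndex_conjBy_conjBy (θ : G) (Γ Δ : Subgroup G) :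
    (conjBy θ Δ).relIndex (conjBy θ Γ) = Δ.relIndex Γ :=
  Subgroup.relIndex_map_map_of_injective _ _ (MulAut.conj θ).injective

/-- The index depends only on the double coset `ΓθΓ`, which allows `f₁` and `f₂` to be replaced by
representatives in a compact set. -/
theorem relIndex_conjBy_mul_mul (θ : G) {γ γ' : G} {Γ : Subgroup G} (hγ : γ ∈ Γ) (hγ' : γ' ∈ Γ) :
    (conjBy (γ * θ * γ') Γ).relIndex Γ = (conjBy θ Γ).relIndex Γ := by
  rw [conjBy_mul, conjBy_self hγ', conjBy_mul]
  calc (conjBy γ (conjBy θ Γ)).relIndex Γ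
      = (conjBy γ (conjBy θ Γ)).relIndex (conjBy γ Γ) := by rw [conjBy_self hγ]
    _ = (conjBy θ Γ).relIndex Γ := relIndex_conjBy_conjBy _ _ _

/-- Elements that conjugate a lattice into a commensurable one with small index are separated. -/
theorem exists_separation [MeasurableSpace G] [BorelSpace G] (μ : Measure G)
    [μ.IsHaarMeasure] (Γ : Subgroup G) [DiscreteTopology Γ] [Countable Γ]
    [CompactSpace (G ⧸ Γ)] :
    ∃ C : ℝ, 1 ≤ C ∧ ∀ (f₁ f₂ θ θ' : G) (N B η : ℝ), 1 ≤ N → 1 ≤ B →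
      (conjBy θ Γ).relIndex Γ ≠ 0 → ((conjBy θ Γ).relIndex Γ : ℝ) ≤ N →
      (conjBy θ' Γ).relIndex Γ ≠ 0 → ((conjBy θ' Γ).relIndex Γ : ℝ) ≤ N →
      Bd (f₁ * θ * f₂⁻¹ : G) B →
      Bd ((((f₁ * θ * f₂⁻¹)⁻¹ * (f₁ * θ' * f₂⁻¹) : G) : Matrix (Fin 2) (Fin 2) ℝ) - 1) η →
      C * N ^ 4 * B ^ 4 * η < 1 → θ = θ' := by
  obtain ⟨K, hK, -, hKΓ⟩ := exists_isCompact_mul (Γ := Γ)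
  obtain ⟨C₁, hC₁, hshort⟩ := exists_short_noncommuting μ Γ hK
  obtain ⟨c, hc, hdisc⟩ := exists_uniform_discrete (Γ := Γ) hK
  -- The first term puts the commutator below, of size `512 C₁² N⁴ B⁴ η`, inside the discreteness
  -- radius `c`; the summand 2 forces `η ≤ 1/2`.
  refine ⟨512 * C₁ ^ 2 * c⁻¹ + 2, by
    have : 0 ≤ 512 * C₁ ^ 2 * c⁻¹ := by positivity
    linarith, ?_⟩
  intro f₁ f₂ θ θ' N B η hN hB hθ0 hθN hθ0' hθN' hm he hη
  obtain ⟨κ₁, hκ₁, β₁, hβ₁, rfl⟩ := hKΓ f₁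
  obtain ⟨κ₂, hκ₂, β₂, hβ₂, rfl⟩ := hKΓ f₂
  set t := β₁ * θ * β₂⁻¹ with ht
  set t' := β₁ * θ' * β₂⁻¹ with ht'
  have hβ₂' := Γ.inv_mem hβ₂
  rw [← relIndex_conjBy_mul_mul θ hβ₁ hβ₂'] at hθ0 hθN
  rw [← relIndex_conjBy_mul_mul θ' hβ₁ hβ₂'] at hθ0' hθN'
  set m : G := κ₁ * t * κ₂⁻¹ with hmdef
  set m' : G := κ₁ * t' * κ₂⁻¹ with hmdef'
  have em : κ₁ * β₁ * θ * (κ₂ * β₂)⁻¹ = m := by simp [hmdef, ht, mul_assoc]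
  have em' : κ₁ * β₁ * θ' * (κ₂ * β₂)⁻¹ = m' := by simp [hmdef', ht', mul_assoc]
  rw [em] at hm
  rw [em, em'] at he
  set e := m⁻¹ * m' with hedef
  have hη0 : 0 ≤ η := he.nonneg
  have hNB : 1 ≤ N ^ 4 * B ^ 4 := one_le_mul_of_one_le_of_one_le (one_le_pow₀ hN) (one_le_pow₀ hB)
  have hX : 0 ≤ 512 * C₁ ^ 2 * c⁻¹ := by positivity
  have hηle : η ≤ 1 / 2 := by
    have h1 : (512 * C₁ ^ 2 * c⁻¹ + 2) * N ^ 4 * B ^ 4 * η =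
      512 * C₁ ^ 2 * c⁻¹ * ((N ^ 4 * B ^ 4) * η) + 2 * ((N ^ 4 * B ^ 4) * η) := by ring
    rw [h1] at hη
    have h2 : η ≤ (N ^ 4 * B ^ 4) * η := le_mul_of_one_le_left hη0 hNB
    have h3 : 0 ≤ 512 * C₁ ^ 2 * c⁻¹ * ((N ^ 4 * B ^ 4) * η) :=
      mul_nonneg hX (hη0.trans h2)
    linarith
  have hηc : 512 * C₁ ^ 2 * (N ^ 4 * B ^ 4) * η < c := by
    have h1 : 512 * C₁ ^ 2 * c⁻¹ * (N ^ 4 * B ^ 4) * η < 1 := by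
      have : 0 ≤ 2 * (N ^ 4 * B ^ 4) * η := by positivity
      linarith
    have h2 : 512 * C₁ ^ 2 * c⁻¹ * (N ^ 4 * B ^ 4) * η * c < 1 * c :=
      mul_lt_mul_of_pos_right h1 hc
    have h3 : 512 * C₁ ^ 2 * c⁻¹ * (N ^ 4 * B ^ 4) * η * c =
      512 * C₁ ^ 2 * (N ^ 4 * B ^ 4) * η := by field_simp
    linarith
  -- Elements of `Δ` are carried into `Γ` by both `t⁻¹` and `t'⁻¹`, and its index in `Γ` is at most
  -- `N²`.
  set Δ : Subgroup G := conjBy t Γ ⊓ conjBy t' Γ ⊓ Γ with hΔ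
  have hΔ0 : Δ.relIndex Γ ≠ 0 := by
    rw [hΔ, Subgroup.inf_relIndex_right]
    exact Subgroup.relIndex_inf_ne_zero hθ0 hθ0'
  have hΔN : (Δ.relIndex Γ : ℝ) ≤ N ^ 2 := by
    rw [hΔ, Subgroup.inf_relIndex_right]
    calc (((conjBy t Γ ⊓ conjBy t' Γ).relIndex Γ : ℕ) : ℝ)
        ≤ ((conjBy t Γ).relIndex Γ * (conjBy t' Γ).relIndex Γ : ℕ) := by
          exact_mod_cast Subgroup.relIndex_inf_le
      _ ≤ N ^ 2 := by
          push_cast; rw [sq]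
          exact mul_le_mul hθN hθN' (Nat.cast_nonneg _) (by linarith)
  obtain ⟨a, ha, b, hb, hab, hBa, hBb⟩ := hshort κ₁ hκ₁ Δ inf_le_right hΔ0
  -- The conjugates `t⁻¹xt` and `t'⁻¹xt'` both lie in `Γ`. After conjugation by `κ₂` they become `w`
  -- and `e⁻¹we`, which are too close to differ, so `e` commutes with `w`.
  have key : ∀ x ∈ Δ, Bd (κ₁ * x * κ₁⁻¹ : G) (C₁ * Δ.relIndex Γ) →
      e * (κ₂ * (t⁻¹ * x * t) * κ₂⁻¹) = κ₂ * (t⁻¹ * x * t) * κ₂⁻¹ * e := by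
    intro x hx hBx
    obtain ⟨⟨hx1, hx2⟩, hx3⟩ := hx
    have hx1' := mem_conjBy.1 hx1
    have hx2' := mem_conjBy.1 hx2
    set w := κ₂ * (t⁻¹ * x * t) * κ₂⁻¹ with hw
    have hw1 : w = m⁻¹ * (κ₁ * x * κ₁⁻¹) * m := by simp [hw, hmdef, mul_assoc]
    have hw2 : κ₂ * (t'⁻¹ * x * t') * κ₂⁻¹ = e⁻¹ * w * e := by
      rw [hw1, hedef]; simp [hmdef', mul_assoc]
    have hBw : Bd w (4 * C₁ * N ^ 2 * B ^ 2) := by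
      have h1 := (hm.inv.mul (hBx.mono (mul_le_mul_of_nonneg_left hΔN
        (by linarith : 0 ≤ C₁)))).mul hm
      rw [hw1, Matrix.SpecialLinearGroup.coe_mul, Matrix.SpecialLinearGroup.coe_mul]
      exact h1.mono (by ring_nf; rfl)
    have hcm : Bd (((w⁻¹ * (e⁻¹ * w * e) : G) : Matrix (Fin 2) (Fin 2) ℝ) - 1)
        (512 * C₁ ^ 2 * (N ^ 4 * B ^ 4) * η) := by
      have e1 : (((w⁻¹ * (e⁻¹ * w * e) : G) : Matrix (Fin 2) (Fin 2) ℝ) - 1) =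
          ((w⁻¹ : G) : Matrix (Fin 2) (Fin 2) ℝ) * (((e⁻¹ : G) : Matrix (Fin 2) (Fin 2) ℝ) *
            ((w : Matrix (Fin 2) (Fin 2) ℝ) * ((e : Matrix (Fin 2) (Fin 2) ℝ) - 1) -
            ((e : Matrix (Fin 2) (Fin 2) ℝ) - 1) * (w : Matrix (Fin 2) (Fin 2) ℝ))) := by
        have e2 : (w : Matrix (Fin 2) (Fin 2) ℝ) * ((e : Matrix (Fin 2) (Fin 2) ℝ) - 1) -
            ((e : Matrix (Fin 2) (Fin 2) ℝ) - 1) * (w : Matrix (Fin 2) (Fin 2) ℝ) =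
            ((w * e : G) : Matrix (Fin 2) (Fin 2) ℝ) - ((e * w : G) : Matrix (Fin 2) (Fin 2) ℝ) := by
          simp only [Matrix.SpecialLinearGroup.coe_mul]; noncomm_ring
        rw [e2, mul_sub, mul_sub, ← Matrix.SpecialLinearGroup.coe_mul,
          ← Matrix.SpecialLinearGroup.coe_mul, ← Matrix.SpecialLinearGroup.coe_mul,
          ← Matrix.SpecialLinearGroup.coe_mul]
        simp only [mul_assoc, inv_mul_cancel_left, inv_mul_cancel,
          Matrix.SpecialLinearGroup.coe_one]
      rw [e1]
      have he' : Bd ((e⁻¹ : G) : Matrix (Fin 2) (Fin 2) ℝ) 2 :=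
        (he.of_sub_one.mono (by linarith)).inv
      have h1 := hBw.inv.mul (he'.mul ((hBw.mul he).sub (he.mul hBw)))
      exact h1.mono (by ring_nf; rfl)
    have e3 : w⁻¹ * (e⁻¹ * w * e) = κ₂ * ((t⁻¹ * x * t)⁻¹ * (t'⁻¹ * x * t')) * κ₂⁻¹ := by
      rw [← hw2, hw]; simp [mul_assoc]
    have h4 := hdisc κ₂ hκ₂ _ (Γ.mul_mem (Γ.inv_mem hx1') hx2') (by
      rw [← e3]; exact fun i j => (hcm i j).trans_lt hηc)
    rw [h4, mul_one, mul_inv_cancel] at e3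
    have h5 : w = e⁻¹ * w * e := inv_mul_eq_one.1 e3
    calc e * w = e * (e⁻¹ * w * e) := by rw [← h5]
      _ = w * e := by simp [mul_assoc]
  have hne : (κ₂ * (t⁻¹ * a * t) * κ₂⁻¹) * (κ₂ * (t⁻¹ * b * t) * κ₂⁻¹) ≠
      (κ₂ * (t⁻¹ * b * t) * κ₂⁻¹) * (κ₂ * (t⁻¹ * a * t) * κ₂⁻¹) := by
    intro h1
    apply hab
    have e1 : ∀ x y : G, (κ₂ * (t⁻¹ * x * t) * κ₂⁻¹) * (κ₂ * (t⁻¹ * y * t) * κ₂⁻¹) =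
      (κ₂ * t⁻¹) * (x * y) * (κ₂ * t⁻¹)⁻¹ := fun x y => by simp [mul_assoc]
    rw [e1, e1] at h1
    exact mul_left_cancel (mul_right_cancel h1)
  have he1 := eq_one_of_commute (key a ha hBa) (key b hb hBb) hne (he.mono hηle)
  have h1 : m = m' := inv_mul_eq_one.1 he1
  have h2 : t = t' := mul_left_cancel (mul_right_cancel h1)
  exact mul_left_cancel (mul_right_cancel h2)

/-! ### The commensurating element attached to a point near a short orbit -/

theorem a_inv (t : ℝ) : (a t)⁻¹ = a (-t) := by
  rw [inv_eq_iff_mul_eq_one]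
  have h1 : Real.exp (t / 2) * Real.exp (-t / 2) = 1 := by
    rw [← Real.exp_add, ← Real.exp_zero]; ring_nf
  apply ext_entries <;> simp [coe_mul_eq, coe_a, -Matrix.SpecialLinearGroup.coe_mul]
  · exact h1
  · rw [mul_comm]; exact h1

/-- Lifts of two points of `X` that are close differ by an element near `1`. -/
theorem exists_nearOne_of_distX_lt {Γ : Subgroup G} {x y : G ⧸ Γ} {ε : ℝ} (hε : 0 < ε)
    (hε' : ε ≤ 1 / 4) (hd : distX Γ x y < ENNReal.ofReal ε) :
    ∃ e : G, Bd ((e : Matrix (Fin 2) (Fin 2) ℝ) - 1) (2 * ε) ∧ e • x = y := by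
  simp only [distX, iInf_lt_iff] at hd
  obtain ⟨g, g', rfl, rfl, hlt⟩ := hd
  refine ⟨g' * g⁻¹, fun i j => abs_entry_sub_le_of_distG_lt hε hε' hlt i j, ?_⟩
  change ((g' * g⁻¹ * g : G) : G ⧸ Γ) = g'
  rw [inv_mul_cancel_right]

/-- A nearby point of the translated orbit has the form `(g₁η, g₂η)P₀`. Pulling `f₁`, `f₂` back
through it gives lifts `k₁`, `k₂` of `P₀`, and in `θ = k₁⁻¹k₂` the unknown `η` cancels. -/
theorem exists_commensurating [MeasurableSpace G] (μ : Measure G)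
    {Γ : Subgroup G} {C : ℝ} (hC : ∀ (k₁ k₂ : G) (V : ℝ), 0 ≤ V →
      orbitVol μ Γ ((k₁ : G ⧸ Γ), (k₂ : G ⧸ Γ)) ≤ ENNReal.ofReal V →
        (conjBy (k₁⁻¹ * k₂) Γ).relIndex Γ ≠ 0 ∧
          ((conjBy (k₁⁻¹ * k₂) Γ).relIndex Γ : ℝ) ≤ C * (V + 1))
    {P₀ : (G ⧸ Γ) × (G ⧸ Γ)} {V : ℝ} (hV : 0 ≤ V) (hvol : orbitVol μ Γ P₀ ≤ ENNReal.ofReal V)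
    {g₁ g₂ f₁ f₂ : G} {E : ℝ} (hE : 0 < E) (hE' : E ≤ 1 / 8)
    (hd : distToSet Γ ((f₁ : G ⧸ Γ), (f₂ : G ⧸ Γ))
      ((fun Q : (G ⧸ Γ) × (G ⧸ Γ) => (g₁ • Q.1, g₂ • Q.2)) '' diagOrbit Γ P₀) ≤
        ENNReal.ofReal E) :
    ∃ θ e₁ e₂ : G, (conjBy θ Γ).relIndex Γ ≠ 0 ∧ ((conjBy θ Γ).relIndex Γ : ℝ) ≤ C * (V + 1) ∧
      Bd ((e₁ : Matrix (Fin 2) (Fin 2) ℝ) - 1) (4 * E) ∧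
      Bd ((e₂ : Matrix (Fin 2) (Fin 2) ℝ) - 1) (4 * E) ∧
      f₁ * θ * f₂⁻¹ = e₁⁻¹ * (g₁ * g₂⁻¹) * e₂ := by
  have hlt := hd.trans_lt ((ENNReal.ofReal_lt_ofReal_iff (by linarith : 0 < 2 * E)).2
    (by linarith))
  simp only [distToSet, iInf_lt_iff] at hlt
  obtain ⟨Q, ⟨Q', ⟨η, rfl⟩, rfl⟩, hQ⟩ := hlt
  obtain ⟨hQ1, hQ2⟩ := max_lt_iff.1 hQ
  obtain ⟨e₁, he₁, h1⟩ := exists_nearOne_of_distX_lt (by linarith) (by linarith) hQ1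
  obtain ⟨e₂, he₂, h2⟩ := exists_nearOne_of_distX_lt (by linarith) (by linarith) hQ2
  have hl1 : ((η⁻¹ * g₁⁻¹ * e₁ * f₁ : G) : G ⧸ Γ) = P₀.1 := by
    have : ((η⁻¹ * g₁⁻¹ * e₁ * f₁ : G) : G ⧸ Γ) = η⁻¹ • g₁⁻¹ • e₁ • (f₁ : G ⧸ Γ) := by
      rw [mul_assoc, mul_assoc]; rfl
    rw [this, h1, inv_smul_smul, inv_smul_smul]
  have hl2 : ((η⁻¹ * g₂⁻¹ * e₂ * f₂ : G) : G ⧸ Γ) = P₀.2 := by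
    have : ((η⁻¹ * g₂⁻¹ * e₂ * f₂ : G) : G ⧸ Γ) = η⁻¹ • g₂⁻¹ • e₂ • (f₂ : G ⧸ Γ) := by
      rw [mul_assoc, mul_assoc]; rfl
    rw [this, h2, inv_smul_smul, inv_smul_smul]
  obtain ⟨h3, h4⟩ := hC (η⁻¹ * g₁⁻¹ * e₁ * f₁) (η⁻¹ * g₂⁻¹ * e₂ * f₂) V hV (by
    rw [hl1, hl2]; exact hvol)
  refine ⟨_, e₁, e₂, h3, h4, he₁.mono (by linarith), he₂.mono (by linarith), ?_⟩
  simp [mul_assoc]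

/-- Steps of length at most `E` lead from any `s` to 0; no continuity of `f` is involved, so it may
come from arbitrary choices. -/
theorem eq_of_forall_close {α : Type*} (f : ℝ → α) {L E : ℝ} (hE : 0 < E)
    (hf : ∀ s ∈ Set.Icc 0 L, ∀ s' ∈ Set.Icc 0 L, |s - s'| ≤ E → f s = f s') :
    ∀ s ∈ Set.Icc 0 L, f s = f 0 := by
  have key : ∀ n : ℕ, ∀ s ∈ Set.Icc 0 L, s ≤ n * E → f s = f 0 := by
    intro n
    induction n with
    | zero =>
      intro s hs hsn
      have : s = 0 := le_antisymm (by simpa using hsn) hs.1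
      rw [this]
    | succ n ih =>
      intro s hs hsn
      push_cast at hsn
      by_cases h : s ≤ E
      · exact hf s hs 0 ⟨le_rfl, hs.1.trans hs.2⟩ (by rw [sub_zero, abs_of_nonneg hs.1]; exact h)
      · have h1 : s - E ∈ Set.Icc 0 L := ⟨by linarith, by linarith [hs.2]⟩
        rw [hf s hs (s - E) h1 (by rw [sub_sub_cancel, abs_of_pos hE]),
          ih _ h1 (by linarith)]
  intro s hs
  obtain ⟨n, hn⟩ := exists_nat_gt (s / E)
  exact key n s hs ((div_lt_iff₀ hE).1 hn).le

theorem bd_h_sub_one {t x : ℝ} (ht : |t| ≤ x) : Bd ((h t : Matrix (Fin 2) (Fin 2) ℝ) - 1) x := by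
  have := (abs_nonneg t).trans ht
  intro i j
  rw [coe_h]
  fin_cases i <;> fin_cases j <;> simp [Matrix.sub_apply] <;> assumption

/-- If a matrix stays bounded under conjugation by a long piece of the horocycle, it is close to
an upper triangular unipotent one up to sign. -/
theorem entries_of_bd_conj {Z : G} {B L : ℝ} (hL : 0 < L)
    (hZ : ∀ s ∈ Set.Icc 0 L, Bd (h s * Z * (h s)⁻¹ : G) B) :
    |Z 1 0| ≤ 8 * B / L ^ 2 ∧ |Z 1 1 - Z 0 0| ≤ 8 * B / L := by
  have hv : ∀ s ∈ Set.Icc 0 L, |Z 0 1 + s * (Z 1 1 - Z 0 0) - s ^ 2 * Z 1 0| ≤ B := by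
    intro s hs
    have h1 := hZ s hs 0 1
    rw [h_inv, coe_mul_eq, coe_mul_eq, coe_h, coe_h] at h1
    simp at h1
    convert h1 using 2
    ring
  -- The upper right entry of the conjugate is a quadratic polynomial in `s`; its values at `0`,
  -- `L/2` and `L` determine, hence bound, the coefficients.
  have v0 := abs_le.1 (hv 0 ⟨le_rfl, hL.le⟩)
  have v1 := abs_le.1 (hv (L / 2) ⟨by linarith, by linarith⟩)
  have v2 := abs_le.1 (hv L ⟨hL.le, le_rfl⟩)
  constructor
  · rw [le_div_iff₀ (by positivity), ← abs_of_pos (by positivity : 0 < L ^ 2), ← abs_mul, abs_le]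
    constructor <;> nlinarith
  · have e : |Z 1 1 - Z 0 0| * L = |(Z 1 1 - Z 0 0) * L| := by rw [abs_mul, abs_of_pos hL]
    rw [le_div_iff₀ hL, e, abs_le]
    constructor <;> nlinarith

/-- The lower left entry and the difference of the diagonal entries of `Z` are small, so with `det Z
= 1` both diagonal entries are near a common sign `±1`. Squaring the trace removes that sign. -/
theorem trace_sq_sub_le {Z : G} {B L l : ℝ} (hL : 1 ≤ L) (hB : 1 ≤ B) (hl : 0 < l)
    (hZ : ∀ s ∈ Set.Icc 0 L, Bd (h s * Z * (h s)⁻¹ : G) B) :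
    |(l * Z 0 0 + l⁻¹ * Z 1 1) ^ 2 - (l + l⁻¹) ^ 2| ≤ (l + l⁻¹) ^ 2 * (16 * B ^ 2 / L) := by
  have hL0 : 0 < L := by linarith
  obtain ⟨h1, h2⟩ := entries_of_bd_conj hL0 hZ
  have hZ0 := hZ 0 ⟨le_rfl, hL0.le⟩
  rw [h_zero, one_mul, inv_one, mul_one] at hZ0
  have hdet := det_entries Z
  have hl1 : l * l⁻¹ = 1 := mul_inv_cancel₀ hl.ne'
  set m := l⁻¹ with hm
  have hm0 : 0 < m := inv_pos.2 hl
  have hbc : |Z 0 1 * Z 1 0| ≤ 8 * B ^ 2 / L := by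
    rw [abs_mul]
    calc |Z 0 1| * |Z 1 0| ≤ B * (8 * B / L ^ 2) :=
          mul_le_mul (hZ0 0 1) h1 (abs_nonneg _) (by linarith)
      _ = 8 * B ^ 2 / L ^ 2 := by ring
      _ ≤ 8 * B ^ 2 / L := by
          apply div_le_div_of_nonneg_left (by positivity) hL0
          nlinarith
  have had : ∀ x : ℝ, |x| ≤ B → |x * (Z 1 1 - Z 0 0)| ≤ 8 * B ^ 2 / L := by
    intro x hx
    rw [abs_mul]
    calc |x| * |Z 1 1 - Z 0 0| ≤ B * (8 * B / L) :=
          mul_le_mul hx h2 (abs_nonneg _) (by linarith)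
      _ = 8 * B ^ 2 / L := by ring
  have e : (l * Z 0 0 + m * Z 1 1) ^ 2 - (l + m) ^ 2 =
      l ^ 2 * (Z 0 1 * Z 1 0 - Z 0 0 * (Z 1 1 - Z 0 0)) +
      m ^ 2 * (Z 0 1 * Z 1 0 + Z 1 1 * (Z 1 1 - Z 0 0)) + 2 * (l * m) * (Z 0 1 * Z 1 0) := by
    linear_combination (l + m) ^ 2 * hdet
  set D := 8 * B ^ 2 / L with hD
  have hD0 : 0 ≤ D := by positivity
  have t1 := abs_le.1 hbc
  have t2 := abs_le.1 (had _ (hZ0 0 0))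
  have t3 := abs_le.1 (had _ (hZ0 1 1))
  have e2 : 16 * B ^ 2 / L = 2 * D := by rw [hD]; ring
  rw [e, e2, abs_le]
  have hlm : 0 < l * m := mul_pos hl hm0
  have l2 : 0 < l ^ 2 := by positivity
  have m2 : 0 < m ^ 2 := by positivity
  constructor <;> nlinarith

/-- The element `θ` that commensurates `Γ` with small index and has trace close to that of
`a_{log p - log q}`. -/
theorem exists_commensurating_trace [MeasurableSpace G] [BorelSpace G] (μ : Measure G)
    [μ.IsHaarMeasure] (Γ : Subgroup G) [DiscreteTopology Γ] [Countable Γ]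
    [CompactSpace (G ⧸ Γ)] :
    ∃ C : ℝ, 1 ≤ C ∧ ∀ (x : G ⧸ Γ) (p q : ℕ) (P₀ : (G ⧸ Γ) × (G ⧸ Γ)) (g₁ g₂ : G) (ρ L E : ℝ),
      0 < p → 0 < q → 1 ≤ ρ → 1 ≤ L → 0 < E → C * ρ ^ 16 * E < 1 →
      Bd g₁ ρ → Bd g₂ ρ → orbitVol μ Γ P₀ ≤ ENNReal.ofReal ρ →
      (∀ s ∈ Set.Icc 0 L, distToSet Γ (h s • a (-Real.log p) • x, h s • a (-Real.log q) • x)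
        ((fun Q : (G ⧸ Γ) × (G ⧸ Γ) => (g₁ • Q.1, g₂ • Q.2)) '' diagOrbit Γ P₀) ≤
          ENNReal.ofReal E) →
      ∃ θ : G, (conjBy θ Γ).relIndex Γ ≠ 0 ∧ ((conjBy θ Γ).relIndex Γ : ℝ) ≤ C * ρ ∧
        |p * q * (θ : Matrix (Fin 2) (Fin 2) ℝ).trace ^ 2 - (p + q) ^ 2| ≤
          (p + q) ^ 2 * (C * ρ ^ 4 / L) := by
  obtain ⟨C₁, hC₁, hidx⟩ := exists_relIndex_le μ Γ
  obtain ⟨C₂, hC₂, hsep⟩ := exists_separation μ Γ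
  set c := 2 * C₁ + 1 with hc
  have hc1 : 1 ≤ c := by linarith
  -- The first summand makes the separation lemma apply with `N = cρ`, `B = 32ρ²`, `η = 33280ρ⁴E`,
  -- whence the power `ρ^16`. The others cover the index bound, the smallness of `E` and the trace
  -- estimate.
  refine ⟨C₂ * c ^ 4 * 32 ^ 4 * 33280 + c + 33280,
    by nlinarith [show 0 ≤ C₂ * c ^ 4 * 32 ^ 4 * 33280 by positivity], ?_⟩
  intro x p q P₀ g₁ g₂ ρ L E hp hq hρ hL hE hsmall hg₁ hg₂ hvol hdist
  obtain ⟨g₀, rfl⟩ := QuotientGroup.mk_surjective x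
  have hρk : ∀ k : ℕ, 1 ≤ ρ ^ k := fun k => one_le_pow₀ hρ
  have hX : 0 ≤ C₂ * c ^ 4 * 32 ^ 4 * 33280 := by positivity
  have hE1 : 33280 * ρ ^ 16 * E < 1 := by
    have : 0 ≤ (C₂ * c ^ 4 * 32 ^ 4 * 33280 + c) * (ρ ^ 16 * E) := by positivity
    linarith
  have hE2 : C₂ * c ^ 4 * 32 ^ 4 * 33280 * ρ ^ 16 * E < 1 := by
    have : 0 ≤ (c + 33280) * (ρ ^ 16 * E) := by positivity
    linarith
  have hE4 : 33280 * ρ ^ 4 * E < 1 := by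
    have : ρ ^ 4 ≤ ρ ^ 16 := pow_le_pow_right₀ hρ (by norm_num)
    nlinarith
  have hE3 : 33280 * E < 1 := by nlinarith [hρk 4]
  set F₁ : ℝ → G := fun s => h s * (a (-Real.log p) * g₀) with hF₁
  set F₂ : ℝ → G := fun s => h s * (a (-Real.log q) * g₀) with hF₂
  set g := g₁ * g₂⁻¹ with hg
  have hgB : Bd g (2 * ρ ^ 2) := by
    rw [hg, Matrix.SpecialLinearGroup.coe_mul]
    exact (hg₁.mul hg₂.inv).mono (by ring_nf; rfl)
  have hex : ∀ s, ∃ θ e₁ e₂ : G, s ∈ Set.Icc 0 L → (conjBy θ Γ).relIndex Γ ≠ 0 ∧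
      ((conjBy θ Γ).relIndex Γ : ℝ) ≤ c * ρ ∧
      Bd ((e₁ : Matrix (Fin 2) (Fin 2) ℝ) - 1) (4 * E) ∧
      Bd ((e₂ : Matrix (Fin 2) (Fin 2) ℝ) - 1) (4 * E) ∧
      F₁ s * θ * (F₂ s)⁻¹ = e₁⁻¹ * g * e₂ := by
    intro s
    by_cases hs : s ∈ Set.Icc 0 L
    · obtain ⟨θ, e₁, e₂, h1, h2, h3⟩ := exists_commensurating μ hidx (zero_le_one.trans hρ) hvol hE
        (by linarith) (f₁ := F₁ s) (f₂ := F₂ s) (hdist s hs)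
      exact ⟨θ, e₁, e₂, fun _ => ⟨h1, h2.trans (by nlinarith), h3⟩⟩
    · exact ⟨1, 1, 1, fun h => absurd h hs⟩
  choose θ e₁ e₂ hθ using hex
  have hbd : ∀ s ∈ Set.Icc 0 L, Bd (F₁ s * θ s * (F₂ s)⁻¹ : G) (32 * ρ ^ 2) := by
    intro s hs
    obtain ⟨-, -, h1, h2, h3⟩ := hθ s hs
    rw [h3, Matrix.SpecialLinearGroup.coe_mul, Matrix.SpecialLinearGroup.coe_mul]
    have h1' : Bd (e₁ s) 2 := h1.of_sub_one.mono (by linarith)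
    have h2' : Bd (e₂ s) 2 := h2.of_sub_one.mono (by linarith)
    exact ((h1'.inv.mul hgB).mul h2').mono (by ring_nf; rfl)
  have hFs : ∀ s s' : ℝ, ∀ t : G, F₁ s * t * (F₂ s)⁻¹ =
      h (s - s') * (F₁ s' * t * (F₂ s')⁻¹) * h (-(s - s')) := by
    intro s s' t
    have e1 : h s = h (s - s') * h s' := by rw [h_mul_h]; ring_nf
    simp only [hF₁, hF₂, e1, mul_inv_rev, ← h_inv (s - s'), mul_assoc]
  have hconst := eq_of_forall_close θ (L := L) hE (by
    intro s hs s' hs' hss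
    obtain ⟨h1, h2, h3, h4, h5⟩ := hθ s hs
    obtain ⟨k1, k2, k3, k4, k5⟩ := hθ s' hs'
    refine hsep (F₁ s) (F₂ s) (θ s) (θ s') (c * ρ) (32 * ρ ^ 2) (33280 * ρ ^ 4 * E)
      (one_le_mul_of_one_le_of_one_le hc1 hρ) (by nlinarith [hρk 2]) h1 h2 k1 k2 (hbd s hs) ?_ ?_
    · have hτ : |s - s'| ≤ 4 * E := by linarith
      -- Both products are `g` up to errors near 1, since `g = g₁g₂⁻¹` is the same for `s` and `s'`;
      -- the passage from `s'` to `s` costs only `h` of a time at most `E`. Conjugation by `g` loses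
      -- the factor `ρ⁴`.
      have e1 : (F₁ s * θ s * (F₂ s)⁻¹)⁻¹ * (F₁ s * θ s' * (F₂ s)⁻¹) =
          (e₂ s)⁻¹ * (g⁻¹ * (e₁ s * h (s - s') * (e₁ s')⁻¹) * g) * (e₂ s' * h (-(s - s'))) := by
        rw [h5, hFs s s', k5]; simp [mul_assoc]
      rw [e1]
      set X := 4 * E with hX
      have hX1 : X ≤ 1 := by linarith
      have hX0 : 0 < X := by linarith
      have hXX : X * X ≤ X := mul_le_of_le_one_left hX0.le hX1
      have hXXX : X * X * X ≤ X := (mul_le_of_le_one_right (by positivity) hX1).trans hXX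
      have hτ' : |-(s - s')| ≤ X := by rwa [abs_neg]
      have u1 : Bd (((e₁ s * h (s - s') * (e₁ s')⁻¹ : G) : Matrix (Fin 2) (Fin 2) ℝ) - 1)
          (13 * X) := by
        rw [Matrix.SpecialLinearGroup.coe_mul, Matrix.SpecialLinearGroup.coe_mul]
        exact ((h3.mul_sub_one (bd_h_sub_one hτ)).mul_sub_one k3.inv_sub_one).mono (by linarith)
      have u2 : Bd (((g⁻¹ * (e₁ s * h (s - s') * (e₁ s')⁻¹) * g : G) :
          Matrix (Fin 2) (Fin 2) ℝ) - 1) (208 * ρ ^ 4 * X) := by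
        generalize e₁ s * h (s - s') * (e₁ s')⁻¹ = u at u1
        have e2 : ((g⁻¹ * u * g : G) : Matrix (Fin 2) (Fin 2) ℝ) - 1 =
            ((g⁻¹ : G) : Matrix (Fin 2) (Fin 2) ℝ) * ((u : Matrix (Fin 2) (Fin 2) ℝ) - 1) * g := by
          rw [mul_sub, mul_one, sub_mul, ← Matrix.SpecialLinearGroup.coe_mul,
            ← Matrix.SpecialLinearGroup.coe_mul, ← Matrix.SpecialLinearGroup.coe_mul,
            inv_mul_cancel, Matrix.SpecialLinearGroup.coe_one]
        rw [e2]
        exact ((hgB.inv.mul u1).mul hgB).mono (by ring_nf; rfl)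
      set Y := 208 * ρ ^ 4 * X with hY
      have hXY : X ≤ Y := by nlinarith [hρk 4]
      have hY1 : 40 * Y = 33280 * ρ ^ 4 * E := by rw [hY, hX]; ring
      have hYle : Y ≤ 1 / 40 := by linarith
      have u3 : Bd (((e₂ s' * h (-(s - s')) : G) : Matrix (Fin 2) (Fin 2) ℝ) - 1) (4 * X) := by
        rw [Matrix.SpecialLinearGroup.coe_mul]
        exact (k4.mul_sub_one (bd_h_sub_one hτ')).mono (by linarith)
      rw [← hY1, Matrix.SpecialLinearGroup.coe_mul, Matrix.SpecialLinearGroup.coe_mul]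
      refine ((h4.inv_sub_one.mul_sub_one u2).mul_sub_one u3).mono ?_
      have hXY1 : X * Y ≤ Y := mul_le_of_le_one_left (by linarith) hX1
      have hXY2 : X * Y * X ≤ Y := (mul_le_of_le_one_right (by positivity) hX1).trans hXY1
      linarith
    · calc C₂ * (c * ρ) ^ 4 * (32 * ρ ^ 2) ^ 4 * (33280 * ρ ^ 4 * E)
          = C₂ * c ^ 4 * 32 ^ 4 * 33280 * ρ ^ 16 * E := by ring
        _ < 1 := hE2)
  have h0 : (0 : ℝ) ∈ Set.Icc 0 L := ⟨le_rfl, by linarith⟩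
  obtain ⟨h1, h2, -⟩ := hθ 0 h0
  refine ⟨θ 0, h1, h2.trans (mul_le_mul_of_nonneg_right (by linarith) (by linarith)), ?_⟩
  set Z := F₁ 0 * θ 0 * (F₂ 0)⁻¹ with hZ
  have hZB : ∀ s ∈ Set.Icc 0 L, Bd (h s * Z * (h s)⁻¹ : G) (32 * ρ ^ 2) := by
    intro s hs
    have h3 := hbd s hs
    rw [hconst s hs, hFs s 0, sub_zero, ← h_inv] at h3
    exact h3
  have hp' : (0 : ℝ) < p := by exact_mod_cast hp
  have hq' : (0 : ℝ) < q := by exact_mod_cast hq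
  -- `l = √(p/q)`: up to conjugation by `g₀`, the element `θ` is `a_{log p} Z a_{-log q}`, so its
  -- trace is `l Z₀₀ + l⁻¹ Z₁₁`.
  set l := Real.exp (Real.log p / 2) * Real.exp (-Real.log q / 2) with hl
  have hl0 : 0 < l := by positivity
  have hlinv : l⁻¹ = Real.exp (-Real.log p / 2) * Real.exp (Real.log q / 2) := by
    rw [hl, mul_inv, ← Real.exp_neg, ← Real.exp_neg]; ring_nf
  have hl2 : l ^ 2 = p / q := by
    rw [hl, mul_pow, ← Real.exp_nat_mul, ← Real.exp_nat_mul]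
    have e1 : ((2 : ℕ) : ℝ) * (Real.log p / 2) = Real.log p := by push_cast; ring
    have e2 : ((2 : ℕ) : ℝ) * (-Real.log q / 2) = -Real.log q := by push_cast; ring
    rw [e1, e2, Real.exp_neg, Real.exp_log hp', Real.exp_log hq', div_eq_mul_inv]
  have htr : (θ 0 : Matrix (Fin 2) (Fin 2) ℝ).trace = l * Z 0 0 + l⁻¹ * Z 1 1 := by
    have e1 : g₀ * θ 0 * g₀⁻¹ = a (Real.log p) * Z * a (-Real.log q) := by
      rw [hZ]; simp only [hF₁, hF₂, h_zero, one_mul, ← a_inv]; simp [mul_assoc]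
    have e2 : (g₀ * θ 0 * g₀⁻¹ : G).1.trace = (θ 0 : Matrix (Fin 2) (Fin 2) ℝ).trace := by
      rw [Matrix.SpecialLinearGroup.coe_mul, Matrix.trace_mul_comm,
        ← Matrix.SpecialLinearGroup.coe_mul, inv_mul_cancel_left]
    rw [← e2, e1, hlinv, hl]
    change Matrix.trace ((a (Real.log p) * Z * a (-Real.log q) : G) : Matrix (Fin 2) (Fin 2) ℝ) = _
    rw [Matrix.trace_fin_two, coe_mul_eq, coe_mul_eq, coe_a, coe_a]
    simp
    ring
  have hkey := trace_sq_sub_le hL (by nlinarith [hρk 2] : 1 ≤ 32 * ρ ^ 2) hl0 hZB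
  have hpq : p * q * (l + l⁻¹) ^ 2 = ((p : ℝ) + q) ^ 2 := by
    have e1 : (l + l⁻¹) ^ 2 = l ^ 2 + (l ^ 2)⁻¹ + 2 := by
      have : l * l⁻¹ = 1 := mul_inv_cancel₀ hl0.ne'
      rw [← inv_pow]; linear_combination 2 * this
    rw [e1, hl2]; field_simp; ring
  have hpq0 : (0 : ℝ) < p * q := by positivity
  rw [htr, ← hpq, ← mul_sub, abs_mul, abs_of_pos hpq0, mul_assoc ((p : ℝ) * q) ((l + l⁻¹) ^ 2)]
  refine mul_le_mul_of_nonneg_left (hkey.trans (mul_le_mul_of_nonneg_left ?_ (sq_nonneg _))) hpq0.le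
  apply div_le_div_of_nonneg_right _ (by linarith)
  have : 0 ≤ (C₂ * c ^ 4 * 32 ^ 4 * 33280 + c) * ρ ^ 4 := by positivity
  nlinarith [hρk 4]

/-! ### Unipotent elements of a cocompact lattice -/

theorem exists_conj_eq_h {g : G} (hg : (g : Matrix (Fin 2) (Fin 2) ℝ).trace = 2) :
    ∃ (k : G) (t : ℝ), k * g * k⁻¹ = h t := by
  rw [Matrix.trace_fin_two] at hg
  have hdet := det_entries g
  by_cases hz : g 1 0 = 0
  · refine ⟨1, g 0 1, ?_⟩
    rw [hz] at hdet
    have h0 : g 0 0 = 1 := by nlinarith [sq_nonneg (g 0 0 - 1)]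
    have h1 : g 1 1 = 1 := by linarith
    rw [one_mul, inv_one, mul_one]
    apply ext_entries <;> simp [coe_h, h0, h1, hz]
  · set z := g 1 0 with hzdef
    set x := g 0 0 - 1 with hx
    have hx11 : g 1 1 = 1 - x := by rw [hx]; linarith
    have hx00 : g 0 0 = 1 + x := by rw [hx]; ring
    have hyz : x ^ 2 + g 0 1 * z = 0 := by
      rw [hx00, hx11] at hdet; linear_combination -hdet
    let k : G := ⟨!![0, 1 / z; -z, x], by rw [Matrix.det_fin_two_of]; field_simp; ring⟩
    have hk : (k : Matrix (Fin 2) (Fin 2) ℝ) = !![0, 1 / z; -z, x] := rfl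
    refine ⟨k, -1 / z, ?_⟩
    apply ext_entries <;> simp [coe_mul_eq, coe_inv_eq, hk, coe_h, ← hzdef, hx11, hx00,
      -Matrix.SpecialLinearGroup.coe_mul, -Matrix.SpecialLinearGroup.coe_inv]
    · field_simp; ring
    · field_simp
    · linear_combination (-z) * hyz
    · field_simp; ring

/-- A cocompact lattice contains no unipotent element other than `1`. -/
theorem eq_one_of_trace_eq_two {Γ : Subgroup G} [DiscreteTopology Γ] [CompactSpace (G ⧸ Γ)]
    {γ : G} (hγ : γ ∈ Γ) (htr : (γ : Matrix (Fin 2) (Fin 2) ℝ).trace = 2) : γ = 1 := by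
  obtain ⟨K, hK, -, hKΓ⟩ := exists_isCompact_mul (Γ := Γ)
  obtain ⟨c, hc, hdisc⟩ := exists_uniform_discrete (Γ := Γ) hK
  obtain ⟨k, t, hkt⟩ := exists_conj_eq_h htr
  -- Conjugation by `a s` with `s` very negative contracts the unipotent below the uniform
  -- discreteness radius.
  obtain ⟨s, hs⟩ : ∃ s : ℝ, Real.exp s * |t| < c := by
    refine ⟨Real.log (c / (|t| + 1)), ?_⟩
    have h0 := abs_nonneg t
    rw [Real.exp_log (by positivity), div_mul_eq_mul_div, div_lt_iff₀ (by positivity)]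
    nlinarith
  obtain ⟨κ, hκ, β, hβ, hκβ⟩ := hKΓ (a s * k)
  have h1 : κ * (β * γ * β⁻¹) * κ⁻¹ = h (Real.exp s * t) := by
    have e1 : κ * (β * γ * β⁻¹) * κ⁻¹ = (κ * β) * γ * (κ * β)⁻¹ := by simp [mul_assoc]
    have e2 : a s * k * γ * (a s * k)⁻¹ = a s * (k * γ * k⁻¹) * (a s)⁻¹ := by simp [mul_assoc]
    rw [e1, ← hκβ, e2, hkt, a_mul_h, mul_inv_cancel_right]
  have h2 := hdisc κ hκ _ (Γ.mul_mem (Γ.mul_mem hβ hγ) (Γ.inv_mem hβ)) (by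
    rw [h1]
    intro i j
    refine lt_of_le_of_lt (bd_h_sub_one le_rfl i j) ?_
    rwa [abs_mul, abs_of_pos (Real.exp_pos s)])
  have h3 : β * γ = β * 1 := by rw [mul_one]; exact mul_inv_eq_one.1 h2
  exact mul_left_cancel h3

/-! ### Finite index subgroups -/

/-- Elements of this intersection lie in the unit group `Λ` and are conjugated by `θ⁻¹` into `Λ`
again; passing from `Γ` to `Γ ⊓ Λ` costs only a constant factor in the index. -/
theorem relIndex_inf_conjBy_le {Γ Λ : Subgroup G} {θ : G} (hΛ : Λ.relIndex Γ ≠ 0)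
    (hθ : (conjBy θ Γ).relIndex Γ ≠ 0) :
    ((Γ ⊓ Λ) ⊓ conjBy θ (Γ ⊓ Λ)).relIndex Γ ≠ 0 ∧
      ((Γ ⊓ Λ) ⊓ conjBy θ (Γ ⊓ Λ)).relIndex Γ ≤
        Λ.relIndex Γ ^ 2 * (conjBy θ Γ).relIndex Γ := by
  have e : (Γ ⊓ Λ).relIndex Γ = Λ.relIndex Γ := by rw [inf_comm, Subgroup.inf_relIndex_right]
  have hconj : conjBy θ (Γ ⊓ Λ) = conjBy θ Λ ⊓ conjBy θ Γ := by
    ext g; simp only [mem_conjBy, Subgroup.mem_inf, and_comm]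
  have h1 : (conjBy θ (Γ ⊓ Λ)).relIndex Γ =
      (conjBy θ Λ).relIndex (conjBy θ Γ ⊓ Γ) * (conjBy θ Γ).relIndex Γ := by
    rw [hconj, Subgroup.relIndex_inf_mul_relIndex]
  have h2 : (conjBy θ Λ).relIndex (conjBy θ Γ) ≠ 0 := by rwa [relIndex_conjBy_conjBy]
  have h3 : (conjBy θ Λ).relIndex (conjBy θ Γ ⊓ Γ) ≤ Λ.relIndex Γ := by
    rw [← relIndex_conjBy_conjBy θ Γ Λ]
    exact Subgroup.relIndex_le_of_le_right inf_le_left h2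
  have h4 : (conjBy θ Λ).relIndex (conjBy θ Γ ⊓ Γ) ≠ 0 := fun h =>
    h2 (Subgroup.relIndex_eq_zero_of_le_right inf_le_left h)
  refine ⟨Subgroup.relIndex_inf_ne_zero (e ▸ hΛ) (h1 ▸ mul_ne_zero h4 hθ), ?_⟩
  refine Subgroup.relIndex_inf_le.trans ?_
  rw [e, h1, sq, mul_assoc]
  gcongr

/-! ### Two by two matrices -/

theorem trace_coe_inv (g : G) : ((g⁻¹ : G) : Matrix (Fin 2) (Fin 2) ℝ).trace =
    (g : Matrix (Fin 2) (Fin 2) ℝ).trace := by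
  rw [Matrix.trace_fin_two, Matrix.trace_fin_two, coe_inv_eq]; simp [add_comm]

/-- For dual bases of `M₂` under the trace form, `∑ eᵢ m eᵢ* = tr(m)·1`. This is that formula for
`1, A, B, [A,B]`, with the inverse Gram matrix cleared by the factor `8(W² - PQ)`; the result is
polynomial and needs no independence. -/
theorem casimir_identity (A B m : Matrix (Fin 2) (Fin 2) ℝ) (hA : A.trace = 0) (hB : B.trace = 0)
    (P Q W : ℝ) (hP : 2 * P = (A * A).trace) (hQ : 2 * Q = (B * B).trace)
    (hW : 2 * W = (A * B).trace) :
    (4 * (W ^ 2 - P * Q)) • m + (A * B - B * A) * m * (A * B - B * A) - (4 * Q) • (A * m * A) +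
      (4 * W) • (A * m * B + B * m * A) - (4 * P) • (B * m * B) =
      (8 * (W ^ 2 - P * Q) * m.trace) • (1 : Matrix (Fin 2) (Fin 2) ℝ) := by
  rw [Matrix.trace_fin_two] at hA hB
  have hA' : A 1 1 = -A 0 0 := by linarith
  have hB' : B 1 1 = -B 0 0 := by linarith
  simp only [Matrix.trace_fin_two, Matrix.mul_apply, Fin.sum_univ_two, hA', hB'] at hP hQ hW
  have hP' : P = A 0 0 ^ 2 + A 0 1 * A 1 0 := by linarith
  have hQ' : Q = B 0 0 ^ 2 + B 0 1 * B 1 0 := by linarith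
  have hW' : W = A 0 0 * B 0 0 + (A 0 1 * B 1 0 + A 1 0 * B 0 1) / 2 := by linarith
  subst hP' hQ' hW'
  ext i j
  fin_cases i <;> fin_cases j <;>
    simp [Matrix.mul_apply, Fin.sum_univ_two, Matrix.trace_fin_two, hA', hB'] <;> ring

/-- The commutator part of the trace form discriminant. -/
theorem det_commutator (a b : Matrix (Fin 2) (Fin 2) ℝ) (P Q W : ℝ)
    (hP : 2 * P = ((a - a.adjugate) * (a - a.adjugate)).trace)
    (hQ : 2 * Q = ((b - b.adjugate) * (b - b.adjugate)).trace)
    (hW : 2 * W = ((a - a.adjugate) * (b - b.adjugate)).trace) :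
    W ^ 2 - P * Q = -4 * (a * b - b * a).det := by
  simp [Matrix.trace_fin_two, Matrix.mul_apply, Fin.sum_univ_two, Matrix.adjugate_fin_two,
    Matrix.det_fin_two] at hP hQ hW ⊢
  have hP' : P = (a 0 0 - a 1 1) ^ 2 + 4 * a 0 1 * a 1 0 := by linarith
  have hQ' : Q = (b 0 0 - b 1 1) ^ 2 + 4 * b 0 1 * b 1 0 := by linarith
  have hW' : W = (a 0 0 - a 1 1) * (b 0 0 - b 1 1) + 2 * (a 0 1 * b 1 0 + a 1 0 * b 0 1) := by
    linarith
  subst hP' hQ' hW'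
  ring

/-- The commutator minus 1 is `(ab - ba)a⁻¹b⁻¹`, and `det(g - 1) = 2 - tr g` when `det g = 1`. -/
theorem trace_commutator_eq_two {a b : G} (hab : ((a : Matrix (Fin 2) (Fin 2) ℝ) * b -
    (b : Matrix (Fin 2) (Fin 2) ℝ) * a).det = 0) :
    ((a * b * a⁻¹ * b⁻¹ : G) : Matrix (Fin 2) (Fin 2) ℝ).trace = 2 := by
  have h1 : (((a * b * a⁻¹ * b⁻¹ : G) : Matrix (Fin 2) (Fin 2) ℝ) - 1) =
      ((a : Matrix (Fin 2) (Fin 2) ℝ) * b - (b : Matrix (Fin 2) (Fin 2) ℝ) * a) *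
        ((a⁻¹ * b⁻¹ : G) : Matrix (Fin 2) (Fin 2) ℝ) := by
    rw [sub_mul, ← Matrix.SpecialLinearGroup.coe_mul, ← Matrix.SpecialLinearGroup.coe_mul,
      ← Matrix.SpecialLinearGroup.coe_mul, ← Matrix.SpecialLinearGroup.coe_mul]
    simp only [mul_assoc, mul_inv_cancel_left, mul_inv_cancel, Matrix.SpecialLinearGroup.coe_one]
  have h2 := congrArg Matrix.det h1
  rw [Matrix.det_mul, hab, zero_mul] at h2
  generalize a * b * a⁻¹ * b⁻¹ = g at h2
  have hdet := det_entries g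
  rw [Matrix.det_fin_two] at h2
  simp [Matrix.sub_apply] at h2
  rw [Matrix.trace_fin_two]
  linarith

theorem exists_eq_smul {v w : Fin 2 → ℝ} (hv : v ≠ 0) (h : v 0 * w 1 = v 1 * w 0) :
    ∃ c : ℝ, w = c • v := by
  by_cases h0 : v 0 = 0
  · have h1 : v 1 ≠ 0 := fun h1 => hv (by ext i; fin_cases i <;> simp [h0, h1])
    refine ⟨w 1 / v 1, ?_⟩
    have h2 : w 0 = 0 := by simpa [h0, h1] using h
    ext i; fin_cases i
    · simp [h0, h2]
    · simp [h1]
  · refine ⟨w 0 / v 0, ?_⟩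
    ext i; fin_cases i
    · simp [h0]
    · simp; field_simp; linarith

/-- If both `M a M*` and `M b M*` vanish, where `M*` is the adjugate of the non-zero singular
matrix `M`, then `a` and `b` have a common eigenvector. -/
theorem det_commutator_eq_zero_of_mul_adjugate {M a b : Matrix (Fin 2) (Fin 2) ℝ} (hM : M ≠ 0)
    (hdet : M.det = 0) (ha : M * a * M.adjugate = 0) (hb : M * b * M.adjugate = 0) :
    (a * b - b * a).det = 0 := by
  -- A non-zero column `v` of the adjugate spans the kernel of `M`; the hypotheses say that `av` and
  -- `bv` are in that kernel as well.
  obtain ⟨v, hv, hMv, hav, hbv⟩ : ∃ v : Fin 2 → ℝ, v ≠ 0 ∧ M.mulVec v = 0 ∧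
      M.mulVec (a.mulVec v) = 0 ∧ M.mulVec (b.mulVec v) = 0 := by
    have hadj : M.adjugate ≠ 0 := by
      intro h0
      apply hM
      have := congrArg Matrix.adjugate h0
      rw [Matrix.adjugate_fin_two, Matrix.adjugate_fin_two] at this
      ext i j
      have h00 := congrFun (congrFun this 0) 0
      have h01 := congrFun (congrFun this 0) 1
      have h10 := congrFun (congrFun this 1) 0
      have h11 := congrFun (congrFun this 1) 1
      simp at h00 h01 h10 h11
      fin_cases i <;> fin_cases j <;> simp <;> assumption
    obtain ⟨j, hj⟩ : ∃ j, (fun i => M.adjugate i j) ≠ 0 := by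
      by_contra hcon
      push Not at hcon
      exact hadj (by ext i j; exact congrFun (hcon j) i)
    have hcol : ∀ X : Matrix (Fin 2) (Fin 2) ℝ, X * M.adjugate = 0 →
        X.mulVec (fun i => M.adjugate i j) = 0 := by
      intro X hX
      ext i
      exact congrFun (congrFun hX i) j
    refine ⟨_, hj, hcol M ?_, ?_, ?_⟩
    · rw [Matrix.mul_adjugate, hdet, zero_smul]
    · rw [Matrix.mulVec_mulVec]; exact hcol _ ha
    · rw [Matrix.mulVec_mulVec]; exact hcol _ hb
  have hpar : ∀ w : Fin 2 → ℝ, M.mulVec w = 0 → v 0 * w 1 = v 1 * w 0 := by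
    intro w hw
    by_contra hne
    apply hM
    have hv0 := congrFun hMv 0
    have hv1 := congrFun hMv 1
    have hw0 := congrFun hw 0
    have hw1 := congrFun hw 1
    simp only [Matrix.mulVec, dotProduct, Fin.sum_univ_two, Pi.zero_apply] at hv0 hv1 hw0 hw1
    have hne' : v 0 * w 1 - v 1 * w 0 ≠ 0 := sub_ne_zero.2 hne
    ext i j
    apply mul_left_cancel₀ hne'
    rw [Matrix.zero_apply, mul_zero]
    fin_cases i <;> fin_cases j <;> simp only [Fin.zero_eta, Fin.mk_one, Fin.isValue]
    · linear_combination w 1 * hv0 - v 1 * hw0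
    · linear_combination v 0 * hw0 - w 0 * hv0
    · linear_combination w 1 * hv1 - v 1 * hw1
    · linear_combination v 0 * hw1 - w 0 * hv1
  obtain ⟨l, hl⟩ := exists_eq_smul hv (hpar _ hav)
  obtain ⟨m, hm⟩ := exists_eq_smul hv (hpar _ hbv)
  refine Matrix.exists_mulVec_eq_zero_iff.1 ⟨v, hv, ?_⟩
  rw [Matrix.sub_mulVec, ← Matrix.mulVec_mulVec, ← Matrix.mulVec_mulVec, hl, hm,
    Matrix.mulVec_smul, Matrix.mulVec_smul, hl, hm, smul_smul, smul_smul, mul_comm, sub_self]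

/-! ### Integers of totally real fields -/

open NumberField InfinitePlace in
/-- A non-zero integer of a totally real field is not small at one real place and bounded at the
others. -/
theorem one_le_abs_mul_pow {F : Type} [Field F] [NumberField F] [NumberField.IsTotallyReal F]
    (σ₀ : F →+* ℝ) {x : F} (hx : IsIntegral ℤ x) (hx0 : x ≠ 0) {M : ℝ} (hM : 1 ≤ M)
    (h : ∀ σ : F →+* ℝ, σ ≠ σ₀ → |σ x| ≤ M) :
    1 ≤ |σ₀ x| * M ^ Fintype.card (InfinitePlace F) := by
  classical
  set w₀ : InfinitePlace F := InfinitePlace.mk (Complex.ofRealHom.comp σ₀) with hw₀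
  have h0 : w₀ x = |σ₀ x| := by
    rw [hw₀, InfinitePlace.apply]
    change ‖((σ₀ x : ℝ) : ℂ)‖ = _
    rw [Complex.norm_real, Real.norm_eq_abs]
  have hw : ∀ w : InfinitePlace F, w ≠ w₀ → w x ≤ M := by
    intro w hne
    have hreal := IsTotallyReal.isReal w
    rw [← norm_embedding_of_isReal hreal, Real.norm_eq_abs]
    refine h _ fun heq => hne ?_
    rw [hw₀, ← heq]
    refine (mk_embedding w).symm.trans (congrArg InfinitePlace.mk ?_)
    ext y
    exact (embedding_of_isReal_apply hreal y).symm
  -- All places being real, the product is the absolute value of the norm, a non-zero rational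
  -- integer.
  have hprod : (1 : ℝ) ≤ ∏ w : InfinitePlace F, w x := by
    have h1 := prod_eq_abs_norm x
    simp only [IsTotallyReal.mult_eq, pow_one] at h1
    rw [h1]
    have h2 : IsIntegral ℤ (Algebra.norm ℚ x) := Algebra.isIntegral_norm ℚ hx
    obtain ⟨n, hn⟩ := IsIntegrallyClosed.isIntegral_iff.1 h2
    have hn0 : n ≠ 0 := by
      rintro rfl
      rw [map_zero] at hn
      exact hx0 (Algebra.norm_eq_zero_iff.1 hn.symm)
    rw [← hn]
    have := Int.one_le_abs hn0
    simp only [eq_intCast, ← Int.cast_abs, Rat.cast_intCast]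
    exact_mod_cast this
  rw [← Finset.mul_prod_erase _ _ (Finset.mem_univ w₀), h0] at hprod
  refine hprod.trans (mul_le_mul_of_nonneg_left ?_ (abs_nonneg _))
  calc ∏ w ∈ Finset.univ.erase w₀, w x
      ≤ ∏ _w ∈ Finset.univ.erase w₀, M :=
        Finset.prod_le_prod (fun w _ => apply_nonneg w x)
          fun w hwm => hw w (Finset.ne_of_mem_erase hwm)
    _ = M ^ (Finset.univ.erase w₀).card := Finset.prod_const _
    _ ≤ M ^ Fintype.card (InfinitePlace F) :=
        pow_le_pow_right₀ hM (Finset.card_le_univ _)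

/-! ### Orders in quaternion algebras -/

/-- The order `𝓞_F + 𝓞_F i + 𝓞_F j + 𝓞_F k`. -/
def order {F : Type} [Field F] (α β : F) (hα : IsIntegral ℤ α) (hβ : IsIntegral ℤ β) :
    Subring ℍ[F,α,β] where
  carrier := {u | IsIntegral ℤ u.re ∧ IsIntegral ℤ u.imI ∧ IsIntegral ℤ u.imJ ∧ IsIntegral ℤ u.imK}
  one_mem' := by simp [isIntegral_one, isIntegral_zero]
  zero_mem' := by simp [isIntegral_zero]
  add_mem' := by
    rintro u v ⟨h1, h2, h3, h4⟩ ⟨k1, k2, k3, k4⟩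
    exact ⟨h1.add k1, h2.add k2, h3.add k3, h4.add k4⟩
  neg_mem' := by
    rintro u ⟨h1, h2, h3, h4⟩
    exact ⟨h1.neg, h2.neg, h3.neg, h4.neg⟩
  mul_mem' := by
    rintro u v ⟨h1, h2, h3, h4⟩ ⟨k1, k2, k3, k4⟩
    refine ⟨?_, ?_, ?_, ?_⟩
    · simp only [QuaternionAlgebra.re_mul]
      exact (((h1.mul k1).add ((hα.mul h2).mul k2)).add ((hβ.mul h3).mul k3)).add
        (((isIntegral_zero.mul hβ).mul h3).mul k4) |>.sub (((hα.mul hβ).mul h4).mul k4)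
    · simp only [QuaternionAlgebra.imI_mul, zero_mul, add_zero]
      exact (((h1.mul k2).add (h2.mul k1)).sub ((hβ.mul h3).mul k4)).add ((hβ.mul h4).mul k3)
    · simp only [QuaternionAlgebra.imJ_mul, zero_mul, add_zero]
      exact (((h1.mul k3).add ((hα.mul h2).mul k4)).add (h3.mul k1)).sub ((hα.mul h4).mul k2)
    · simp only [QuaternionAlgebra.imK_mul, zero_mul, add_zero]
      exact (((h1.mul k4).add (h2.mul k3)).sub (h3.mul k2)).add (h4.mul k1)

section Quaternion

variable {F : Type} [Field F] {α β : F}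

theorem star_mem_order {hα : IsIntegral ℤ α} {hβ : IsIntegral ℤ β} {u : ℍ[F,α,β]}
    (hu : u ∈ order α β hα hβ) : star u ∈ order α β hα hβ := by
  obtain ⟨h1, h2, h3, h4⟩ := hu
  refine ⟨?_, ?_, ?_, ?_⟩
  · simpa using h1
  · simpa using h2.neg
  · simpa using h3.neg
  · simpa using h4.neg

theorem smul_mem_order {hα : IsIntegral ℤ α} {hβ : IsIntegral ℤ β} {u : ℍ[F,α,β]} {c : F}
    (hc : IsIntegral ℤ c) (hu : u ∈ order α β hα hβ) : c • u ∈ order α β hα hβ := by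
  obtain ⟨h1, h2, h3, h4⟩ := hu
  exact ⟨hc.mul h1, hc.mul h2, hc.mul h3, hc.mul h4⟩

theorem add_star_eq (u : ℍ[F,α,β]) : u + star u = ((2 * u.re : F) : ℍ[F,α,β]) := by
  rw [QuaternionAlgebra.self_add_star', zero_mul, add_zero]

theorem star_mul_self_of_mul_star {u : ℍ[F,α,β]} (hu : u * star u = 1) : star u * u = 1 := by
  rw [← hu]; exact star_comm_self' u

theorem mul_star_mul_eq_one {u v : ℍ[F,α,β]} (hu : u * star u = 1) (hv : v * star v = 1) :
    (u * v) * star (u * v) = 1 := by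
  rw [star_mul, mul_assoc, ← mul_assoc v, hv, one_mul, hu]

theorem star_mul_star_eq_one {u : ℍ[F,α,β]} (hu : u * star u = 1) :
    star u * star (star u) = 1 := by
  rw [star_star, star_mul_self_of_mul_star hu]

/-- At a ramified real place, the reduced trace of an element of norm one is bounded. -/
theorem abs_re_le_one {σ : F →+* ℝ} (hα : σ α < 0) (hβ : σ β < 0) {u : ℍ[F,α,β]}
    (hu : u * star u = 1) : |σ u.re| ≤ 1 := by
  have h1 := congrArg (fun z : ℍ[F,α,β] => σ z.re) hu
  simp only [QuaternionAlgebra.re_mul, QuaternionAlgebra.re_star, QuaternionAlgebra.imI_star,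
    QuaternionAlgebra.imJ_star, QuaternionAlgebra.imK_star, QuaternionAlgebra.re_one, map_add,
    map_sub, map_mul, map_neg, map_one, map_zero] at h1
  -- With `σ α, σ β < 0` the norm form `re² - α imI² - β imJ² + αβ imK²` is positive definite.
  rw [← sq_le_one_iff_abs_le_one]
  have h2 : 0 ≤ -σ α * σ u.imI ^ 2 := mul_nonneg (by linarith) (sq_nonneg _)
  have h3 : 0 ≤ -σ β * σ u.imJ ^ 2 := mul_nonneg (by linarith) (sq_nonneg _)
  have h4 : 0 ≤ σ α * σ β * σ u.imK ^ 2 :=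
    mul_nonneg (mul_pos_of_neg_of_neg hα hβ).le (sq_nonneg _)
  nlinarith

variable (σ₀ : F →+* ℝ) (φ : ℍ[F,α,β] →+* Matrix (Fin 2) (Fin 2) ℝ)

/-- The images of `i` and `j` anticommute and have invertible scalar squares, so those of `i`, `j`
and `ij` have trace zero. -/
theorem trace_map (hα : α ≠ 0) (hβ : β ≠ 0)
    (hφ : ∀ c : F, φ (c : ℍ[F,α,β]) = σ₀ c • (1 : Matrix (Fin 2) (Fin 2) ℝ)) (u : ℍ[F,α,β]) :
    (φ u).trace = σ₀ (2 * u.re) := by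
  let i : ℍ[F,α,β] := ⟨0, 1, 0, 0⟩
  let j : ℍ[F,α,β] := ⟨0, 0, 1, 0⟩
  have hii : i * i = ((α : F) : ℍ[F,α,β]) := by ext <;> simp [i]
  have hjj : j * j = ((β : F) : ℍ[F,α,β]) := by ext <;> simp [j]
  have hij : i * j = -(j * i) := by ext <;> simp [i, j]
  have hu : u = (u.re : ℍ[F,α,β]) + (u.imI : ℍ[F,α,β]) * i + (u.imJ : ℍ[F,α,β]) * j +
      (u.imK : ℍ[F,α,β]) * (i * j) := by ext <;> simp [i, j]
  have hij' : φ i * φ j = -(φ j * φ i) := by rw [← map_mul, hij, map_neg, map_mul]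
  have hα' : σ₀ α ≠ 0 := (map_ne_zero σ₀).2 hα
  have hβ' : σ₀ β ≠ 0 := (map_ne_zero σ₀).2 hβ
  have ti : (φ i).trace = 0 := by
    have h1 : (φ i * (φ j * φ j)).trace = σ₀ β * (φ i).trace := by
      rw [← map_mul, hjj, hφ, Matrix.mul_smul, mul_one, Matrix.trace_smul, smul_eq_mul]
    have h2 : (φ i * (φ j * φ j)).trace = -(φ i * (φ j * φ j)).trace := by
      conv_lhs => rw [← mul_assoc, hij', neg_mul, Matrix.trace_neg, mul_assoc,
        Matrix.trace_mul_comm, mul_assoc]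
    have h3 : σ₀ β * (φ i).trace = 0 := by linarith
    exact (mul_eq_zero.1 h3).resolve_left hβ'
  have tj : (φ j).trace = 0 := by
    have h1 : (φ j * (φ i * φ i)).trace = σ₀ α * (φ j).trace := by
      rw [← map_mul, hii, hφ, Matrix.mul_smul, mul_one, Matrix.trace_smul, smul_eq_mul]
    have h2 : (φ j * (φ i * φ i)).trace = -(φ j * (φ i * φ i)).trace := by
      have hji' : φ j * φ i = -(φ i * φ j) := by rw [hij', neg_neg]
      conv_lhs => rw [← mul_assoc, hji', neg_mul, Matrix.trace_neg, mul_assoc,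
        Matrix.trace_mul_comm, mul_assoc]
    have h3 : σ₀ α * (φ j).trace = 0 := by linarith
    exact (mul_eq_zero.1 h3).resolve_left hα'
  have tk : (φ i * φ j).trace = 0 := by
    have h1 : (φ i * φ j).trace = -(φ i * φ j).trace := by
      conv_lhs => rw [hij', Matrix.trace_neg, Matrix.trace_mul_comm]
    linarith
  have hc : ∀ (c : F) (M : Matrix (Fin 2) (Fin 2) ℝ), M.trace = 0 →
      (φ (c : ℍ[F,α,β]) * M).trace = 0 := by
    intro c M hM
    rw [hφ, Matrix.smul_mul, one_mul, Matrix.trace_smul, hM, smul_zero]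
  conv_lhs => rw [hu]
  simp only [map_add, map_mul, Matrix.trace_add]
  rw [hc _ _ ti, hc _ _ tj, hc _ _ tk, hφ, Matrix.trace_smul, Matrix.trace_one, map_ofNat,
    Fintype.card_fin, smul_eq_mul]
  push_cast
  ring

/-- Both conjugations are "trace minus the element", and `φ` respects traces. -/
theorem map_star_eq_adjugate (hα : α ≠ 0) (hβ : β ≠ 0)
    (hφ : ∀ c : F, φ (c : ℍ[F,α,β]) = σ₀ c • (1 : Matrix (Fin 2) (Fin 2) ℝ)) (u : ℍ[F,α,β]) :
    φ (star u) = (φ u).adjugate := by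
  have h1 : star u = ((2 * u.re : F) : ℍ[F,α,β]) - u := by rw [← add_star_eq, add_sub_cancel_left]
  rw [h1, map_sub, hφ, ← trace_map σ₀ φ hα hβ hφ, Matrix.adjugate_fin_two, Matrix.trace_fin_two]
  ext i j
  fin_cases i <;> fin_cases j <;> simp

theorem map_smul_eq (hφ : ∀ c : F, φ (c : ℍ[F,α,β]) = σ₀ c • (1 : Matrix (Fin 2) (Fin 2) ℝ))
    (c : F) (u : ℍ[F,α,β]) : φ (c • u) = σ₀ c • φ u := by
  rw [← QuaternionAlgebra.coe_mul_eq_smul, map_mul, hφ, Matrix.smul_mul, one_mul]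

end Quaternion

/-! ### Unipotent units from zero divisors -/

/-- Lets a unipotent unit be replaced by a power that lies in the commensurable group `Γ` without
becoming trivial. -/
theorem pow_ne_one_of_trace_eq_two {g : G} (hg : (g : Matrix (Fin 2) (Fin 2) ℝ).trace = 2)
    (hg1 : g ≠ 1) {n : ℕ} (hn : 0 < n) :
    ((g ^ n : G) : Matrix (Fin 2) (Fin 2) ℝ).trace = 2 ∧ g ^ n ≠ 1 := by
  obtain ⟨k, t, hkt⟩ := exists_conj_eq_h hg
  have hpow : ∀ n : ℕ, h t ^ n = h (n * t) := by
    intro n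
    induction n with
    | zero => simp [h_zero]
    | succ n ih => rw [pow_succ, ih, h_mul_h]; congr 1; push_cast; ring
  have e : k * g ^ n * k⁻¹ = h (n * t) := by rw [← hpow, ← hkt, conj_pow]
  have ht : t ≠ 0 := by
    rintro rfl
    rw [h_zero] at hkt
    exact hg1 (by simpa using (mul_inv_eq_one.1 hkt))
  constructor
  · have h1 : ((k * g ^ n * k⁻¹ : G) : Matrix (Fin 2) (Fin 2) ℝ).trace = 2 := by
      rw [e, coe_h, Matrix.trace_fin_two_of]; norm_num
    rwa [Matrix.SpecialLinearGroup.coe_mul, Matrix.trace_mul_comm,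
      ← Matrix.SpecialLinearGroup.coe_mul, inv_mul_cancel_left] at h1
  · intro h1
    rw [h1, mul_one, mul_inv_cancel] at e
    have h2 := congrArg (fun g : G => (g : Matrix (Fin 2) (Fin 2) ℝ) 0 1) e
    simp [coe_h, ht, hn.ne'] at h2

section Quaternion

variable {F : Type} [Field F] {α β : F} (σ₀ : F →+* ℝ)
  (φ : ℍ[F,α,β] →+* Matrix (Fin 2) (Fin 2) ℝ)

/-- A zero divisor of the order gives rise to a unipotent unit of norm one. -/
theorem exists_unipotent_of_det_eq_zero {hαi : IsIntegral ℤ α} {hβi : IsIntegral ℤ β}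
    (hα : α ≠ 0) (hβ : β ≠ 0)
    (hφ : ∀ c : F, φ (c : ℍ[F,α,β]) = σ₀ c • (1 : Matrix (Fin 2) (Fin 2) ℝ))
    {w u v : ℍ[F,α,β]} (hw : w ∈ order α β hαi hβi) (hu : u ∈ order α β hαi hβi)
    (hv : v ∈ order α β hαi hβi) (hw0 : φ w ≠ 0) (hdet : (φ w).det = 0)
    (huv : (φ u * φ v - φ v * φ u).det ≠ 0) :
    ∃ g ∈ normOneUnits α β hαi hβi φ, (g : Matrix (Fin 2) (Fin 2) ℝ).trace = 2 ∧ g ≠ 1 := by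
  have hstar := map_star_eq_adjugate σ₀ φ hα hβ hφ
  obtain ⟨z, hz, hz0⟩ : ∃ z ∈ order α β hαi hβi, φ w * φ z * (φ w).adjugate ≠ 0 := by
    by_contra hcon
    push Not at hcon
    exact huv (det_commutator_eq_zero_of_mul_adjugate hw0 hdet (hcon u hu) (hcon v hv))
  have hww : w * star w = 0 := by
    rw [QuaternionAlgebra.mul_star_eq_coe]
    have h1 : φ (w * star w) = 0 := by
      rw [map_mul, hstar, Matrix.mul_adjugate, hdet, zero_smul]
    rw [QuaternionAlgebra.mul_star_eq_coe, hφ] at h1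
    have h2 := congrFun (congrFun h1 0) 0
    simp only [Matrix.smul_apply, Matrix.one_apply_eq, smul_eq_mul, mul_one,
      Matrix.zero_apply] at h2
    rw [(map_eq_zero σ₀).1 h2, QuaternionAlgebra.coe_zero]
  have hww' : star w * w = 0 := by rw [← star_comm_self' w] at hww; exact hww
  -- As `w` has reduced norm 0, so does `n`, and its reduced trace is `tr(z)` times that norm, also
  -- 0. Hence `1 + n` has norm 1 and trace 2; `z` was chosen to make it differ from 1 under `φ`.
  set n := w * z * star w with hn
  have hnstar : star n = w * star z * star w := by
    rw [hn, star_mul, star_mul, star_star, mul_assoc]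
  have hnn : n * star n = 0 := by
    rw [hnstar, hn, show w * z * star w * (w * star z * star w) =
      w * z * (star w * w) * (star z * star w) by simp only [mul_assoc], hww', mul_zero, zero_mul]
  have hn0 : n + star n = 0 := by
    rw [hnstar, hn, ← add_mul, ← mul_add, add_star_eq, ← QuaternionAlgebra.coe_commutes, mul_assoc,
      hww, mul_zero]
  have hone : (1 + n) * star (1 + n) = 1 := by
    rw [star_add, star_one, mul_add, mul_one, add_mul, one_mul, hnn, add_zero, add_assoc, hn0,
      add_zero]
  have hmem : 1 + n ∈ order α β hαi hβi :=
    add_mem (one_mem _) (mul_mem (mul_mem hw hz) (star_mem_order hw))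
  have hre : (1 + n).re = 1 := by
    have h1 := add_star_eq n
    rw [hn0] at h1
    have h2 := congrArg QuaternionAlgebra.re h1
    rw [QuaternionAlgebra.re_zero, QuaternionAlgebra.re_coe] at h2
    have h3 : σ₀ n.re = 0 := by
      have h4 := congrArg σ₀ h2
      rw [map_zero, map_mul, map_ofNat] at h4
      linarith
    rw [QuaternionAlgebra.re_add, (map_eq_zero σ₀).1 h3, QuaternionAlgebra.re_one, add_zero]
  have hdet1 : (φ (1 + n)).det = 1 := by
    have h1 := congrArg φ hone
    rw [map_mul, hstar, Matrix.mul_adjugate, map_one] at h1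
    have h2 := congrFun (congrFun h1 0) 0
    simpa using h2
  refine ⟨⟨φ (1 + n), hdet1⟩, ⟨1 + n, hmem, hone, rfl⟩, ?_, ?_⟩
  · change (φ (1 + n)).trace = 2
    rw [trace_map σ₀ φ hα hβ hφ, hre, mul_one, map_ofNat]
  · intro h1
    have h2 : φ (1 + n) = 1 := congrArg Subtype.val h1
    rw [map_add, map_one, add_eq_left, hn, map_mul, map_mul, hstar] at h2
    exact hz0 h2

/-! ### The intertwiner -/

/-- The reduced trace of `u * w` at `σ`, for `u` of norm one, is bounded by `2 c`. -/
def TraceBd (σ : F →+* ℝ) (w : ℍ[F,α,β]) (c : ℝ) : Prop :=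
  ∀ u : ℍ[F,α,β], u * star u = 1 → |σ (u * w).re| ≤ c

theorem traceBd_one {σ : F →+* ℝ} (hα : σ α < 0) (hβ : σ β < 0) :
    TraceBd σ (1 : ℍ[F,α,β]) 1 := fun u hu => by
  rw [mul_one]; exact abs_re_le_one hα hβ hu

theorem TraceBd.abs_re_le {σ : F →+* ℝ} {w : ℍ[F,α,β]} {c : ℝ} (hw : TraceBd σ w c) :
    |σ w.re| ≤ c := by
  have := hw 1 (by simp)
  rwa [one_mul] at this

/-- The bound quantifies over all norm-one multipliers, so multiplication by `v` or `star v` is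
absorbed. This bounds reduced traces of products without bounding coordinates. -/
theorem TraceBd.sub_star_mul {σ : F →+* ℝ} {w v : ℍ[F,α,β]} {c : ℝ} (hw : TraceBd σ w c)
    (hv : v * star v = 1) : TraceBd σ ((v - star v) * w) (2 * c) := by
  intro u hu
  rw [← mul_assoc, mul_sub, sub_mul, QuaternionAlgebra.re_sub, map_sub]
  have h1 := hw _ (mul_star_mul_eq_one hu hv)
  have h2 := hw _ (mul_star_mul_eq_one hu (star_mul_star_eq_one hv))
  exact (abs_sub _ _).trans (by linarith)

theorem TraceBd.sub {σ : F →+* ℝ} {w v : ℍ[F,α,β]} {c d : ℝ} (hw : TraceBd σ w c)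
    (hv : TraceBd σ v d) : TraceBd σ (w - v) (c + d) := by
  intro u hu
  rw [mul_sub, QuaternionAlgebra.re_sub, map_sub]
  exact (abs_sub _ _).trans (add_le_add (hw u hu) (hv u hu))

/-- For `a, b` and `a', b'`, an element `ω` with `a ω = ω a'`, `b ω = ω b'` in case the pairs are
conjugate. -/
def intertwiner (a b a' b' : ℍ[F,α,β]) : ℍ[F,α,β] :=
  (4 * ((a * b).re ^ 2 - (a * a).re * (b * b).re)) • (1 : ℍ[F,α,β]) +
    (a * b - b * a) * (a' * b' - b' * a') - (4 * (b * b).re) • (a * a') +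
    (4 * (a * b).re) • (a * b' + b * a') - (4 * (a * a).re) • (b * b')

theorem isIntegral_natCast {n : ℕ} : IsIntegral ℤ (n : F) := by
  have : (n : F) = algebraMap ℤ F n := by simp
  rw [this]; exact isIntegral_algebraMap

theorem intertwiner_mem_order {hαi : IsIntegral ℤ α} {hβi : IsIntegral ℤ β}
    {a b a' b' : ℍ[F,α,β]} (ha : a ∈ order α β hαi hβi) (hb : b ∈ order α β hαi hβi)
    (ha' : a' ∈ order α β hαi hβi) (hb' : b' ∈ order α β hαi hβi) :
    intertwiner a b a' b' ∈ order α β hαi hβi := by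
  have h4 : IsIntegral ℤ (4 : F) := by exact_mod_cast isIntegral_natCast (F := F) (n := 4)
  have haa := (mul_mem ha ha).1
  have hbb := (mul_mem hb hb).1
  have hab := (mul_mem ha hb).1
  refine sub_mem (add_mem (sub_mem (add_mem (smul_mem_order (h4.mul ((hab.pow 2).sub
    (haa.mul hbb))) (one_mem _)) (mul_mem (sub_mem (mul_mem ha hb) (mul_mem hb ha))
    (sub_mem (mul_mem ha' hb') (mul_mem hb' ha')))) ?_) ?_) ?_
  · exact smul_mem_order (h4.mul hbb) (mul_mem ha ha')
  · exact smul_mem_order (h4.mul hab) (add_mem (mul_mem ha hb') (mul_mem hb ha'))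
  · exact smul_mem_order (h4.mul haa) (mul_mem hb hb')

/-- Each double product has trace bound 4, so `32 = 16 + 16`; the five terms of the intertwiner
contribute `128 + 64 + 64 + 128 + 64 = 448`. -/
theorem abs_re_intertwiner_le {σ : F →+* ℝ} (hα : σ α < 0) (hβ : σ β < 0)
    {a b a' b' : ℍ[F,α,β]} (ha : a * star a = 1) (hb : b * star b = 1) (ha' : a' * star a' = 1)
    (hb' : b' * star b' = 1) :
    |σ (((a - star a) * (b - star b)).re ^ 2 - ((a - star a) * (a - star a)).re *
      ((b - star b) * (b - star b)).re)| ≤ 32 ∧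
    |σ (intertwiner (a - star a) (b - star b) (a' - star a') (b' - star b')).re| ≤ 448 := by
  have h1 := traceBd_one hα hβ
  have h2 : ∀ u v : ℍ[F,α,β], u * star u = 1 → v * star v = 1 →
      TraceBd σ ((u - star u) * (v - star v)) 4 := fun u v hu hv => by
    have := (h1.sub_star_mul hv).sub_star_mul hu
    rw [mul_one] at this
    norm_num at this
    exact this
  have h3 : ∀ u v w : ℍ[F,α,β], ∀ c : ℝ, TraceBd σ w c → u * star u = 1 → v * star v = 1 →
      TraceBd σ ((u - star u) * (v - star v) * w) (4 * c) := fun u v w c hw hu hv => by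
    have := (hw.sub_star_mul hv).sub_star_mul hu
    rw [← mul_assoc] at this
    convert this using 1; ring
  have hP := (h2 a a ha ha).abs_re_le
  have hQ := (h2 b b hb hb).abs_re_le
  have hW := (h2 a b ha hb).abs_re_le
  have hAA := (h2 a a' ha ha').abs_re_le
  have hBB := (h2 b b' hb hb').abs_re_le
  have hAB := (h2 a b' ha hb').abs_re_le
  have hBA := (h2 b a' hb ha').abs_re_le
  have h8 := (h2 a' b' ha' hb').sub (h2 b' a' hb' ha')
  have hG := ((h3 a b _ _ h8 ha hb).sub (h3 b a _ _ h8 hb ha)).abs_re_le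
  rw [← sub_mul] at hG
  unfold intertwiner
  simp only [QuaternionAlgebra.re_add, QuaternionAlgebra.re_sub, QuaternionAlgebra.re_smul,
    QuaternionAlgebra.re_one, smul_eq_mul, mul_one, map_add, map_sub, map_mul, map_pow, map_ofNat]
    at *
  generalize σ ((a - star a) * (a - star a)).re = P at *
  generalize σ ((b - star b) * (b - star b)).re = Q at *
  generalize σ ((a - star a) * (b - star b)).re = W at *
  generalize σ ((a - star a) * (a' - star a')).re = X₁ at *
  generalize σ ((b - star b) * (b' - star b')).re = X₂ at *
  generalize σ ((a - star a) * (b' - star b')).re = X₃ at *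
  generalize σ ((b - star b) * (a' - star a')).re = X₄ at *
  have mulb : ∀ {x y c d : ℝ}, |x| ≤ c → |y| ≤ d → |x * y| ≤ c * d := fun hx hy => by
    rw [abs_mul]; exact mul_le_mul hx hy (abs_nonneg _) ((abs_nonneg _).trans hx)
  have m1 := abs_le.1 (mulb hP hQ)
  have m2 := abs_le.1 (mulb hW hW)
  have m3 := abs_le.1 (mulb hQ hAA)
  have m4 := abs_le.1 (mulb hW hAB)
  have m5 := abs_le.1 (mulb hW hBA)
  have m6 := abs_le.1 (mulb hP hBB)
  have m7 := abs_le.1 hG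
  constructor <;> rw [abs_le] <;> constructor <;> linarith

end Quaternion

section Quaternion

variable {F : Type} [Field F] {α β : F} (σ₀ : F →+* ℝ)
  (φ : ℍ[F,α,β] →+* Matrix (Fin 2) (Fin 2) ℝ)

/-- The Casimir identity for `m = T'`, multiplied by `T` on the right: each `X T' Y T` becomes a
product of `X` with a conjugate of `Y`, hence comes from the algebra. -/
theorem map_intertwiner (hα : α ≠ 0) (hβ : β ≠ 0)
    (hφ : ∀ c : F, φ (c : ℍ[F,α,β]) = σ₀ c • (1 : Matrix (Fin 2) (Fin 2) ℝ))
    {a b a' b' : ℍ[F,α,β]} {T T' : Matrix (Fin 2) (Fin 2) ℝ} (hT : T' * T = 1) (hT' : T * T' = 1)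
    (ha : (φ a).trace = 0) (hb : (φ b).trace = 0) (ha' : φ a' = T' * φ a * T)
    (hb' : φ b' = T' * φ b * T) :
    φ (intertwiner a b a' b') =
      (8 * σ₀ ((a * b).re ^ 2 - (a * a).re * (b * b).re) * T'.trace) • T := by
  have htr : ∀ u v : ℍ[F,α,β], 2 * σ₀ (u * v).re = (φ u * φ v).trace := fun u v => by
    rw [← map_mul, trace_map σ₀ φ hα hβ hφ, map_mul, map_ofNat]
  have h1 := casimir_identity (φ a) (φ b) T' ha hb _ _ _ (htr a a) (htr b b) (htr a b)
  have h2 := congrArg (fun X => X * T) h1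
  simp only [Matrix.smul_mul, one_mul, add_mul, sub_mul] at h2
  have h3 : ∀ X : Matrix (Fin 2) (Fin 2) ℝ, T * (T' * X) = X := fun X => by
    rw [← mul_assoc, hT', one_mul]
  rw [map_sub, map_pow, map_mul, ← h2]
  unfold intertwiner
  simp only [map_add, map_sub, map_mul, map_smul_eq σ₀ φ hφ, ha', hb', map_pow, map_ofNat, map_one,
    sub_mul, mul_sub, mul_assoc, h3, hT]
  abel

end Quaternion

/-! ### Arithmetic rigidity of commensurating elements -/

/-- An element that conjugates a finite index subgroup of an arithmetic lattice into the lattice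
and whose squared trace is close to `(p + q)² / (p q)` has large index. -/
theorem exists_arithmetic_rigidity [MeasurableSpace G] [BorelSpace G] (μ : Measure G)
    [μ.IsHaarMeasure] (Γ : Subgroup G) [DiscreteTopology Γ] [Countable Γ]
    [CompactSpace (G ⧸ Γ)] (hΓ : IsArithmetic Γ) :
    ∃ (C : ℝ) (d : ℕ), 0 < C ∧ ∀ (θ : G) (p q : ℕ) (N η : ℝ), 0 < p → 0 < q → p ≠ q →
      (conjBy θ Γ).relIndex Γ ≠ 0 → ((conjBy θ Γ).relIndex Γ : ℝ) ≤ N →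
      |p * q * (θ : Matrix (Fin 2) (Fin 2) ℝ).trace ^ 2 - (p + q) ^ 2| ≤ η →
      1 ≤ C * N ^ 4 * ((p + q : ℝ) ^ 2) ^ d * η := by
  obtain ⟨F, _, _, _, α, β, hαi, hβi, σ₀, φ, hα, hβ, hφ, hram, hcomm⟩ := hΓ
  obtain ⟨C₁, hC₁, hshort⟩ := exists_short_noncommuting μ Γ (isCompact_singleton (x := (1 : G)))
  set Λ := normOneUnits α β hαi hβi φ with hΛ
  set d := Fintype.card (NumberField.InfinitePlace F) with hd
  set m := Λ.relIndex Γ with hm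
  have hm0 : m ≠ 0 := hcomm.2
  have hm1 : (1 : ℝ) ≤ m := by exact_mod_cast Nat.one_le_iff_ne_zero.2 hm0
  refine ⟨1024 * (C₁ * m ^ 2) ^ 4 * 2000 ^ d, d, by positivity, ?_⟩
  intro θ p q N η hp hq hpq hθ hθN htrace
  have hp' : (0 : ℝ) < p := by exact_mod_cast hp
  have hq' : (0 : ℝ) < q := by exact_mod_cast hq
  have hη : 0 ≤ η := (abs_nonneg _).trans htrace
  obtain ⟨hΔ0, hΔN⟩ := relIndex_inf_conjBy_le hm0 hθ
  obtain ⟨a, ⟨⟨haΓ, ha⟩, haθ⟩, b, ⟨⟨hbΓ, hb⟩, hbθ⟩, hab, hBa, hBb⟩ :=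
    hshort 1 rfl _ (inf_le_left.trans inf_le_left) hΔ0
  have hB : C₁ * (((Γ ⊓ Λ) ⊓ conjBy θ (Γ ⊓ Λ)).relIndex Γ : ℝ) ≤ C₁ * m ^ 2 * N := by
    rw [mul_assoc]
    refine mul_le_mul_of_nonneg_left ?_ (by linarith)
    calc ((((Γ ⊓ Λ) ⊓ conjBy θ (Γ ⊓ Λ)).relIndex Γ : ℕ) : ℝ)
        ≤ ((m ^ 2 * (conjBy θ Γ).relIndex Γ : ℕ) : ℝ) := by exact_mod_cast hΔN
      _ ≤ m ^ 2 * N := by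
        push_cast; exact mul_le_mul_of_nonneg_left hθN (by positivity)
  rw [one_mul, inv_one, mul_one] at hBa hBb
  replace hBa := hBa.mono hB
  replace hBb := hBb.mono hB
  set B := C₁ * m ^ 2 * N with hBdef
  obtain ⟨-, ha'⟩ := mem_conjBy.1 haθ
  obtain ⟨-, hb'⟩ := mem_conjBy.1 hbθ
  obtain ⟨ua, hua, hua1, hφua⟩ := ha
  obtain ⟨ub, hub, hub1, hφub⟩ := hb
  obtain ⟨va, hva, hva1, hφva⟩ := ha'
  obtain ⟨vb, hvb, hvb1, hφvb⟩ := hb'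
  replace hua : ua ∈ order α β hαi hβi := hua
  replace hub : ub ∈ order α β hαi hβi := hub
  replace hva : va ∈ order α β hαi hβi := hva
  replace hvb : vb ∈ order α β hαi hβi := hvb
  have hstar := map_star_eq_adjugate σ₀ φ hα hβ hφ
  have htm := trace_map σ₀ φ hα hβ hφ
  have hanti : ∀ (u : ℍ[F,α,β]) (g : G), φ u = g →
      φ (u - star u) = (g : Matrix (Fin 2) (Fin 2) ℝ) - ((g⁻¹ : G) : Matrix (Fin 2) (Fin 2) ℝ) := by
    intro u g hu
    rw [map_sub, hstar, hu, Matrix.SpecialLinearGroup.coe_inv]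
  have hanti0 : ∀ u : ℍ[F,α,β], (φ (u - star u)).trace = 0 := by
    intro u
    rw [htm, QuaternionAlgebra.re_sub, QuaternionAlgebra.re_star]; simp
  have hconj : ∀ g : G, ((θ⁻¹ * g * θ : G) : Matrix (Fin 2) (Fin 2) ℝ) -
      (((θ⁻¹ * g * θ)⁻¹ : G) : Matrix (Fin 2) (Fin 2) ℝ) =
      ((θ⁻¹ : G) : Matrix (Fin 2) (Fin 2) ℝ) * ((g : Matrix (Fin 2) (Fin 2) ℝ) -
        ((g⁻¹ : G) : Matrix (Fin 2) (Fin 2) ℝ)) * θ := by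
    intro g
    rw [mul_sub, sub_mul, ← Matrix.SpecialLinearGroup.coe_mul, ← Matrix.SpecialLinearGroup.coe_mul,
      ← Matrix.SpecialLinearGroup.coe_mul, ← Matrix.SpecialLinearGroup.coe_mul]
    simp [mul_assoc]
  set A := ua - star ua with hA
  set Bq := ub - star ub with hBq
  set A' := va - star va with hA'
  set B' := vb - star vb with hB'
  have hφA := (hanti ua a hφua : φ A = _)
  have hφB := (hanti ub b hφub : φ Bq = _)
  have hφA' := (hanti va _ hφva : φ A' = _)
  have hφB' := (hanti vb _ hφvb : φ B' = _)
  have hAo : A ∈ order α β hαi hβi := sub_mem hua (star_mem_order hua)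
  have hBo : Bq ∈ order α β hαi hβi := sub_mem hub (star_mem_order hub)
  have hAo' : A' ∈ order α β hαi hβi := sub_mem hva (star_mem_order hva)
  have hBo' : B' ∈ order α β hαi hβi := sub_mem hvb (star_mem_order hvb)
  set k : F := (A * Bq).re ^ 2 - (A * A).re * (Bq * Bq).re with hk
  -- An element of the order that maps to `8 σ₀(k) tr(θ) · θ`; its reduced trace at `σ₀` is `8 σ₀(k)
  -- tr(θ)²`, which brings the squared trace into `F`.
  set ω := intertwiner A Bq A' B' with hω
  have hωo : ω ∈ order α β hαi hβi := intertwiner_mem_order hAo hBo hAo' hBo'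
  set τ := (θ : Matrix (Fin 2) (Fin 2) ℝ).trace with hτ
  have hφω : φ ω = (8 * σ₀ k * τ) • (θ : Matrix (Fin 2) (Fin 2) ℝ) := by
    rw [hω, map_intertwiner σ₀ φ hα hβ hφ (T := θ) (T' := (θ⁻¹ : G)) ?_ ?_ (hanti0 _) (hanti0 _)
      ?_ ?_, trace_coe_inv]
    · rw [← Matrix.SpecialLinearGroup.coe_mul, inv_mul_cancel, Matrix.SpecialLinearGroup.coe_one]
    · rw [← Matrix.SpecialLinearGroup.coe_mul, mul_inv_cancel, Matrix.SpecialLinearGroup.coe_one]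
    · rw [hφA', hconj, hφA]
    · rw [hφB', hconj, hφB]
  have hkdet : σ₀ k = -4 * ((a : Matrix (Fin 2) (Fin 2) ℝ) * b -
      (b : Matrix (Fin 2) (Fin 2) ℝ) * a).det := by
    have htr : ∀ u v : ℍ[F,α,β], 2 * σ₀ (u * v).re = (φ u * φ v).trace := fun u v => by
      rw [← map_mul, htm, map_mul, map_ofNat]
    rw [← det_commutator (a : Matrix (Fin 2) (Fin 2) ℝ) (b : Matrix (Fin 2) (Fin 2) ℝ)
      (σ₀ (A * A).re) (σ₀ (Bq * Bq).re) (σ₀ (A * Bq).re), hk, map_sub, map_pow, map_mul]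
    · rw [htr, hφA, Matrix.SpecialLinearGroup.coe_inv]
    · rw [htr, hφB, Matrix.SpecialLinearGroup.coe_inv]
    · rw [htr, hφB, hφA, Matrix.SpecialLinearGroup.coe_inv,
        Matrix.SpecialLinearGroup.coe_inv]
  -- Otherwise the commutator of `a` and `b` would be unipotent in `Γ`, hence trivial.
  have hdet0 : ((a : Matrix (Fin 2) (Fin 2) ℝ) * b - (b : Matrix (Fin 2) (Fin 2) ℝ) * a).det ≠ 0 := by
    intro h0
    have h1 := eq_one_of_trace_eq_two (Γ.mul_mem (Γ.mul_mem (Γ.mul_mem haΓ hbΓ) (Γ.inv_mem haΓ))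
      (Γ.inv_mem hbΓ)) (trace_commutator_eq_two h0)
    apply hab
    rw [mul_inv_eq_one, mul_inv_eq_iff_eq_mul] at h1
    exact h1
  have hk0 : σ₀ k ≠ 0 := by
    rw [hkdet]; exact mul_ne_zero (by norm_num) hdet0
  have hkB : |σ₀ k| ≤ 128 * B ^ 4 := by
    have h1 := (hBa.mul hBb).sub (hBb.mul hBa)
    rw [hkdet, abs_mul, Matrix.det_fin_two]
    set X := (a : Matrix (Fin 2) (Fin 2) ℝ) * b - (b : Matrix (Fin 2) (Fin 2) ℝ) * a
    have h2 : ∀ i j i' j', |X i j * X i' j'| ≤ (2 * B * B + 2 * B * B) * (2 * B * B + 2 * B * B) :=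
      fun i j i' j' => by
        rw [abs_mul]; exact mul_le_mul (h1 _ _) (h1 _ _) (abs_nonneg _) h1.nonneg
    have h3 := (abs_sub (X 0 0 * X 1 1) (X 0 1 * X 1 0)).trans (add_le_add (h2 0 0 1 1) (h2 0 1 1 0))
    rw [abs_neg, abs_of_pos (by norm_num : (0 : ℝ) < 4)]
    linarith
  -- An algebraic integer with `σ₀ x = 8 σ₀(k) (pq tr(θ)² - (p+q)²)`: tiny at `σ₀` by hypothesis,
  -- moderate at the ramified places.
  set x : F := p * q * (2 * ω.re) - 8 * k * (p + q) ^ 2 with hx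
  have hint : IsIntegral ℤ x := by
    have h2 : IsIntegral ℤ (2 : F) := by exact_mod_cast isIntegral_natCast (F := F) (n := 2)
    have h8 : IsIntegral ℤ (8 : F) := by exact_mod_cast isIntegral_natCast (F := F) (n := 8)
    have hki : IsIntegral ℤ k :=
      ((mul_mem hAo hBo).1.pow 2).sub ((mul_mem hAo hAo).1.mul (mul_mem hBo hBo).1)
    exact ((isIntegral_natCast.mul isIntegral_natCast).mul (h2.mul hωo.1)).sub
      ((h8.mul hki).mul ((isIntegral_natCast.add isIntegral_natCast).pow 2))
  have hσω : σ₀ (2 * ω.re) = 8 * σ₀ k * τ ^ 2 := by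
    rw [← htm, hφω, Matrix.trace_smul, smul_eq_mul]; ring
  have hσx : σ₀ x = 8 * σ₀ k * (p * q * τ ^ 2 - (p + q) ^ 2) := by
    rw [hx, map_sub, map_mul, hσω]
    simp only [map_mul, map_pow, map_add, map_natCast, map_ofNat]
    ring
  have hpq1 : (1 : ℝ) ≤ ((p : ℝ) + q) ^ 2 := by
    have : (1 : ℝ) ≤ p := by exact_mod_cast hp
    nlinarith
  by_cases hx0 : x = 0
  · exfalso
    have h1 : p * q * τ ^ 2 = ((p : ℝ) + q) ^ 2 := by
      rw [hx0, map_zero] at hσx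
      have := (mul_eq_zero.1 hσx.symm).resolve_left (mul_ne_zero (by norm_num) hk0)
      linarith
    -- If `x = 0`, the eigenvalues of `qτθ` are `p + q` and `(p + q)q/p`. So `w` is singular under
    -- `φ`, and it is non-zero there precisely because `p ≠ q`.
    set w : ℍ[F,α,β] := (q : F) • ω - (8 * k * (p + q)) • (1 : ℍ[F,α,β]) with hw
    have hwo : w ∈ order α β hαi hβi := by
      have h8 : IsIntegral ℤ (8 : F) := by exact_mod_cast isIntegral_natCast (F := F) (n := 8)
      have hki : IsIntegral ℤ k :=
        ((mul_mem hAo hBo).1.pow 2).sub ((mul_mem hAo hAo).1.mul (mul_mem hBo hBo).1)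
      exact sub_mem (smul_mem_order isIntegral_natCast hωo) (smul_mem_order ((h8.mul hki).mul
        (isIntegral_natCast.add isIntegral_natCast)) (one_mem _))
    have hφw : φ w = (8 * σ₀ k) • ((q * τ) • (θ : Matrix (Fin 2) (Fin 2) ℝ) -
        ((p : ℝ) + q) • (1 : Matrix (Fin 2) (Fin 2) ℝ)) := by
      rw [hw, map_sub, map_smul_eq σ₀ φ hφ, map_smul_eq σ₀ φ hφ, hφω, map_one, smul_sub, smul_smul,
        smul_smul, smul_smul]
      simp only [map_mul, map_add, map_natCast, map_ofNat]
      congr 2; ring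
    have hdetθ := det_entries θ
    have hτ' : τ = θ 0 0 + θ 1 1 := Matrix.trace_fin_two _
    have hdetw : (φ w).det = 0 := by
      rw [hφw, Matrix.det_smul, Matrix.det_fin_two]
      simp only [Matrix.sub_apply, Matrix.smul_apply, smul_eq_mul, Matrix.one_apply_eq, mul_one]
      have e01 : (1 : Matrix (Fin 2) (Fin 2) ℝ) 0 1 = 0 := by simp
      have e10 : (1 : Matrix (Fin 2) (Fin 2) ℝ) 1 0 = 0 := by simp
      rw [e01, e10]
      apply mul_eq_zero_of_right
      linear_combination (q * τ) ^ 2 * hdetθ + q * τ * (p + q) * hτ' - h1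
    have hw0 : φ w ≠ 0 := by
      intro h0
      have h2 := congrArg Matrix.trace h0
      rw [hφw, Matrix.trace_smul, Matrix.trace_sub, Matrix.trace_smul, Matrix.trace_smul,
        Matrix.trace_one, Matrix.trace_zero, ← hτ, smul_eq_mul, smul_eq_mul, smul_eq_mul] at h2
      have h3 := (mul_eq_zero.1 h2).resolve_left (mul_ne_zero (by norm_num) hk0)
      rw [Fintype.card_fin] at h3
      push_cast at h3
      have h4 : ((p : ℝ) + q) * (q - p) = 0 := by linear_combination p * h3 - h1
      have h5 : (q : ℝ) - p = 0 := (mul_eq_zero.1 h4).resolve_left (by positivity)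
      exact hpq (by exact_mod_cast (sub_eq_zero.1 h5).symm)
    obtain ⟨g, hg, hg2, hg1⟩ := exists_unipotent_of_det_eq_zero σ₀ φ hα hβ hφ hwo hua hub hw0 hdetw
      (by rw [hφua, hφub]; exact hdet0)
    obtain ⟨n, hn, -, hgn⟩ := Subgroup.exists_pow_mem_of_relIndex_ne_zero hcomm.1 hg
    obtain ⟨h2, h3⟩ := pow_ne_one_of_trace_eq_two hg2 hg1 hn
    exact h3 (eq_one_of_trace_eq_two hgn.1 h2)
  · have h1 := one_le_abs_mul_pow σ₀ hint hx0 (M := 2000 * ((p : ℝ) + q) ^ 2) (by linarith) (by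
      intro σ hσ
      obtain ⟨hσα, hσβ⟩ := hram σ hσ
      obtain ⟨b1, b2⟩ := abs_re_intertwiner_le hσα hσβ hua1 hub1 hva1 hvb1
      have e : σ x = p * q * (2 * σ ω.re) - 8 * σ k * (p + q) ^ 2 := by
        rw [hx]; simp only [map_sub, map_mul, map_pow, map_add, map_natCast, map_ofNat]
      rw [e]
      have hpq2 : (p : ℝ) * q ≤ (p + q) ^ 2 := by nlinarith
      have hpq0 : (0 : ℝ) < p * q := by positivity
      calc |p * q * (2 * σ ω.re) - 8 * σ k * (p + q) ^ 2|
          ≤ |p * q * (2 * σ ω.re)| + |8 * σ k * (p + q) ^ 2| := abs_sub _ _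
        _ = p * q * (2 * |σ ω.re|) + 8 * |σ k| * (p + q) ^ 2 := by
          rw [abs_mul, abs_of_pos hpq0, abs_mul, abs_of_pos (zero_lt_two' ℝ), abs_mul, abs_mul,
            abs_of_nonneg (sq_nonneg ((p : ℝ) + q)), abs_of_pos (by norm_num : (0 : ℝ) < 8)]
        _ ≤ (p + q) ^ 2 * (2 * 448) + 8 * 32 * (p + q) ^ 2 := by
          gcongr
        _ ≤ 2000 * ((p : ℝ) + q) ^ 2 := by nlinarith)
    have h2 : |σ₀ x| ≤ 1024 * B ^ 4 * η := by
      rw [hσx, abs_mul, abs_mul, abs_of_pos (by norm_num : (0 : ℝ) < 8)]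
      calc 8 * |σ₀ k| * |p * q * τ ^ 2 - (p + q) ^ 2| ≤ 8 * (128 * B ^ 4) * η :=
            mul_le_mul (by linarith) htrace (abs_nonneg _) (by positivity)
        _ = 1024 * B ^ 4 * η := by ring
    refine h1.trans ((mul_le_mul_of_nonneg_right h2 (by positivity)).trans (le_of_eq ?_))
    rw [hBdef, mul_pow, mul_pow (2000 : ℝ)]
    ring

end Horocycle

/-! ### Choice of exponents and conclusion -/

theorem lemma4p1 [MeasurableSpace Horocycle.G] [BorelSpace Horocycle.G]
    (μ : MeasureTheory.Measure Horocycle.G) [μ.IsHaarMeasure]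
    (Γ : Subgroup Horocycle.G) (hΓ : Horocycle.IsCocompactArithmeticLattice Γ)
    (A₁ A₂ : ℝ) (hA₁ : 0 < A₁) (hA₂ : 0 < A₂) :
    ∃ δ₀ : ℝ, 0 < δ₀ ∧ ∀ δ : ℝ, 0 < δ → δ < δ₀ →
      ∃ T₀ : ℝ, ∀ T : ℝ, T₀ ≤ T →
        ∀ x : Horocycle.G ⧸ Γ, ∀ p q : ℕ, 0 < p → 0 < q → p ≠ q →
          (p : ℝ) ≤ T ^ (δ ^ 2) → (q : ℝ) ≤ T ^ (δ ^ 2) →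
            ¬ Horocycle.E2 μ Γ A₁ A₂ (T ^ (δ / (1000 * A₁ * A₂))) T
              (Horocycle.a (-Real.log p) • x, Horocycle.a (-Real.log q) • x) := by
  have := hΓ.discrete
  have := hΓ.cocompact
  have : Countable Γ := TopologicalSpace.separableSpace_iff_countable.1 inferInstance
  obtain ⟨C₁, hC₁, hcomm⟩ := Horocycle.exists_commensurating_trace μ Γ
  obtain ⟨C₂, d, hC₂, hrigid⟩ := Horocycle.exists_arithmetic_rigidity μ Γ hΓ.arithmetic
  have hD : 0 < 2 * (2 * (d : ℝ) + 3 + 1 / A₂) := by positivity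
  -- Chosen so that `δ(2d + 3) + 1000κ < 1/2` for the `κ` below; the final exponent `2δ(d+1) + 8κ -
  -- (1 - δ)` is then at most `-1/2`.
  refine ⟨1 / (2 * (2 * d + 3 + 1 / A₂)), by positivity, fun δ hδ hδ₀ => ?_⟩
  rw [lt_div_iff₀ hD] at hδ₀
  have hδ1 : δ ≤ 1 := by
    have h1 : 0 ≤ δ * (1 / A₂) := by positivity
    have h2 : 0 ≤ δ * d := by positivity
    linarith
  -- The exponent with `R^{A₁} = T^κ`.
  set κ := δ / (1000 * A₂) with hκ
  have hκ0 : 0 < κ := by positivity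
  have hδκ : δ * (1 / A₂) = 1000 * κ := by rw [hκ]; field_simp
  set K := C₂ * C₁ ^ 5 * 4 ^ (d + 1) with hK
  have lim : ∀ c y : ℝ, 0 < y → ∀ᶠ T : ℝ in Filter.atTop, c * T ^ (-y) < 1 := fun c y hy => by
    have h := (tendsto_rpow_neg_atTop hy).const_mul c
    rw [mul_zero] at h
    exact h.eventually_lt_const zero_lt_one
  obtain ⟨T₀, hT₀⟩ := Filter.eventually_atTop.1 ((Filter.eventually_ge_atTop (1 : ℝ)).and
    -- `983 = 1000 - 16 - 1`: the distance decays like `T^(-1000κ)`, against a factor `T^κ` in E2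
    -- and `ρ^16 = T^(16κ)` in the separation condition.
    ((lim (C₁ * 2 ^ (1 / A₂)) (983 * κ) (by positivity)).and (lim K (1 / 2) (by norm_num))))
  refine ⟨T₀, fun T hT x p q hp hq hpq hpT hqT hE2 => ?_⟩
  obtain ⟨hT1, hTE, hTK⟩ := hT₀ T hT
  have hT0 : 0 < T := by linarith
  obtain ⟨P₀, hvol, hE2⟩ := hE2
  obtain ⟨g₁, g₂, hg, hdist⟩ := hE2 0 ⟨le_rfl, hT0.le⟩
  have hρ : (T ^ (δ / (1000 * A₁ * A₂))) ^ A₁ = T ^ κ := by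
    rw [← Real.rpow_mul hT0.le, hκ]
    congr 1; field_simp
  rw [hρ] at hvol hg hdist
  -- Short enough that `(1 + s)/T ≤ 2T^(-δ)` on `[0, L]`, so the orbit is close throughout; long
  -- enough that the factor `1/L` in the trace estimate beats all losses.
  set L := T ^ (1 - δ) with hL
  have hL1 : 1 ≤ L := Real.one_le_rpow hT1 (by linarith)
  have hLT : L ≤ T := (Real.rpow_le_rpow_of_exponent_le hT1 (by linarith)).trans_eq (Real.rpow_one T)
  have hLdiv : L / T = T ^ (-δ) := by
    rw [hL, Real.rpow_sub hT0, Real.rpow_neg hT0.le, Real.rpow_one]; field_simp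
  set E := T ^ κ * (2 * T ^ (-δ)) ^ (1 / A₂) with hE
  have hE0 : 0 < E := by positivity
  have hρ1 : 1 ≤ T ^ κ := Real.one_le_rpow hT1 hκ0.le
  have hEC : C₁ * (T ^ κ) ^ 16 * E < 1 := by
    refine lt_of_eq_of_lt ?_ hTE
    rw [hE, Real.mul_rpow (by norm_num) (by positivity), ← Real.rpow_mul hT0.le, neg_mul, hδκ,
      ← Real.rpow_natCast, ← Real.rpow_mul hT0.le]
    rw [show -(983 * κ) = κ * (16 : ℕ) + κ + -(1000 * κ) by push_cast; ring, Real.rpow_add hT0,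
      Real.rpow_add hT0]
    ring
  obtain ⟨θ, hθ0, hθN, hθ⟩ := hcomm x p q P₀ g₁ g₂ (T ^ κ) L E hp hq hρ1 hL1 hE0 hEC
    (fun i j => (hg i j).1.le) (fun i j => (hg i j).2.le) hvol fun s hs => by
      refine (hdist s ⟨hs.1, hs.2.trans hLT⟩).trans (ENNReal.ofReal_le_ofReal ?_)
      rw [hE, sub_zero, abs_of_nonneg hs.1]
      have h1 : (1 + s) / T ≤ 2 * T ^ (-δ) := by
        rw [← hLdiv, ← mul_div_assoc]
        gcongr
        linarith [hs.2]
      have h2 : 0 ≤ (1 + s) / T := div_nonneg (by linarith [hs.1]) hT0.le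
      gcongr
  have hfin := hrigid θ p q _ _ hp hq hpq hθ0 hθN hθ
  refine hfin.not_gt (lt_of_le_of_lt ?_ hTK)
  -- The weaker bound `p, q ≤ T^δ` suffices here, as `δ ≤ 1`.
  have hpq2 : ((p : ℝ) + q) ^ 2 ≤ 4 * T ^ (2 * δ) := by
    have h1 : T ^ (δ ^ 2) ≤ T ^ δ := Real.rpow_le_rpow_of_exponent_le hT1 (by nlinarith)
    calc ((p : ℝ) + q) ^ 2 ≤ (2 * T ^ δ) ^ 2 := by gcongr; linarith
      _ = 4 * T ^ (2 * δ) := by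
        rw [two_mul δ, Real.rpow_add hT0]; ring
  calc C₂ * (C₁ * T ^ κ) ^ 4 * (((p : ℝ) + q) ^ 2) ^ d *
        (((p : ℝ) + q) ^ 2 * (C₁ * (T ^ κ) ^ 4 / L))
      = C₂ * C₁ ^ 5 * (((p : ℝ) + q) ^ 2) ^ (d + 1) * ((T ^ κ) ^ 8 / L) := by ring
    _ ≤ C₂ * C₁ ^ 5 * (4 * T ^ (2 * δ)) ^ (d + 1) * ((T ^ κ) ^ 8 / L) := by gcongr
    _ = K * T ^ (2 * δ * (d + 1 : ℕ) + κ * (8 : ℕ) - (1 - δ)) := by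
      rw [Real.rpow_sub hT0, Real.rpow_add hT0, Real.rpow_mul hT0.le (2 * δ), Real.rpow_mul hT0.le κ,
        Real.rpow_natCast, Real.rpow_natCast, mul_pow, hK, hL]
      ring
    _ ≤ K * T ^ (-(1 / 2 : ℝ)) := by
      refine mul_le_mul_of_nonneg_left (Real.rpow_le_rpow_of_exponent_le hT1 ?_) (by positivity)
      push_cast
      linarith
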